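/- \textbf{Setting.} Let $n\ge 3$ and let $(\mathbb H^n,b)$ be hyperbolic space in the ball model, $b=\big(\tfrac{2}{1-|y|^2}\big)^2\delta$ on $\{|y|<1\}$, with $r=\operatorname{arcosh}\tfrac{1+|y|^2}{1-|y|^2}$ the distance to the origin and $B_R=\{r<R\}$. For a tensor field $T$ defined near infinity, $T=\mathcal O_p(e^{-lr})$ means that $|\nabla_b^qT|_b\le Ce^{-lr}$ for all $q\le p$ outside some ball, and $\mathcal O=\mathcal O_0$. Put $$V_{(0)}=\tfrac{1+|y|^2}{1-|y|^2}=\cosh r,\qquad V_{(i)}=\tfrac{2y^i}{1-|y|^2},\qquad C_{(i)}=-\tfrac{1+|y|^2}{2}\,\partial_{y^i}+y^iy^j\,\partial_{y^j},\qquad i=1,\dots,n.$$ For symmetric $2$-tensors $\gamma,\kappa$ near infinity, a function $V$ and a vector field $Y$ let $$\mathbb U_{(V,Y)}(\gamma,\kappa)=V(\operatorname{div}_b\gamma-d\operatorname{tr}_b\gamma)-\iota_{\nabla_bV}\gamma+(\operatorname{tr}_b\gamma)\,dV+2\big(\iota_Y\kappa-(\operatorname{tr}_b\kappa)Y^\flat\big),$$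 $$\mathbb F^R_{(V,Y)}(\gamma,\kappa)=\int_{\{r=R\}}\mathbb U_{(V,Y)}(\gamma,\kappa)(\nu_b)\,d\mu_b,\qquad \mathbb Q_{(V,Y)}(\gamma,\kappa)=\lim_{R\to\infty}\mathbb F^R_{(V,Y)}(\gamma,\kappa),$$ with $\nu_b$ the outward unit normal; the charge $\mathbb Q_{(V,Y)}$ is well-defined if the limit exists in $\mathbb R$. For a metric $g$ and a symmetric $2$-tensor $k$, with $\Lambda=-\tfrac{n(n-1)}2$, let $$\mu=\mathrm{Scal}_g-2\Lambda+(\operatorname{tr}_gk)^2-|k|_g^2,\qquad J=\operatorname{div}_gk-d\operatorname{tr}_gk.$$ Let $M$ be a smooth $n$-manifold, $K\subset M$ compact, $R_0>0$, and $\varphi:M\setminus K\to\mathbb H^n\setminus\overline B_{R_0}$ a diffeomorphism; tensor fields on $M\setminus K$ are identified with their push-forwards by $\varphi$. For $t\in\mathbb R$ let $g(t)$ be a Riemannian metric and $k(t)$ a symmetric $2$-tensor field on $M$, such that for some $T>0$ they are smooth in $(t,y)$ on $(-T,T)\times(\mathbb H^n\setminus\overline B_{R_0})$ and satisfy there the Einstein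 evolution equations with cosmological constant $\Lambda$, lapse $N=V_{(0)}$ and shift $0$, $$\partial_tg=2Nk,\qquad \partial_tk=\nabla^2_gN-N\Big(\mathrm{Ric}_g+(\operatorname{tr}_gk)k-2\,k\circ k-\tfrac{2\Lambda}{n-1}g\Big)+N\Big(S+\tfrac{\mu/2-\operatorname{tr}_gS}{n-1}\,g\Big),$$ where $(k\circ k)_{ij}=g^{lm}k_{il}k_{mj}$ and $S=S(t)$ is an arbitrary $2$-tensor family, the spatial stress tensor of the matter (in vacuum $S=0$ and $\mu=0$). Let $\tau>\tfrac n2$ and $\varepsilon>0$. Consider the decay conditions, for $(g,k,\mu,J)=(g(t),k(t),\mu(t),J(t))$, $$(\ast)\qquad g-b=\mathcal O_2(e^{-\tau r}),\quad k=\mathcal O_1(e^{-\tau r}),\quad k=\mathcal O(e^{-(\tau+1)r}),\quad \mu=\mathcal O(e^{-(n+\varepsilon)r}),\quad J=\mathcal O(e^{-(n+1+\varepsilon)r}).$$ Write $\gamma(t)=g(t)-b$, $\kappa(t)=k(t)$, and $\mathbb Q_{(V,Y)}(t)=\mathbb Q_{(V,Y)}(\gamma(t),\kappa(t))$, $\mathbb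 F^R_{(V,Y)}(t)=\mathbb F^R_{(V,Y)}(\gamma(t),\kappa(t))$. \textbf{Theorem.} Assume that $(\ast)$ holds at $t=0$. (i) The charges $\mathbb Q_{(V_{(0)},0)}(0)$, $\mathbb Q_{(V_{(i)},0)}(0)$ and $\mathbb Q_{(0,C_{(i)})}(0)$, $i=1,\dots,n$, are well-defined. (ii) If, for some $0<T'\le T$, the conditions $(\ast)$ hold for all $t\in(-T',T')$ with constants and balls independent of $t$, then $\mathbb Q_{(V_{(0)},0)}(t)$ and $\mathbb Q_{(V_{(i)},0)}(t)$ are well-defined for all $t\in(-T',T')$, they are differentiable at $t=0$, and $$\frac{d}{dt}\Big|_{t=0}\mathbb Q_{(V_{(0)},0)}=0,\qquad \frac{d}{dt}\Big|_{t=0}\mathbb Q_{(V_{(i)},0)}=\mathbb Q_{(0,C_{(i)})}(0),\quad i=1,\dots,n.$$ (iii) If, instead of a condition for $t\neq0$, one has $k(0)=\mathcal O_1(e^{-(\tau+1)r})$, then the same holds with the derivative taken before the limit: for all large $R$ the functions $\mathbb F^R_{(V_{(0)},0)}(t)$ and $\mathbb F^R_{(V_{(i)},0)}(t)$ are differentiable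 at $t=0$, and $$\lim_{R\to\infty}\frac{d}{dt}\Big|_{t=0}\mathbb F^R_{(V_{(0)},0)}=0,\qquad \lim_{R\to\infty}\frac{d}{dt}\Big|_{t=0}\mathbb F^R_{(V_{(i)},0)}=\mathbb Q_{(0,C_{(i)})}(0),\quad i=1,\dots,n.$$ -/

import Mathlib

open Filter Topology Set MeasureTheory
open scoped Manifold ContDiff

noncomputable section

namespace AHData

/-! ### Tensor calculus in the coordinates `y¹, …, yⁿ` of an open subset of `ℝⁿ` -/

/-- Euclidean `ℝⁿ`; its open unit ball carries the Poincaré model of hyperbolic space. -/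
abbrev E (n : ℕ) := EuclideanSpace ℝ (Fin n)

/-- Covariant tensor fields of rank `m`, by their coordinate components. -/
abbrev CovTensor (n m : ℕ) := E n → (Fin m → Fin n) → ℝ

/-- Covariant 2-tensor fields (metrics, second fundamental forms), by their components. -/
abbrev Tensor2 (n : ℕ) := E n → Matrix (Fin n) (Fin n) ℝ

/-- One-forms, by their components `ω_i`. -/
abbrev OneForm (n : ℕ) := E n → Fin n → ℝ

/-- Vector fields, by their components `X^i`. -/
abbrev VField (n : ℕ) := E n → Fin n → ℝ

variable {n m : ℕ}

/-- A function as a tensor field of rank `0`. -/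
def ofFun (f : E n → ℝ) : CovTensor n 0 := fun y _ => f y

/-- A one-form as a tensor field of rank `1`. -/
def ofOneForm (w : OneForm n) : CovTensor n 1 := fun y I => w y (I 0)

/-- A matrix of components as a tensor field of rank `2`. -/
def ofTensor2 (h : Tensor2 n) : CovTensor n 2 := fun y I => h y (I 0) (I 1)

/-- The partial derivative `∂f/∂yⁱ`. -/
def pd (i : Fin n) (f : E n → ℝ) (y : E n) : ℝ :=
  fderiv ℝ f y (EuclideanSpace.single i 1)

/-- The differential `df`. -/
def dif (f : E n → ℝ) : OneForm n := fun y i => pd i f y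

/-- The Christoffel symbol `Γ^l_{ij}` of the metric `G`. -/
def christoffel (G : Tensor2 n) (y : E n) (l i j : Fin n) : ℝ :=
  (1 / 2) * ∑ p, (G y)⁻¹ l p *
    (pd i (fun x => G x p j) y + pd j (fun x => G x p i) y - pd p (fun x => G x i j) y)

/-- The covariant derivative `(∇T)_{i I} = ∇_i T_I`; the first index is the one of the
derivative. -/
def covDeriv (G : Tensor2 n) (T : CovTensor n m) : CovTensor n (m + 1) := fun y I =>
  pd (I 0) (fun x => T x (Fin.tail I)) y
    - ∑ s : Fin m, ∑ l : Fin n,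
        christoffel G y l (I 0) (Fin.tail I s) * T y (Function.update (Fin.tail I) s l)

/-- The iterated covariant derivative `∇^q T`. -/
def iterCovDeriv (G : Tensor2 n) (T : CovTensor n m) : (q : ℕ) → CovTensor n (m + q)
  | 0 => T
  | q + 1 => covDeriv G (iterCovDeriv G T q)

/-- The squared pointwise norm `|T|²_G`. -/
def normSq (G : Tensor2 n) (T : CovTensor n m) (y : E n) : ℝ :=
  ∑ I : Fin m → Fin n, ∑ I' : Fin m → Fin n,
    (∏ s, (G y)⁻¹ (I s) (I' s)) * (T y I * T y I')

/-- The pointwise norm `|T|_G`. -/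
def tnorm (G : Tensor2 n) (T : CovTensor n m) (y : E n) : ℝ := Real.sqrt (normSq G T y)

/-- The trace `tr_G h`. -/
def tr (G h : Tensor2 n) (y : E n) : ℝ := ∑ i, ∑ j, (G y)⁻¹ i j * h y i j

/-- The divergence `(div_G h)_j = G^{il} ∇_l h_{ij}`. -/
def divg (G h : Tensor2 n) : OneForm n := fun y j =>
  ∑ i, ∑ l, (G y)⁻¹ i l * covDeriv G (ofTensor2 h) y ![l, i, j]

/-- The gradient `∇_G f`. -/
def grad (G : Tensor2 n) (f : E n → ℝ) : VField n := fun y i => ∑ j, (G y)⁻¹ i j * pd j f y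

/-- The Hessian `∇²_G f`. -/
def hess (G : Tensor2 n) (f : E n → ℝ) : Tensor2 n := fun y =>
  Matrix.of fun i j => covDeriv G (ofOneForm (dif f)) y ![i, j]

/-- The contraction `(ι_X h)_j = h_{ij} X^i`. -/
def contr (X : VField n) (h : Tensor2 n) : OneForm n := fun y j => ∑ i, X y i * h y i j

/-- The Lie derivative `(L_X h)_{ij}`. -/
def lieDeriv (X : VField n) (h : Tensor2 n) : Tensor2 n := fun y => Matrix.of fun i j =>
  ∑ l, (X y l * pd l (fun x => h x i j) y
    + h y l j * pd i (fun x => X x l) y + h y i l * pd j (fun x => X x l) y)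

/-- The Ricci tensor `Ric_G`. -/
def ricci (G : Tensor2 n) : Tensor2 n := fun y => Matrix.of fun i j =>
  ∑ l, (pd l (fun x => christoffel G x l i j) y - pd j (fun x => christoffel G x l i l) y)
    + ∑ l, ∑ p, (christoffel G y l l p * christoffel G y p i j
        - christoffel G y l j p * christoffel G y p i l)

/-- The scalar curvature `Scal_G`. -/
def scal (G : Tensor2 n) (y : E n) : ℝ := tr G (ricci G) y

/-! ### The constraint and evolution equations -/

/-- The cosmological constant `Λ = -n(n-1)/2`. -/
def cosmo (n : ℕ) : ℝ := -((n : ℝ) * ((n : ℝ) - 1)) / 2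

/-- The energy density `μ = Scal_g - 2Λ + (tr_g k)² - |k|_g²`. -/
def energyDensity (G k : Tensor2 n) (y : E n) : ℝ :=
  scal G y - 2 * cosmo n + tr G k y ^ 2 - normSq G (ofTensor2 k) y

/-- The momentum density `J = div_g k - d tr_g k`. -/
def momentumDensity (G k : Tensor2 n) : OneForm n := fun y j =>
  divg G k y j - pd j (tr G k) y

/-- The right-hand side of the first evolution equation, `∂_t g = 2 N k + L_X g`. -/
def metricRate (N : E n → ℝ) (X : VField n) (G k : Tensor2 n) : Tensor2 n := fun y =>
  (2 * N y) • k y + lieDeriv X G y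

/-- The right-hand side of the second evolution equation,
`∂_t k = ∇²N - N (Ric + (tr k) k - 2 k∘k - (2Λ/(n-1)) g)
          + N (S + ((μ/2 - tr S)/(n-1)) g) + L_X k`.
Here `S` is the spatial stress tensor of the matter, in the units in which the energy density of
the matter is `μ/2`. For `S = 0` and `μ = 0` these are the vacuum equations. -/
def curvatureRate (N : E n → ℝ) (X : VField n) (S G k : Tensor2 n) : Tensor2 n := fun y =>
  hess G N y
    - N y • (ricci G y + tr G k y • k y - (2 : ℝ) • (k y * (G y)⁻¹ * k y)
        - (2 * cosmo n / ((n : ℝ) - 1)) • G y)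
    + N y • (S y + ((energyDensity G k y / 2 - tr G S y) / ((n : ℝ) - 1)) • G y)
    + lieDeriv X k y

/-- On the coordinate domain `U` and for times in `I`, the family `(g(t), k(t))` evolves by the
Einstein evolution equations with cosmological constant `Λ`, lapse `N`, shift `X` and matter
stress tensor `S(t)`. -/
def EinsteinEvolution (I : Set ℝ) (U : Set (E n)) (N : E n → ℝ) (X : VField n)
    (S G k : ℝ → Tensor2 n) : Prop :=
  ∀ t ∈ I, ∀ y ∈ U, ∀ i j : Fin n,
    HasDerivAt (fun s => G s y i j) (metricRate N X (G t) (k t) y i j) t ∧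
    HasDerivAt (fun s => k s y i j) (curvatureRate N X (S t) (G t) (k t) y i j) t

/-! ### Hyperbolic space, its ball model, and decay -/

/-- The hyperbolic metric `b = (2 / (1 - |y|²))² δ` on the unit ball. -/
def hyp (n : ℕ) : Tensor2 n := fun y =>
  ((2 / (1 - ‖y‖ ^ 2)) ^ 2) • (1 : Matrix (Fin n) (Fin n) ℝ)

/-- The hyperbolic distance `r` to the origin of the ball. -/
def rad (y : E n) : ℝ := Real.arcosh ((1 + ‖y‖ ^ 2) / (1 - ‖y‖ ^ 2))

/-- `ℍⁿ ∖ closure (B_R)`: the complement of the closed geodesic ball of radius `R`. -/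
def ext (n : ℕ) (R : ℝ) : Set (E n) := {y | ‖y‖ < 1 ∧ R < rad y}

/-- `T(t) = O_p(e^{-l r})` as `r → ∞`, uniformly for `t ∈ I`: all `b`-covariant derivatives up to
order `p` have `b`-norm at most `C e^{-l r}` outside a ball, with the same constant `C` and the same
ball for all `t ∈ I`. The decay of a single tensor field is the case where `I` is a point. -/
def DecaysOn (I : Set ℝ) (p : ℕ) (l : ℝ) (T : ℝ → CovTensor n m) : Prop :=
  ∃ C ρ : ℝ, ∀ t ∈ I, ∀ y ∈ ext n ρ, ∀ q ≤ p,
    tnorm (hyp n) (iterCovDeriv (hyp n) (T t) q) y ≤ C * Real.exp (-(l * rad y))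

/-! ### Asymptotic charts and initial data -/

/-- A chart at infinity `φ : M ∖ K → ℍⁿ ∖ closure (B_R)`, with `K` compact and `φ` a smooth
diffeomorphism, where `ℍⁿ` is the ball model. -/
structure ChartAtInfinity (n : ℕ) (M : Type*) [TopologicalSpace M] [ChartedSpace (E n) M] where
  /-- The compact set. -/
  K : Set M
  /-- The radius. -/
  R : ℝ
  /-- The diffeomorphism. -/
  φ : OpenPartialHomeomorph M (E n)
  isCompact_K : IsCompact K
  R_pos : 0 < R
  source_eq : φ.source = Kᶜ
  target_eq : φ.target = ext n R
  smooth : ContMDiffOn (𝓡 n) (𝓡 n) ∞ φ φ.source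
  smooth_symm : ContMDiffOn (𝓡 n) (𝓡 n) ∞ φ.symm φ.target

/-- A bilinear form on every tangent space of `M`. -/
abbrev BilinField (n : ℕ) (M : Type*) [TopologicalSpace M] [ChartedSpace (E n) M] :=
  (x : M) → TangentSpace (𝓡 n) x →L[ℝ] TangentSpace (𝓡 n) x →L[ℝ] ℝ

/-- The components of the push-forward `φ_* h` on `ℍⁿ ∖ closure (B_R)`. -/
def ChartAtInfinity.push {M : Type*} [TopologicalSpace M] [ChartedSpace (E n) M]
    (c : ChartAtInfinity n M) (h : BilinField n M) : Tensor2 n := fun y =>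
  Matrix.of fun i j =>
    h (c.φ.symm y)
      (mfderiv (𝓡 n) (𝓡 n) c.φ.symm y (EuclideanSpace.single i (1 : ℝ) : E n))
      (mfderiv (𝓡 n) (𝓡 n) c.φ.symm y (EuclideanSpace.single j (1 : ℝ) : E n))

/-- Smooth Riemannian metrics on `M`. -/
abbrev RMetric (n : ℕ) (M : Type*) [TopologicalSpace M] [ChartedSpace (E n) M]
    [IsManifold (𝓡 n) ∞ M] :=
  Bundle.ContMDiffRiemannianMetric (𝓡 n) ∞ (E n) (fun x : M => TangentSpace (𝓡 n) x)

/-- For `t ∈ I`, `(M, g(t), k(t))` is an asymptotically hyperbolic initial data set of order `τ`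
in a given chart at infinity, `γ(t) = g(t) - b = O₂(e^{-τ r})` and `κ(t) = k(t) = O₁(e^{-τ r})`,
with `k(t) = O(e^{-(τ+1) r})`, `μ(t) = O(e^{-(n+ε) r})` and `J(t) = O(e^{-(n+1+ε) r})`, all
uniformly for `t ∈ I`. -/
structure DataDecay (I : Set ℝ) (τ ε : ℝ) (g k : ℝ → Tensor2 n) : Prop where
  metric : DecaysOn I 2 τ (fun t => ofTensor2 (g t - hyp n))
  second : DecaysOn I 1 τ (fun t => ofTensor2 (k t))
  second_extra : DecaysOn I 0 (τ + 1) (fun t => ofTensor2 (k t))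
  energy : DecaysOn I 0 (n + ε) (fun t => ofFun (energyDensity (g t) (k t)))
  momentum : DecaysOn I 0 (n + 1 + ε) (fun t => ofOneForm (momentumDensity (g t) (k t)))

/-! ### Charges -/

/-- The charge density
`U_{(V,Y)}(γ,κ) = V (div_b γ - d tr_b γ) - ι_{∇V} γ + (tr_b γ) dV + 2 (ι_Y κ - (tr_b κ) Y^♭)`. -/
def chargeDensity (V : E n → ℝ) (Y : VField n) (γ κ : Tensor2 n) : OneForm n := fun y j =>
  V y * (divg (hyp n) γ y j - pd j (tr (hyp n) γ) y)
    - contr (grad (hyp n) V) γ y j + tr (hyp n) γ y * pd j V y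
    + 2 * (contr Y κ y j - tr (hyp n) κ y * contr Y (hyp n) y j)

/-- The outward `b`-unit normal of the geodesic spheres around the origin. -/
def normal : VField n := fun y i => (1 - ‖y‖ ^ 2) / 2 * (y i / ‖y‖)

/-- `∫_{r = R} U_{(V,Y)}(γ,κ)(ν_b) dμ_b`. The sphere `{r = R}` is the Euclidean sphere of radius
`tanh (R/2)`, and `dμ_b = sinh^{n-1} R dμ_σ` with `σ` the round metric of the unit sphere. -/
def flux (V : E n → ℝ) (Y : VField n) (γ κ : Tensor2 n) (R : ℝ) : ℝ :=
  ∫ x : Metric.sphere (0 : E n) 1,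
    (∑ j, chargeDensity V Y γ κ (Real.tanh (R / 2) • (x : E n)) j
        * normal (Real.tanh (R / 2) • (x : E n)) j) * Real.sinh R ^ (n - 1)
    ∂((volume : Measure (E n)).toSphere)

/-- The charge `Q_{(V,Y)}(γ,κ)` is well-defined: the limit of the fluxes exists. -/
def ChargeExists (V : E n → ℝ) (Y : VField n) (γ κ : Tensor2 n) : Prop :=
  ∃ q : ℝ, Tendsto (flux V Y γ κ) atTop (𝓝 q)

/-- The charge `Q_{(V,Y)}(γ,κ) = lim_{R → ∞} ∫_{r = R} U_{(V,Y)}(γ,κ)(ν_b) dμ_b`. -/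
def charge (V : E n → ℝ) (Y : VField n) (γ κ : Tensor2 n) : ℝ :=
  limUnder atTop (flux V Y γ κ)

/-- `V_(0) = (1 + |y|²) / (1 - |y|²)`. -/
def V₀ : E n → ℝ := fun y => (1 + ‖y‖ ^ 2) / (1 - ‖y‖ ^ 2)

/-- `V_(i) = 2 yⁱ / (1 - |y|²)`. -/
def Vᵢ (i : Fin n) : E n → ℝ := fun y => 2 * y i / (1 - ‖y‖ ^ 2)

/-- `C_(i) = -((1 + |y|²)/2) ∂_i + yⁱ yʲ ∂_j`. -/
def Cᵢ (i : Fin n) : VField n := fun y j =>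
  -((1 + ‖y‖ ^ 2) / 2) * (if j = i then 1 else 0) + y i * y j

end AHData

end

/-! In the ball model b = ω²δ with ω = 2/(1-|y|²), and ω is comparable to e^r. Decay conditions
therefore become powers of ω for coordinate components: writing g = ω²(δ + h) and k = ω²q, one has
h, q = O(ω^{-τ}), and each coordinate derivative costs one factor ω.

Convergence. The flux of a one-form U through the geodesic sphere of radius R is the Euclidean flux
of ω^{n-2}U through the sphere of radius tanh(R/2), and its R-derivative is an integral of the
divergence of U (`hasDerivAt_eflux`, `hasDerivAt_hflux`). If div_b U = O(e^{-(n-1+δ)r}), the flux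
converges exponentially fast (`exists_limit_hflux`). Because ∇²V = Vb, the divergence of the charge
one-form of V is V times the linearised scalar curvature (`div_potDensity`); because Y is Killing,
that of Y is 2Y paired with div_b k - d tr_b k (`div_killDensity`). Both linearisations agree with
the constraint quantities up to quadratic errors (`scal_expansion`, `momentum_expansion`). These are
small enough since 2τ > n: a common rate is any δ > 0 with δ ≤ ε and n + δ ≤ 2τ.

Time derivative. Inserting ∂_t g = 2 V_(0) k into the charge one-form of V gives the charge one-form
of Y = V∇V_(0) - V_(0)∇V plus 2 V_(0) V (div_b k - d tr_b k) (`hasDerivAt_potUp`). This Y is 0 for V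
= V_(0) and C_(i) for V = V_(i) (`conjugate_V₀`, `conjugate_Vᵢ`). It remains to see that the last
term, with its weight V_(0)V of order ω², has vanishing flux in the limit. The decay of J is just
enough for that, but passing from g to b in the divergence costs (g^{-1} - b^{-1})∇k, which is one
power of ω too large when only k = O_1(e^{-τr}). Under k = O_1(e^{-(τ+1)r}) it is small enough, and
the fluxes themselves can be differentiated (`hasDerivAt_flux`).

Under the weaker hypothesis the flux is modified beforehand: the derivative terms of the charge are
contracted with g^{-1} instead of b^{-1} (`potUp`). This does not change the limit, and the time
derivative now produces `divTrUp`, which differs from J only by terms without derivatives of k; for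
these the bound k = O(e^{-(τ+1)r}) suffices. Uniformity in t makes the time derivatives of the
modified fluxes converge uniformly, so limit and derivative commute (`hasDerivAt_charge`). -/

namespace AHData

variable {n m : ℕ}

/-! ### The conformal factor -/

/-- The conformal factor `ω = 2 / (1 - |y|²)` of the ball model. -/
noncomputable def om (y : E n) : ℝ := 2 / (1 - ‖y‖ ^ 2)

lemma one_sub_pos {y : E n} (hy : ‖y‖ < 1) : 0 < 1 - ‖y‖ ^ 2 := by
  nlinarith [norm_nonneg y]

lemma two_le_om {y : E n} (hy : ‖y‖ < 1) : 2 ≤ om y := by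
  rw [om, le_div_iff₀ (one_sub_pos hy)]; nlinarith [norm_nonneg y]

lemma om_pos {y : E n} (hy : ‖y‖ < 1) : 0 < om y := by linarith [two_le_om hy]

lemma om_mul_sq {y : E n} (hy : ‖y‖ < 1) : om y * ‖y‖ ^ 2 = om y - 2 := by
  have := one_sub_pos hy
  rw [om]; field_simp; ring

lemma V₀_eq_om {y : E n} (hy : ‖y‖ < 1) : V₀ y = om y - 1 := by
  have := one_sub_pos hy
  rw [om, V₀]; field_simp; ring

lemma Vᵢ_eq_om (i : Fin n) (y : E n) : Vᵢ i y = om y * y i := by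
  rw [om, Vᵢ]; ring

lemma one_le_V₀ {y : E n} (hy : ‖y‖ < 1) : 1 ≤ V₀ y := by
  rw [V₀_eq_om hy]; linarith [two_le_om hy]

lemma cosh_rad {y : E n} (hy : ‖y‖ < 1) : Real.cosh (rad y) = om y - 1 := by
  rw [← V₀_eq_om hy]; exact Real.cosh_arcosh (one_le_V₀ hy)

lemma rad_nonneg {y : E n} (hy : ‖y‖ < 1) : 0 ≤ rad y := Real.arcosh_nonneg (one_le_V₀ hy)

lemma exp_rad_le {y : E n} (hy : ‖y‖ < 1) : Real.exp (rad y) ≤ 2 * om y := by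
  have := cosh_rad hy
  rw [Real.cosh_eq] at this
  linarith [Real.exp_pos (-rad y)]

lemma om_le_exp_rad {y : E n} (hy : ‖y‖ < 1) : om y ≤ 2 * Real.exp (rad y) := by
  have := cosh_rad hy
  rw [Real.cosh_eq] at this
  have h1 : Real.exp (-rad y) ≤ 1 := Real.exp_le_one_iff.2 (by linarith [rad_nonneg hy])
  have h2 : 1 ≤ Real.exp (rad y) := Real.one_le_exp (rad_nonneg hy)
  linarith

/-- The sign of the exponent decides which of the two comparisons is used; the constant 2^|l| covers
both cases. It is applied to ω and e^r. -/
lemma rpow_le_of_comparable {a b l : ℝ} (ha : 0 < a) (hb : 0 < b) (hab : a ≤ 2 * b)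
    (hba : b ≤ 2 * a) : a ^ l ≤ 2 ^ |l| * b ^ l := by
  rcases le_total 0 l with hl | hl
  · rw [abs_of_nonneg hl, ← Real.mul_rpow (by norm_num) hb.le]
    exact Real.rpow_le_rpow ha.le hab hl
  · rw [abs_of_nonpos hl, Real.rpow_neg (by norm_num), ← Real.inv_rpow (by norm_num),
      ← Real.mul_rpow (by norm_num) hb.le]
    exact Real.rpow_le_rpow_of_nonpos (by positivity) (by linarith) hl

lemma exp_rad_mul_le (l : ℝ) {y : E n} (hy : ‖y‖ < 1) :
    Real.exp (l * rad y) ≤ 2 ^ |l| * om y ^ l := by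
  rw [mul_comm, Real.exp_mul]
  exact rpow_le_of_comparable (Real.exp_pos _) (om_pos hy) (exp_rad_le hy) (om_le_exp_rad hy)

lemma om_rpow_le (l : ℝ) {y : E n} (hy : ‖y‖ < 1) :
    om y ^ l ≤ 2 ^ |l| * Real.exp (l * rad y) := by
  rw [mul_comm l, Real.exp_mul]
  exact rpow_le_of_comparable (om_pos hy) (Real.exp_pos _) (om_le_exp_rad hy) (exp_rad_le hy)

lemma isOpen_ext (R : ℝ) : IsOpen (ext n R) := by
  have hc : ContinuousOn (fun y : E n => rad y) (Metric.ball 0 1) := by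
    refine Real.continuousOn_arcosh.comp ?_ ?_
    · refine ContinuousOn.div (by fun_prop) (by fun_prop) fun y hy => ?_
      have := one_sub_pos (y := y) (by simpa using hy)
      exact this.ne'
    · intro y hy
      exact one_le_V₀ (by simpa using hy)
  have := hc.isOpen_inter_preimage Metric.isOpen_ball (isOpen_Ioi (a := R))
  convert this using 1
  ext y; simp [AHData.ext]

lemma ext_mono {R R' : ℝ} (h : R ≤ R') : ext n R' ⊆ ext n R := fun _ hy => ⟨hy.1, h.trans_lt hy.2⟩

/-! ### Partial derivatives -/

/-- `f` is differentiable at `y` with `∂_i f = f'`. -/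
def HasPd (i : Fin n) (f : E n → ℝ) (f' : ℝ) (y : E n) : Prop :=
  DifferentiableAt ℝ f y ∧ pd i f y = f'

lemma hasPd_pd {f : E n → ℝ} {y : E n} (i : Fin n) (h : DifferentiableAt ℝ f y) :
    HasPd i f (pd i f y) y := ⟨h, rfl⟩

namespace HasPd

variable {i : Fin n} {f g : E n → ℝ} {f' g' : ℝ} {y : E n}

lemma congr_deriv (h : HasPd i f f' y) (e : f' = g') : HasPd i f g' y := e ▸ h

lemma congr_of_eventuallyEq (h : HasPd i f f' y) (e : g =ᶠ[𝓝 y] f) : HasPd i g f' y :=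
  ⟨h.1.congr_of_eventuallyEq e, by rw [pd, e.fderiv_eq]; exact h.2⟩

lemma add (hf : HasPd i f f' y) (hg : HasPd i g g' y) :
    HasPd i (fun x => f x + g x) (f' + g') y :=
  ⟨hf.1.add hg.1, by rw [pd, fderiv_fun_add hf.1 hg.1, ← hf.2, ← hg.2]; rfl⟩

lemma neg (hf : HasPd i f f' y) : HasPd i (fun x => -f x) (-f') y :=
  ⟨hf.1.neg, by rw [pd, fderiv_fun_neg, ← hf.2]; rfl⟩

lemma sub (hf : HasPd i f f' y) (hg : HasPd i g g' y) :
    HasPd i (fun x => f x - g x) (f' - g') y :=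
  ⟨hf.1.sub hg.1, by rw [pd, fderiv_fun_sub hf.1 hg.1, ← hf.2, ← hg.2]; rfl⟩

lemma mul (hf : HasPd i f f' y) (hg : HasPd i g g' y) :
    HasPd i (fun x => f x * g x) (f' * g y + f y * g') y :=
  ⟨hf.1.mul hg.1, by
    rw [pd, fderiv_fun_mul hf.1 hg.1, ← hf.2, ← hg.2]
    simp [pd]; ring⟩

lemma const (c : ℝ) : HasPd i (fun _ => c) 0 y := ⟨differentiableAt_const c, by simp [pd]⟩

lemma const_mul (c : ℝ) (hf : HasPd i f f' y) : HasPd i (fun x => c * f x) (c * f') y :=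
  ((const c).mul hf).congr_deriv (by simp)

lemma mul_const (c : ℝ) (hf : HasPd i f f' y) : HasPd i (fun x => f x * c) (f' * c) y :=
  (hf.mul (const c)).congr_deriv (by simp)

lemma sum {ι : Type*} {s : Finset ι} {F : ι → E n → ℝ} {F' : ι → ℝ}
    (h : ∀ a ∈ s, HasPd i (F a) (F' a) y) :
    HasPd i (fun x => ∑ a ∈ s, F a x) (∑ a ∈ s, F' a) y :=
  ⟨DifferentiableAt.fun_sum fun a ha => (h a ha).1, by
    rw [pd, fderiv_fun_sum fun a ha => (h a ha).1]
    simp only [FunLike.coe_sum, Finset.sum_apply]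
    exact Finset.sum_congr rfl fun a ha => (h a ha).2⟩

lemma coord (i j : Fin n) (y : E n) :
    HasPd i (fun x : E n => x j) (if j = i then 1 else 0) y := by
  have : HasFDerivAt (fun x : E n => x j) (EuclideanSpace.proj j : E n →L[ℝ] ℝ) y :=
    (EuclideanSpace.proj j : E n →L[ℝ] ℝ).hasFDerivAt
  refine ⟨this.differentiableAt, ?_⟩
  rw [pd, this.fderiv]
  simp

lemma normSq (i : Fin n) (y : E n) : HasPd i (fun x : E n => ‖x‖ ^ 2) (2 * y i) y := by
  have := (hasStrictFDerivAt_norm_sq y).hasFDerivAt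
  refine ⟨this.differentiableAt, ?_⟩
  rw [pd, this.fderiv]
  simp [EuclideanSpace.inner_single_right]

lemma om (i : Fin n) {y : E n} (hy : ‖y‖ < 1) :
    HasPd i (om : E n → ℝ) (om y ^ 2 * y i) y := by
  have h0 := (one_sub_pos hy).ne'
  have h1 := (HasPd.const (i := i) (y := y) 1).sub (HasPd.normSq i y)
  have h2 : HasFDerivAt (fun x : E n => 1 - ‖x‖ ^ 2) (fderiv ℝ (fun x : E n => 1 - ‖x‖ ^ 2) y) y :=
    h1.1.hasFDerivAt
  have h3 := (((hasDerivAt_inv h0).const_mul 2).comp_hasFDerivAt y h2)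
  have h4 : (fun x : E n => AHData.om x) = (fun x => 2 * x⁻¹) ∘ (fun x : E n => 1 - ‖x‖ ^ 2) := by
    ext x; simp [AHData.om, div_eq_mul_inv]
  refine ⟨?_, ?_⟩
  · show DifferentiableAt ℝ (fun x : E n => AHData.om x) y
    rw [h4]; exact h3.differentiableAt
  · have h5 := h1.2
    rw [pd] at h5 ⊢
    show fderiv ℝ (fun x : E n => AHData.om x) y _ = _
    rw [h4, h3.fderiv, smul_apply, h5, AHData.om]
    simp only [smul_eq_mul]
    field_simp
    ring

lemma om_pow (i : Fin n) (p : ℕ) {y : E n} (hy : ‖y‖ < 1) :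
    HasPd i (fun x : E n => AHData.om x ^ p) (p * AHData.om y ^ (p + 1) * y i) y := by
  induction p with
  | zero => simpa using HasPd.const (i := i) (y := y) 1
  | succ p ih =>
    have := ih.mul (HasPd.om i hy)
    refine HasPd.congr_deriv (f' := _) (by simpa only [pow_succ] using this) ?_
    push_cast; ring

end HasPd

/-! ### Weighted bounds near infinity -/

/-- `f(t) = O(ω^a)` near infinity, uniformly for `t ∈ I`. -/
def BO (I : Set ℝ) (a : ℝ) (f : ℝ → E n → ℝ) : Prop :=
  ∃ C ρ : ℝ, ∀ t ∈ I, ∀ y ∈ ext n ρ, |f t y| ≤ C * om y ^ a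

/-- A property of `(t, y)` holds for all `t ∈ I` and all `y` near infinity. -/
def NearInf (I : Set ℝ) (P : ℝ → E n → Prop) : Prop := ∃ ρ : ℝ, ∀ t ∈ I, ∀ y ∈ ext n ρ, P t y

lemma NearInf.mono {I : Set ℝ} {P Q : ℝ → E n → Prop} (h : NearInf I P)
    (hPQ : ∀ t ∈ I, ∀ y : E n, ‖y‖ < 1 → P t y → Q t y) : NearInf I Q := by
  obtain ⟨ρ, hρ⟩ := h
  exact ⟨ρ, fun t ht y hy => hPQ t ht y hy.1 (hρ t ht y hy)⟩

lemma NearInf.and {I : Set ℝ} {P Q : ℝ → E n → Prop} (h : NearInf I P) (h' : NearInf I Q) :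
    NearInf I (fun t y => P t y ∧ Q t y) := by
  obtain ⟨ρ, hρ⟩ := h
  obtain ⟨ρ', hρ'⟩ := h'
  exact ⟨max ρ ρ', fun t ht y hy => ⟨hρ t ht y (ext_mono (le_max_left _ _) hy),
    hρ' t ht y (ext_mono (le_max_right _ _) hy)⟩⟩

lemma NearInf.all {ι : Type*} [Finite ι] {I : Set ℝ} {P : ι → ℝ → E n → Prop}
    (h : ∀ a, NearInf I (P a)) : NearInf I (fun t y => ∀ a, P a t y) := by
  choose ρ hρ using h
  obtain ⟨M, hM⟩ := Set.Finite.bddAbove (Set.finite_range ρ)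
  exact ⟨M, fun t ht y hy a => hρ a t ht y (ext_mono (hM ⟨a, rfl⟩) hy)⟩

/-- Exteriors of balls are open, so an identity valid near infinity holds in a neighbourhood of each
point and may be differentiated there. -/
lemma NearInf.eventually {I : Set ℝ} {P : ℝ → E n → Prop} (h : NearInf I P) :
    NearInf I (fun t y => ∀ᶠ x in 𝓝 y, P t x) := by
  obtain ⟨ρ, hρ⟩ := h
  exact ⟨ρ, fun t ht y hy => by
    filter_upwards [(isOpen_ext ρ).mem_nhds hy] with x hx using hρ t ht x hx⟩

lemma nearInf_true {I : Set ℝ} : NearInf I (fun _ (_ : E n) => True) := ⟨0, fun _ _ _ _ => trivial⟩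

namespace BO

variable {I : Set ℝ} {a b : ℝ} {f g : ℝ → E n → ℝ}

lemma of_le {C : ℝ} (h : NearInf I (fun t y => |f t y| ≤ C * om y ^ a)) : BO I a f :=
  ⟨C, h⟩

lemma nonneg_bound (h : BO I a f) :
    ∃ C, 0 ≤ C ∧ NearInf I (fun t y => |f t y| ≤ C * om y ^ a) := by
  obtain ⟨C, ρ, h⟩ := h
  refine ⟨|C|, abs_nonneg _, ρ, fun t ht y hy => (h t ht y hy).trans ?_⟩
  exact mul_le_mul_of_nonneg_right (le_abs_self C) (Real.rpow_nonneg (om_pos hy.1).le _)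

lemma mono (h : BO I a f) (hab : a ≤ b) : BO I b f := by
  obtain ⟨C, hC, h⟩ := h.nonneg_bound
  refine ⟨C, h.mono fun t _ y hy h => h.trans ?_⟩
  exact mul_le_mul_of_nonneg_left
    (Real.rpow_le_rpow_of_exponent_le (by linarith [two_le_om hy]) hab) hC

lemma congr (h : BO I a f) (e : NearInf I (fun t y => g t y = f t y)) : BO I a g := by
  obtain ⟨C, h⟩ := h
  exact ⟨C, (NearInf.and h e).mono fun t _ y _ h => by rw [h.2]; exact h.1⟩

lemma add (hf : BO I a f) (hg : BO I a g) : BO I a (fun t y => f t y + g t y) := by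
  obtain ⟨C, hf⟩ := hf
  obtain ⟨C', hg⟩ := hg
  refine ⟨C + C', (NearInf.and hf hg).mono fun t _ y _ h => (abs_add_le _ _).trans ?_⟩
  rw [add_mul]; exact add_le_add h.1 h.2

lemma neg (hf : BO I a f) : BO I a (fun t y => -f t y) := by
  obtain ⟨C, hf⟩ := hf
  exact ⟨C, NearInf.mono hf fun t _ y _ h => by rwa [abs_neg]⟩

lemma sub (hf : BO I a f) (hg : BO I a g) : BO I a (fun t y => f t y - g t y) := by
  simpa only [sub_eq_add_neg] using hf.add hg.neg

lemma mul (hf : BO I a f) (hg : BO I b g) : BO I (a + b) (fun t y => f t y * g t y) := by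
  obtain ⟨C, hC, hf⟩ := hf.nonneg_bound
  obtain ⟨C', hC', hg⟩ := hg.nonneg_bound
  refine ⟨C * C', (hf.and hg).mono fun t _ y hy h => ?_⟩
  rw [abs_mul, Real.rpow_add (om_pos hy), mul_mul_mul_comm]
  exact mul_le_mul h.1 h.2 (abs_nonneg _)
    (mul_nonneg hC (Real.rpow_nonneg (om_pos hy).le _))

lemma mul_le {c : ℝ} (hf : BO I a f) (hg : BO I b g) (h : a + b ≤ c) :
    BO I c (fun t y => f t y * g t y) := (hf.mul hg).mono h

lemma const (c : ℝ) : BO I 0 (fun _ (_ : E n) => c) :=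
  ⟨|c|, 0, fun t _ y _ => by simp⟩

lemma zero : BO I a (fun _ (_ : E n) => 0) :=
  ⟨0, 0, fun t _ y _ => by simp⟩

lemma const_mul (c : ℝ) (hf : BO I a f) : BO I a (fun t y => c * f t y) := by
  simpa using (const c).mul hf

lemma sum {ι : Type*} {s : Finset ι} {F : ι → ℝ → E n → ℝ} (h : ∀ i ∈ s, BO I a (F i)) :
    BO I a (fun t y => ∑ i ∈ s, F i t y) := by
  classical
  induction s using Finset.induction_on with
  | empty => simpa using BO.zero
  | insert i s hi ih =>
    simp only [Finset.sum_insert hi]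
    exact (h i (Finset.mem_insert_self _ _)).add
      (ih fun j hj => h j (Finset.mem_insert_of_mem hj))

lemma om_rpow (a : ℝ) : BO I a (fun _ (y : E n) => om y ^ a) :=
  ⟨1, 0, fun t _ y hy => by
    rw [abs_of_nonneg (Real.rpow_nonneg (om_pos hy.1).le _), one_mul]⟩

lemma om_pow (p : ℕ) : BO I p (fun _ (y : E n) => om y ^ p) := by
  simpa using om_rpow (I := I) (n := n) (p : ℝ)

lemma om : BO I 1 (fun _ (y : E n) => om y) := by
  simpa using om_pow (I := I) (n := n) 1

lemma coord (i : Fin n) : BO I 0 (fun _ (y : E n) => y i) :=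
  ⟨1, 0, fun t _ y hy => by
    simp only [Real.rpow_zero, mul_one]
    exact (PiLp.norm_apply_le y i).trans hy.1.le⟩

end BO

/-- A strictly larger power of ω absorbs any constant far out. This makes the rescaled metric as
close to the identity matrix as needed. -/
lemma NearInf.bO_le {I : Set ℝ} {a b : ℝ} {f : ℝ → E n → ℝ} (h : BO I a f) (hab : a < b)
    {c : ℝ} (hc : 0 < c) : NearInf I (fun t y => |f t y| ≤ c * om y ^ b) := by
  obtain ⟨C, hC, ρ, h⟩ := h.nonneg_bound
  have hlim : Tendsto (fun r : ℝ => r ^ (b - a)) atTop atTop := tendsto_rpow_atTop (by linarith)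
  obtain ⟨r0, hr0⟩ := (hlim.eventually_ge_atTop (C / c)).exists_forall_of_atTop
  -- The radius is chosen so that e^r > 2|r0| + 1, which forces ω ≥ r0 through e^r ≤ 2ω.
  refine ⟨max ρ (Real.log (2 * |r0| + 1)), fun t ht y hy => ?_⟩
  have h1 := h t ht y (ext_mono (le_max_left _ _) hy)
  have h2 := (ext_mono (le_max_right _ _) hy).2
  have h3 : r0 ≤ om y := by
    have := (Real.log_lt_iff_lt_exp (by positivity)).1 h2
    have := exp_rad_le hy.1
    linarith [le_abs_self r0]
  have h4 := hr0 _ h3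
  rw [div_le_iff₀ hc] at h4
  refine h1.trans ?_
  have h5 : om y ^ b = om y ^ (b - a) * om y ^ a := by
    rw [← Real.rpow_add (om_pos hy.1)]; ring_nf
  rw [h5, ← mul_assoc]
  exact mul_le_mul_of_nonneg_right (by linarith) (Real.rpow_nonneg (om_pos hy.1).le _)

/-! ### Joint smoothness in time and space, and first-order bounds -/

/-- Joint smoothness in `(t, y)` for `t ∈ I` and `y` near infinity. -/
def JS (I : Set ℝ) (f : ℝ → E n → ℝ) : Prop :=
  NearInf I (fun t y => ContDiffAt ℝ ∞ (fun p : ℝ × E n => f p.1 p.2) (t, y))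

lemma contDiffAt_slice {f : ℝ → E n → ℝ} {t : ℝ} {y : E n}
    (h : ContDiffAt ℝ ∞ (fun p : ℝ × E n => f p.1 p.2) (t, y)) : ContDiffAt ℝ ∞ (f t) y :=
  h.comp (f := fun x : E n => (t, x)) y (by fun_prop)

/-- A spatial partial derivative is the derivative of the joint function in the direction (0, e_i),
so it is again jointly smooth. -/
lemma contDiffAt_pd {f : ℝ → E n → ℝ} {t : ℝ} {y : E n} (i : Fin n)
    (h : ContDiffAt ℝ ∞ (fun p : ℝ × E n => f p.1 p.2) (t, y)) :
    ContDiffAt ℝ ∞ (fun p : ℝ × E n => pd i (f p.1) p.2) (t, y) ∧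
    pd i (f t) y = fderiv ℝ (fun p : ℝ × E n => f p.1 p.2) (t, y) (0, EuclideanSpace.single i 1) := by
  have key : ∀ p : ℝ × E n, DifferentiableAt ℝ (fun p : ℝ × E n => f p.1 p.2) p →
      pd i (f p.1) p.2 =
        fderiv ℝ (fun p : ℝ × E n => f p.1 p.2) p (0, EuclideanSpace.single i 1) := by
    intro p hp
    have h1 : HasFDerivAt (fun x : E n => (p.1, x)) (ContinuousLinearMap.inr ℝ ℝ (E n)) p.2 :=
      hasFDerivAt_prodMk_right _ _
    have h2 := HasFDerivAt.comp (x := p.2) (f := fun x : E n => (p.1, x))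
      (g := fun p : ℝ × E n => f p.1 p.2) (by exact hp.hasFDerivAt) h1
    have h3 : HasFDerivAt (f p.1) ((fderiv ℝ (fun p : ℝ × E n => f p.1 p.2) p).comp
      (ContinuousLinearMap.inr ℝ ℝ (E n))) p.2 := h2
    rw [pd, h3.fderiv]; simp
  have hd : ∀ᶠ p in 𝓝 (t, y), DifferentiableAt ℝ (fun p : ℝ × E n => f p.1 p.2) p := by
    -- Regularity at a point spreads to a neighbourhood for orders other than ∞, hence the passage
    -- to order 1.
    have h1 : ContDiffAt ℝ 1 (fun p : ℝ × E n => f p.1 p.2) (t, y) := h.of_le (by simp)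
    filter_upwards [h1.eventually (by simp)] with p hp using hp.differentiableAt (by simp)
  refine ⟨?_, key (t, y) hd.self_of_nhds⟩
  have h2 : ContDiffAt ℝ ∞ (fun p : ℝ × E n => fderiv ℝ (fun p : ℝ × E n => f p.1 p.2) p
      (0, EuclideanSpace.single i 1)) (t, y) :=
    (h.fderiv_right (m := ∞) (by simp)).clm_apply contDiffAt_const
  refine h2.congr_of_eventuallyEq ?_
  filter_upwards [hd] with p hp using key p hp

namespace JS

variable {I : Set ℝ} {f g : ℝ → E n → ℝ}

lemma differentiableAt (h : JS I f) : NearInf I (fun t y => DifferentiableAt ℝ (f t) y) :=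
  NearInf.mono h fun _ _ _ _ h => (contDiffAt_slice h).differentiableAt (by simp)

lemma add (hf : JS I f) (hg : JS I g) : JS I (fun t y => f t y + g t y) :=
  (NearInf.and hf hg).mono fun _ _ _ _ h => h.1.add h.2

lemma neg (hf : JS I f) : JS I (fun t y => -f t y) :=
  NearInf.mono hf fun _ _ _ _ h => h.neg

lemma sub (hf : JS I f) (hg : JS I g) : JS I (fun t y => f t y - g t y) :=
  (NearInf.and hf hg).mono fun _ _ _ _ h => h.1.sub h.2

lemma mul (hf : JS I f) (hg : JS I g) : JS I (fun t y => f t y * g t y) :=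
  (NearInf.and hf hg).mono fun _ _ _ _ h => h.1.mul h.2

lemma const (c : ℝ) : JS I (fun _ (_ : E n) => c) :=
  nearInf_true.mono fun _ _ _ _ _ => contDiffAt_const

lemma sum {ι : Type*} [Fintype ι] {F : ι → ℝ → E n → ℝ} (h : ∀ i, JS I (F i)) :
    JS I (fun t y => ∑ i, F i t y) :=
  (NearInf.all h).mono fun _ _ _ _ h => ContDiffAt.sum fun i _ => h i

lemma pd (hf : JS I f) (i : Fin n) : JS I (fun t y => pd i (f t) y) :=
  NearInf.mono hf fun _ _ _ _ h => (contDiffAt_pd i h).1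

lemma of_space {φ : E n → ℝ} (h : ∀ y : E n, ‖y‖ < 1 → ContDiffAt ℝ ∞ φ y) :
    JS I (fun _ y => φ y) :=
  nearInf_true.mono fun t _ y hy _ => (h y hy).comp (f := Prod.snd) (t, y) contDiffAt_snd

end JS

lemma contDiffAt_om {y : E n} (hy : ‖y‖ < 1) : ContDiffAt ℝ ∞ (om : E n → ℝ) y := by
  unfold om
  exact ContDiffAt.div contDiffAt_const (contDiffAt_const.sub (contDiff_norm_sq ℝ).contDiffAt)
    (one_sub_pos hy).ne'

lemma contDiffAt_coord (i : Fin n) (y : E n) : ContDiffAt ℝ ∞ (fun x : E n => x i) y :=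
  (EuclideanSpace.proj i : E n →L[ℝ] ℝ).contDiff.contDiffAt

/-- `f = O(ω^a)` and `∂f = O(ω^{a+1})` near infinity, with `f` smooth. -/
structure B1 (I : Set ℝ) (a : ℝ) (f : ℝ → E n → ℝ) : Prop where
  bO : BO I a f
  bO_pd : ∀ i, BO I (a + 1) (fun t y => pd i (f t) y)
  smooth : JS I f

namespace B1

variable {I : Set ℝ} {a b : ℝ} {f g : ℝ → E n → ℝ}

lemma mono (h : B1 I a f) (hab : a ≤ b) : B1 I b f :=
  ⟨h.bO.mono hab, fun i => (h.bO_pd i).mono (by linarith), h.smooth⟩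

lemma congr (h : B1 I a f) (hg : JS I g) (e : NearInf I (fun t y => g t y = f t y)) :
    B1 I a g :=
  ⟨h.bO.congr e, fun i => (h.bO_pd i).congr (e.eventually.mono fun t _ y _ e => by
    rw [pd, pd, Filter.EventuallyEq.fderiv_eq e]), hg⟩

lemma add (hf : B1 I a f) (hg : B1 I a g) : B1 I a (fun t y => f t y + g t y) :=
  ⟨hf.bO.add hg.bO, fun i => ((hf.bO_pd i).add (hg.bO_pd i)).congr
    ((hf.smooth.differentiableAt.and hg.smooth.differentiableAt).mono fun _ _ _ _ h =>
      ((hasPd_pd i h.1).add (hasPd_pd i h.2)).2), hf.smooth.add hg.smooth⟩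

lemma neg (hf : B1 I a f) : B1 I a (fun t y => -f t y) :=
  ⟨hf.bO.neg, fun i => (hf.bO_pd i).neg.congr
    (hf.smooth.differentiableAt.mono fun _ _ _ _ h => (hasPd_pd i h).neg.2), hf.smooth.neg⟩

lemma sub (hf : B1 I a f) (hg : B1 I a g) : B1 I a (fun t y => f t y - g t y) := by
  simpa only [sub_eq_add_neg] using hf.add hg.neg

lemma mul (hf : B1 I a f) (hg : B1 I b g) : B1 I (a + b) (fun t y => f t y * g t y) :=
  ⟨hf.bO.mul hg.bO, fun i => (((hf.bO_pd i).mul_le hg.bO (by linarith)).add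
      (hf.bO.mul_le (hg.bO_pd i) (by linarith))).congr
    ((hf.smooth.differentiableAt.and hg.smooth.differentiableAt).mono fun _ _ _ _ h =>
      ((hasPd_pd i h.1).mul (hasPd_pd i h.2)).2), hf.smooth.mul hg.smooth⟩

lemma mul_le {c : ℝ} (hf : B1 I a f) (hg : B1 I b g) (h : a + b ≤ c) :
    B1 I c (fun t y => f t y * g t y) := (hf.mul hg).mono h

lemma const (c : ℝ) : B1 I 0 (fun _ (_ : E n) => c) :=
  ⟨BO.const c, fun _ => BO.zero.congr (nearInf_true.mono fun _ _ _ _ _ => (HasPd.const c).2),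
    JS.const c⟩

lemma const_mul (c : ℝ) (hf : B1 I a f) : B1 I a (fun t y => c * f t y) := by
  simpa using (const c).mul hf

lemma sum {ι : Type*} [Fintype ι] {F : ι → ℝ → E n → ℝ} (h : ∀ i, B1 I a (F i)) :
    B1 I a (fun t y => ∑ i, F i t y) :=
  ⟨BO.sum fun i _ => (h i).bO, fun j => (BO.sum fun i _ => (h i).bO_pd j).congr
    ((NearInf.all fun i => (h i).smooth.differentiableAt).mono fun _ _ _ _ h =>
      (HasPd.sum fun i _ => hasPd_pd j (h i)).2), JS.sum fun i => (h i).smooth⟩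

lemma coord (i : Fin n) : B1 I 0 (fun _ (y : E n) => y i) :=
  ⟨BO.coord i, fun j => ((BO.const (if i = j then 1 else 0)).congr
    (nearInf_true.mono fun _ _ y _ _ => (HasPd.coord j i y).2)).mono (by norm_num),
    JS.of_space fun y _ => contDiffAt_coord i y⟩

lemma om : B1 I 1 (fun _ (y : E n) => om y) :=
  ⟨BO.om, fun i => (((BO.om_pow 2).mul (BO.coord i)).congr
    (nearInf_true.mono fun _ _ y hy _ => (HasPd.om i hy).2)).mono (by norm_num),
    JS.of_space fun y hy => contDiffAt_om hy⟩

end B1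

/-! ### Integration over the unit sphere -/

/-- The unit sphere of `ℝⁿ`. -/
abbrev Sph (n : ℕ) := Metric.sphere (0 : E n) 1

/-- The round measure of the unit sphere of `ℝⁿ`. -/
noncomputable abbrev sph (n : ℕ) : Measure (Sph n) := (volume : Measure (E n)).toSphere

lemma sph_norm_eq (x : Sph n) : ‖(x : E n)‖ = 1 := by simp

lemma sph_sum_sq (x : Sph n) : ∑ i, (x : E n) i * (x : E n) i = 1 := by
  have := EuclideanSpace.norm_sq_eq (x : E n)
  rw [sph_norm_eq x] at this
  simpa [← sq] using this.symm

lemma integrable_sph {f : Sph n → ℝ} (hf : Continuous f) : Integrable f (sph n) :=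
  hf.integrable_of_hasCompactSupport (HasCompactSupport.of_compactSpace f)

/-- The action of a linear isometry on the unit sphere. -/
noncomputable def sphMap (e : E n ≃ₗᵢ[ℝ] E n) (x : Sph n) : Sph n := ⟨e x, by simp⟩

lemma continuous_sphMap (e : E n ≃ₗᵢ[ℝ] E n) : Continuous (sphMap e) :=
  (e.continuous.comp continuous_subtype_val).subtype_mk _

-- The spherical measure of s is, up to a factor, the volume of the cone (0,1)·s. A linear isometry
-- maps cones to cones and preserves volume.
open scoped Pointwise in
lemma measurePreserving_sphMap (e : E n ≃ₗᵢ[ℝ] E n) :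
    MeasurePreserving (sphMap e) (sph n) (sph n) := by
  refine ⟨(continuous_sphMap e).measurable, Measure.ext fun s hs => ?_⟩
  rw [Measure.map_apply (continuous_sphMap e).measurable hs, Measure.toSphere_apply' _ hs,
    Measure.toSphere_apply' _ ((continuous_sphMap e).measurable hs)]
  congr 1
  have hpre : Ioo (0 : ℝ) 1 • ((↑) '' (sphMap e ⁻¹' s) : Set (E n)) =
      e ⁻¹' (Ioo (0 : ℝ) 1 • ((↑) '' s : Set (E n))) := by
    ext y
    simp only [Set.mem_smul, Set.mem_image, Set.mem_preimage]
    constructor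
    · rintro ⟨c, hc, _, ⟨x, hx, rfl⟩, rfl⟩
      exact ⟨c, hc, _, ⟨_, hx, rfl⟩, by simp [sphMap]⟩
    · rintro ⟨c, hc, _, ⟨x, hx, rfl⟩, hy⟩
      refine ⟨c, hc, _, ⟨sphMap e.symm x, ?_, rfl⟩, ?_⟩
      · convert hx
        ext1; simp [sphMap]
      · apply e.injective
        rw [← hy]; simp [sphMap]
  rw [hpre]
  exact (e.measurePreserving).measure_preimage_equiv (f := e.toHomeomorph.toMeasurableEquiv) _

lemma integral_sphMap (e : E n ≃ₗᵢ[ℝ] E n) {f : Sph n → ℝ} (hf : Continuous f) :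
    ∫ x, f (sphMap e x) ∂sph n = ∫ x, f x ∂sph n := by
  have h := measurePreserving_sphMap e
  rw [← integral_map h.measurable.aemeasurable hf.aestronglyMeasurable, h.map_eq]

/-- Continuity of the derivative on the compact product of a closed interval with the sphere gives a
constant dominating function. -/
lemma hasDerivAt_integral_sph {Φ Φ' : ℝ → Sph n → ℝ} {U : Set ℝ} {t₀ : ℝ} (hU : U ∈ 𝓝 t₀)
    (hΦ : ∀ t ∈ U, Continuous (Φ t))
    (hd : ∀ t ∈ U, ∀ x, HasDerivAt (fun s => Φ s x) (Φ' t x) t)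
    (hc : ∀ t ∈ U, ∀ x, ContinuousAt (fun p : ℝ × Sph n => Φ' p.1 p.2) (t, x)) :
    HasDerivAt (fun t => ∫ x, Φ t x ∂sph n) (∫ x, Φ' t₀ x ∂sph n) t₀ := by
  obtain ⟨ε, hε, hball⟩ := Metric.nhds_basis_closedBall.mem_iff.1 hU
  have hK : IsCompact (Metric.closedBall t₀ ε ×ˢ (univ : Set (Sph n))) :=
    (isCompact_closedBall _ _).prod isCompact_univ
  obtain ⟨C, hC⟩ := hK.exists_bound_of_continuousOn (f := fun p : ℝ × Sph n => Φ' p.1 p.2)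
    fun p hp => (hc p.1 (hball hp.1) p.2).continuousWithinAt
  have hcont : Continuous (Φ' t₀) := continuous_iff_continuousAt.2 fun x =>
    (hc t₀ (mem_of_mem_nhds hU) x).comp (f := fun x : Sph n => (t₀, x)) (by fun_prop)
  refine (hasDerivAt_integral_of_dominated_loc_of_deriv_le (bound := fun _ => C)
    (Metric.ball_mem_nhds t₀ hε) ?_ (integrable_sph (hΦ _ (mem_of_mem_nhds hU)))
    hcont.aestronglyMeasurable ?_ (integrable_const C) ?_).2
  · filter_upwards [hU] with t ht using (hΦ t ht).aestronglyMeasurable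
  · exact Eventually.of_forall fun x t ht => hC (t, x) ⟨Metric.ball_subset_closedBall ht, trivial⟩
  · exact Eventually.of_forall fun x t ht =>
      hd t (hball (Metric.ball_subset_closedBall ht)) x

/-! ### Rotations and the divergence theorem in differential form -/

/-- The rotation by the angle `θ` in the plane of the `i`-th and the `j`-th coordinate. -/
noncomputable def rotFun (i j : Fin n) (θ : ℝ) (x : E n) : E n :=
  x + ((Real.cos θ - 1) * x i - Real.sin θ * x j) • EuclideanSpace.single i (1 : ℝ)
    + ((Real.cos θ - 1) * x j + Real.sin θ * x i) • EuclideanSpace.single j (1 : ℝ)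

/-- `rotFun` as a linear isometry. -/
noncomputable def rot (i j : Fin n) (hij : i ≠ j) (θ : ℝ) : E n ≃ₗᵢ[ℝ] E n :=
  LinearIsometry.toLinearIsometryEquiv (E₁ := E n) (F := E n)
    { toFun := rotFun i j θ
      map_add' := fun x y => by
        ext k; simp [rotFun]; split_ifs <;> ring
      map_smul' := fun c x => by
        ext k; simp [rotFun]; split_ifs <;> ring
      norm_map' := fun x => by
        have h : ‖rotFun i j θ x‖ ^ 2 = ‖x‖ ^ 2 := by
          rw [rotFun, ← real_inner_self_eq_norm_sq, ← real_inner_self_eq_norm_sq]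
          simp only [inner_add_left, inner_add_right, inner_smul_left, inner_smul_right,
            EuclideanSpace.inner_single_left, EuclideanSpace.inner_single_right]
          simp [hij, hij.symm]
          have := Real.sin_sq_add_cos_sq θ
          linear_combination (x i ^ 2 + x j ^ 2) * this
        simpa using (sq_eq_sq₀ (norm_nonneg _) (norm_nonneg _)).1 h } rfl

lemma fderiv_eq_sum_pd (f : E n → ℝ) (y v : E n) : fderiv ℝ f y v = ∑ i, v i * pd i f y := by
  conv_lhs => rw [← (EuclideanSpace.basisFun (Fin n) ℝ).sum_repr v]
  simp [pd]

lemma continuous_comp_smul {f : E n → ℝ} {s : ℝ} (h : ∀ x : Sph n, ContinuousAt f (s • (x : E n))) :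
    Continuous fun x : Sph n => f (s • (x : E n)) :=
  continuous_iff_continuousAt.2 fun x =>
    (h x).comp (f := fun x : Sph n => s • (x : E n)) (by fun_prop)

/-- The integral of f over a sphere does not change when f is composed with a rotation;
differentiating in the angle at 0 gives the claim. Only smoothness at points of that sphere matters,
because rotations preserve it. -/
lemma integral_rotation_eq_zero {f : E n → ℝ} {s : ℝ}
    (hf : ∀ x : Sph n, ContDiffAt ℝ ∞ f (s • (x : E n))) (i j : Fin n) :
    ∫ x : Sph n, (s * (x : E n) i) * pd j f (s • (x : E n))
      - (s * (x : E n) j) * pd i f (s • (x : E n)) ∂sph n = 0 := by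
  rcases eq_or_ne i j with rfl | hij
  · simp
  have hrot : ∀ θ (x : Sph n), (sphMap (rot i j hij θ) x : E n) = rotFun i j θ x := fun _ _ => rfl
  have hc0 : Continuous fun x : Sph n => f (s • (x : E n)) :=
    continuous_comp_smul fun x => (hf x).continuousAt
  have hconst : (fun θ => ∫ x : Sph n, f (s • rotFun i j θ x) ∂sph n) =
      fun _ => ∫ x : Sph n, f (s • (x : E n)) ∂sph n := by
    ext θ
    exact integral_sphMap (rot i j hij θ) hc0
  have hv : ∀ (θ : ℝ) (x : E n), HasDerivAt (fun θ => s • rotFun i j θ x)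
      (s • ((-Real.sin θ * x i - Real.cos θ * x j) • EuclideanSpace.single i (1 : ℝ)
        + (-Real.sin θ * x j + Real.cos θ * x i) • EuclideanSpace.single j (1 : ℝ))) θ := by
    intro θ x
    unfold rotFun
    refine HasDerivAt.fun_const_smul s ?_
    have h1 : HasDerivAt (fun θ => (Real.cos θ - 1) * x i - Real.sin θ * x j)
        (-Real.sin θ * x i - Real.cos θ * x j) θ :=
      (((Real.hasDerivAt_cos θ).sub_const 1).mul_const _).sub ((Real.hasDerivAt_sin θ).mul_const _)
    have h2 : HasDerivAt (fun θ => (Real.cos θ - 1) * x j + Real.sin θ * x i)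
        (-Real.sin θ * x j + Real.cos θ * x i) θ :=
      (((Real.hasDerivAt_cos θ).sub_const 1).mul_const _).add ((Real.hasDerivAt_sin θ).mul_const _)
    exact ((h1.smul_const _).const_add x).add (h2.smul_const _)
  have hcr : Continuous fun p : ℝ × Sph n => s • rotFun i j p.1 p.2 := by
    unfold rotFun; fun_prop
  have hder := hasDerivAt_integral_sph (n := n) (U := univ) (t₀ := 0)
    (Φ := fun θ x => f (s • rotFun i j θ x))
    (Φ' := fun θ x => fderiv ℝ f (s • rotFun i j θ x)
      (s • ((-Real.sin θ * (x : E n) i - Real.cos θ * (x : E n) j) •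
          EuclideanSpace.single i (1 : ℝ)
        + (-Real.sin θ * (x : E n) j + Real.cos θ * (x : E n) i) •
          EuclideanSpace.single j (1 : ℝ)))) univ_mem ?_ ?_ ?_
  · rw [hconst] at hder
    have h0 := hder.unique (hasDerivAt_const _ _)
    rw [← h0]
    refine integral_congr_ae (Eventually.of_forall fun x => ?_)
    have hr0 : rotFun i j 0 (x : E n) = x := by simp [rotFun]
    simp only [hr0, Real.sin_zero, Real.cos_zero, map_smul, map_add]
    simp [pd]
    ring
  · intro θ _
    exact hc0.comp (continuous_sphMap (rot i j hij θ))
  · intro θ _ x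
    have h1 := ((hf (sphMap (rot i j hij θ) x)).differentiableAt (by simp)).hasFDerivAt
    exact h1.comp_hasDerivAt θ (hv θ x)
  · intro θ _ x
    have h1 : ContinuousAt (fderiv ℝ f) (s • rotFun i j θ x) :=
      ((hf (sphMap (rot i j hij θ) x)).fderiv_right (m := 0) (by simp)).continuousAt
    refine ContinuousAt.clm_apply (h1.comp (f := fun p : ℝ × Sph n => s • rotFun i j p.1 p.2)
      (x := (θ, x)) hcr.continuousAt) ?_
    exact Continuous.continuousAt (by fun_prop)

/-- The flux of the vector field `W` through the Euclidean sphere of radius `s`. -/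
noncomputable def eflux (W : Fin n → E n → ℝ) (s : ℝ) : ℝ :=
  s ^ (n - 1) * ∫ x : Sph n, ∑ j, W j (s • (x : E n)) * (x : E n) j ∂sph n

/-- Derivatives along the tangential fields y_i∂_j - y_j∂_i integrate to zero over the sphere.
Applied to y_i W_j and summed over i, j at y = sx, they give s² div W - (n-1)s W·x - s² (∂_x W)·x.
Hence the integral of div W is that of (n-1)/s W·x plus the radial derivative, which is what
differentiating s^{n-1} ∫ W·x produces. -/
lemma hasDerivAt_eflux {W : Fin n → E n → ℝ} {s : ℝ} {U : Set ℝ} (hU : U ∈ 𝓝 s) (hs : s ≠ 0)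
    (hn : 1 ≤ n)
    (hW : ∀ r ∈ U, ∀ x : Sph n, ∀ j, ContDiffAt ℝ ∞ (W j) (r • (x : E n))) :
    HasDerivAt (eflux W)
      (s ^ (n - 1) * ∫ x : Sph n, ∑ j, pd j (W j) (s • (x : E n)) ∂sph n) s := by
  have hWs := hW s (mem_of_mem_nhds hU)
  have hcW : ∀ r ∈ U, ∀ j, Continuous fun x : Sph n => W j (r • (x : E n)) := fun r hr j =>
    continuous_comp_smul fun x => (hW r hr x j).continuousAt
  have hcf : ∀ r ∈ U, ∀ x : Sph n, ∀ j, ContinuousAt (fderiv ℝ (W j)) (r • (x : E n)) :=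
    fun r hr x j => ((hW r hr x j).fderiv_right (m := 0) (by simp)).continuousAt
  have hcp : ∀ i j, Continuous fun x : Sph n => pd i (W j) (s • (x : E n)) := fun i j =>
    continuous_comp_smul fun x => (hcf s (mem_of_mem_nhds hU) x j).clm_apply continuousAt_const
  have hder := hasDerivAt_integral_sph (n := n) hU
    (Φ := fun r x => ∑ j, W j (r • (x : E n)) * (x : E n) j)
    (Φ' := fun r x => ∑ j, fderiv ℝ (W j) (r • (x : E n)) x * (x : E n) j) ?_ ?_ ?_
  · refine ((hasDerivAt_pow (n - 1) s).mul hder).congr_deriv ?_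
    -- Natural subtraction: for n = 1 the exponent n - 1 - 1 is truncated, but the factor n - 1
    -- vanishes on both sides.
    have hpow : ((n - 1 : ℕ) : ℝ) * s ^ (n - 1 - 1) = ((n : ℝ) - 1) * s ^ (n - 1) / s := by
      rcases Nat.exists_eq_add_of_le hn with ⟨p, rfl⟩
      rcases p with _ | p
      · simp
      · simp only [Nat.add_sub_cancel_left, Nat.add_sub_cancel]
        rw [pow_succ]; push_cast; field_simp; ring
    rw [hpow]
    have hrotsum : ∫ x : Sph n, ∑ i, ∑ j, ((s * (x : E n) i) * pd j (fun y => y i * W j y)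
        (s • (x : E n)) - (s * (x : E n) j) * pd i (fun y => y i * W j y) (s • (x : E n)))
        ∂sph n = 0 := by
      have hsm : ∀ i j, ∀ x : Sph n,
          ContDiffAt ℝ ∞ (fun y : E n => y i * W j y) (s • (x : E n)) :=
        fun i j x => (contDiffAt_coord i _).mul (hWs x j)
      have hci : ∀ i j k, Continuous fun x : Sph n =>
          pd k (fun y : E n => y i * W j y) (s • (x : E n)) := fun i j k =>
        continuous_comp_smul fun x =>
          (((hsm i j x).fderiv_right (m := 0) (by simp)).continuousAt).clm_apply
            continuousAt_const
      rw [integral_finsetSum]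
      · refine Finset.sum_eq_zero fun i _ => ?_
        rw [integral_finsetSum]
        · exact Finset.sum_eq_zero fun j _ => integral_rotation_eq_zero (hsm i j) i j
        · exact fun j _ => integrable_sph (by have := hci i j i; have := hci i j j; fun_prop)
      · exact fun i _ => integrable_sph (continuous_finsetSum _ fun j _ => by
          have := hci i j i; have := hci i j j; fun_prop)
    have hpt : ∀ x : Sph n, ∑ i, ∑ j, ((s * (x : E n) i) * pd j (fun y => y i * W j y)
        (s • (x : E n)) - (s * (x : E n) j) * pd i (fun y => y i * W j y) (s • (x : E n)))
        = s ^ 2 * ∑ j, pd j (W j) (s • (x : E n))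
          - (((n : ℝ) - 1) * s * ∑ j, W j (s • (x : E n)) * (x : E n) j
            + s ^ 2 * ∑ j, fderiv ℝ (W j) (s • (x : E n)) x * (x : E n) j) := by
      intro x
      have hprod : ∀ i j k, pd k (fun y => y i * W j y) (s • (x : E n)) =
          (if i = k then 1 else 0) * W j (s • (x : E n))
            + (s * (x : E n) i) * pd k (W j) (s • (x : E n)) := fun i j k => by
        have := ((HasPd.coord k i (s • (x : E n))).mul
          (hasPd_pd k ((hWs x j).differentiableAt (by simp)))).2
        simpa using this
      simp only [hprod, fderiv_eq_sum_pd]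
      have h1 := sph_sum_sq x
      have e1 : ∑ i, ∑ j, (s * (x : E n) i) * ((if i = j then 1 else 0) * W j (s • (x : E n))
            + (s * (x : E n) i) * pd j (W j) (s • (x : E n)))
          = s * ∑ j, W j (s • (x : E n)) * (x : E n) j
            + s ^ 2 * ∑ j, pd j (W j) (s • (x : E n)) := by
        simp only [mul_add, Finset.sum_add_distrib]
        congr 1
        · simp only [ite_mul, one_mul, zero_mul, mul_ite, mul_zero, Finset.sum_ite_eq,
            Finset.mem_univ, if_true, Finset.mul_sum]
          exact Finset.sum_congr rfl fun i _ => by ring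
        · rw [Finset.sum_comm, Finset.mul_sum]
          refine Finset.sum_congr rfl fun j _ => ?_
          calc ∑ i, s * (x : E n) i * (s * (x : E n) i * pd j (W j) (s • (x : E n)))
              = (∑ i, (x : E n) i * (x : E n) i) * (s ^ 2 * pd j (W j) (s • (x : E n))) := by
                rw [Finset.sum_mul]; exact Finset.sum_congr rfl fun i _ => by ring
            _ = _ := by rw [h1, one_mul]
      -- Here the Kronecker factor is ∂_i y_i; `if True` is the form in which simplification leaves
      -- the condition i = i.
      have e2 : ∑ i, ∑ j, (s * (x : E n) j) * ((if True then 1 else 0) * W j (s • (x : E n))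
            + (s * (x : E n) i) * pd i (W j) (s • (x : E n)))
          = n * s * ∑ j, W j (s • (x : E n)) * (x : E n) j
            + s ^ 2 * ∑ j, (∑ i, (x : E n) i * pd i (W j) (s • (x : E n))) * (x : E n) j := by
        simp only [mul_add, Finset.sum_add_distrib]
        congr 1
        · simp only [if_true, one_mul, Finset.sum_const, Finset.card_univ, Fintype.card_fin,
            nsmul_eq_mul, Finset.mul_sum]
          exact Finset.sum_congr rfl fun i _ => by ring
        · rw [Finset.sum_comm, Finset.mul_sum]
          refine Finset.sum_congr rfl fun j _ => ?_
          rw [Finset.sum_mul, Finset.mul_sum]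
          exact Finset.sum_congr rfl fun i _ => by ring
      simp only [Finset.sum_sub_distrib]
      rw [e1, e2]; ring
    simp only [hpt] at hrotsum
    have hcd : Continuous fun x : Sph n => ∑ j, fderiv ℝ (W j) (s • (x : E n)) x * (x : E n) j := by
      simp only [fderiv_eq_sum_pd]
      have := hcp
      fun_prop
    have hc1 : Continuous fun x : Sph n => ∑ j, W j (s • (x : E n)) * (x : E n) j := by
      exact continuous_finsetSum _ fun j _ =>
        (hcW s (mem_of_mem_nhds hU) j).mul (by fun_prop)
    have hc2 : Continuous fun x : Sph n => ∑ j, pd j (W j) (s • (x : E n)) := by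
      have := hcp
      fun_prop
    rw [integral_sub (integrable_sph (by fun_prop)) (integrable_sph (by fun_prop)),
      integral_add (integrable_sph (by fun_prop)) (integrable_sph (by fun_prop)),
      integral_const_mul, integral_const_mul, integral_const_mul, sub_eq_zero] at hrotsum
    have : ∫ x : Sph n, ∑ j, pd j (W j) (s • (x : E n)) ∂sph n =
        ((n : ℝ) - 1) / s * ∫ x : Sph n, ∑ j, W j (s • (x : E n)) * (x : E n) j ∂sph n
        + ∫ x : Sph n, ∑ j, fderiv ℝ (W j) (s • (x : E n)) x * (x : E n) j ∂sph n := by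
      field_simp
      field_simp at hrotsum
      linear_combination hrotsum
    rw [this]; ring
  · intro r hr
    exact continuous_finsetSum _ fun j _ => (hcW r hr j).mul (by fun_prop)
  · intro r hr x
    refine HasDerivAt.fun_sum fun j _ => ?_
    have h1 : HasDerivAt (fun r : ℝ => r • (x : E n)) (x : E n) r := by
      simpa using (hasDerivAt_id r).smul_const (x : E n)
    exact ((((hW r hr x j).differentiableAt (by simp)).hasFDerivAt).comp_hasDerivAt r h1).mul_const _
  · intro r hr x
    have h1 : ∀ j, ContinuousAt (fun p : ℝ × Sph n => fderiv ℝ (W j) (p.1 • (p.2 : E n))) (r, x) :=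
      fun j => (hcf r hr x j).comp (f := fun p : ℝ × Sph n => p.1 • (p.2 : E n)) (x := (r, x))
        (Continuous.continuousAt (by fun_prop))
    refine tendsto_finsetSum _ fun j _ => ContinuousAt.mul ((h1 j).clm_apply ?_) ?_
    · exact Continuous.continuousAt (by fun_prop)
    · exact Continuous.continuousAt (by fun_prop)

/-! ### Fluxes through geodesic spheres -/

lemma one_sub_tanh_sq (r : ℝ) : 1 - Real.tanh r ^ 2 = 1 / Real.cosh r ^ 2 := by
  have := Real.cosh_sq_sub_sinh_sq r
  have h := (Real.cosh_pos r).ne'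
  rw [Real.tanh_eq_sinh_div_cosh]; field_simp; exact this

lemma tanh_pos_of_pos {r : ℝ} (hr : 0 < r) : 0 < Real.tanh r := by
  rw [Real.tanh_eq_sinh_div_cosh]; exact div_pos (Real.sinh_pos_iff.2 hr) (Real.cosh_pos r)

lemma tanh_lt_one' (r : ℝ) : Real.tanh r < 1 := by
  rw [Real.tanh_eq_sinh_div_cosh, div_lt_one (Real.cosh_pos r)]; exact Real.sinh_lt_cosh r

lemma tanh_lt_tanh_iff {a b : ℝ} : Real.tanh a < Real.tanh b ↔ a < b := by
  rw [← Real.artanh_lt_artanh_iff ⟨Real.neg_one_lt_tanh a, tanh_lt_one' a⟩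
    ⟨Real.neg_one_lt_tanh b, tanh_lt_one' b⟩, Real.artanh_tanh, Real.artanh_tanh]

lemma norm_tanh_smul {R : ℝ} (hR : 0 < R) (x : Sph n) :
    ‖Real.tanh (R / 2) • (x : E n)‖ = Real.tanh (R / 2) := by
  rw [norm_smul, sph_norm_eq, mul_one, Real.norm_of_nonneg (tanh_pos_of_pos (by linarith)).le]

lemma om_tanh_smul {R : ℝ} (hR : 0 < R) (x : Sph n) :
    om (Real.tanh (R / 2) • (x : E n)) = 2 * Real.cosh (R / 2) ^ 2 := by
  rw [om, norm_tanh_smul hR, one_sub_tanh_sq]; field_simp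

lemma sinh_eq_om_mul {R : ℝ} (hR : 0 < R) (x : Sph n) :
    Real.sinh R = om (Real.tanh (R / 2) • (x : E n)) * Real.tanh (R / 2) := by
  have h := (Real.cosh_pos (R / 2)).ne'
  rw [om_tanh_smul hR, Real.tanh_eq_sinh_div_cosh]
  conv_lhs => rw [show R = 2 * (R / 2) by ring, Real.sinh_two_mul]
  field_simp

lemma rad_tanh_smul {R : ℝ} (hR : 0 < R) (x : Sph n) :
    rad (Real.tanh (R / 2) • (x : E n)) = R := by
  have h1 : ‖Real.tanh (R / 2) • (x : E n)‖ < 1 := by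
    rw [norm_tanh_smul hR]; exact tanh_lt_one' _
  have h2 := V₀_eq_om h1
  rw [om_tanh_smul hR] at h2
  have h3 : rad (Real.tanh (R / 2) • (x : E n)) =
      Real.arcosh (V₀ (Real.tanh (R / 2) • (x : E n))) := rfl
  rw [h3, h2]
  have h4 : 2 * Real.cosh (R / 2) ^ 2 - 1 = Real.cosh R := by
    conv_rhs => rw [show R = 2 * (R / 2) by ring, Real.cosh_two_mul]
    linarith [Real.cosh_sq_sub_sinh_sq (R / 2)]
  rw [h4, Real.arcosh_cosh hR.le]

lemma tanh_smul_mem_ext {ρ R : ℝ} (hR : 0 < R) (h : ρ < R) (x : Sph n) :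
    Real.tanh (R / 2) • (x : E n) ∈ ext n ρ :=
  ⟨by rw [norm_tanh_smul hR]; exact tanh_lt_one' _, by rwa [rad_tanh_smul hR]⟩

/-- The flux of the one-form `U` through the geodesic sphere of radius `R`. -/
noncomputable def hflux (U : OneForm n) (R : ℝ) : ℝ :=
  ∫ x : Sph n, (∑ j, U (Real.tanh (R / 2) • (x : E n)) j
    * normal (Real.tanh (R / 2) • (x : E n)) j) * Real.sinh R ^ (n - 1) ∂sph n

/-- At the point s x with s = tanh(R/2) one has ν = ω^{-1} x and sinh R = ω s, so U(ν) sinh^{n-1} R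
= s^{n-1} ω^{n-2} U·x. -/
lemma hflux_eq_eflux (hn : 2 ≤ n) (U : OneForm n) {R : ℝ} (hR : 0 < R) :
    hflux U R = eflux (fun j y => om y ^ (n - 2) * U y j) (Real.tanh (R / 2)) := by
  rw [hflux, eflux, ← integral_const_mul]
  refine integral_congr_ae (Eventually.of_forall fun x => ?_)
  have hs := tanh_pos_of_pos (r := R / 2) (by linarith)
  have hom : om (Real.tanh (R / 2) • (x : E n)) ≠ 0 :=
    (om_pos (by rw [norm_tanh_smul hR]; exact tanh_lt_one' _)).ne'
  have hnor : ∀ j, normal (Real.tanh (R / 2) • (x : E n)) j =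
      (om (Real.tanh (R / 2) • (x : E n)))⁻¹ * (x : E n) j := by
    intro j
    rw [normal, om, norm_tanh_smul hR, inv_div]
    congr 1
    simp only [PiLp.smul_apply, smul_eq_mul]
    field_simp
  simp only [hnor, sinh_eq_om_mul hR x, Finset.mul_sum, Finset.sum_mul]
  refine Finset.sum_congr rfl fun j _ => ?_
  obtain ⟨p, rfl⟩ := Nat.exists_eq_add_of_le hn
  have e1 : 2 + p - 1 = p + 1 := by omega
  have e2 : 2 + p - 2 = p := by omega
  rw [e1, e2, mul_pow, pow_succ (om _)]
  field_simp

lemma hasDerivAt_tanh_half (R : ℝ) :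
    HasDerivAt (fun R => Real.tanh (R / 2)) (1 / (2 * Real.cosh (R / 2) ^ 2)) R := by
  have h1 : HasDerivAt (fun R : ℝ => R / 2) (1 / 2) R := (hasDerivAt_id R).div_const 2
  have h2 := (h1.sinh).div (h1.cosh) (Real.cosh_pos _).ne'
  have h3 : (fun R => Real.tanh (R / 2)) = fun R => Real.sinh (R / 2) / Real.cosh (R / 2) := by
    ext R; rw [Real.tanh_eq_sinh_div_cosh]
  rw [h3]
  refine h2.congr_deriv ?_
  have h := (Real.cosh_pos (R / 2)).ne'
  field_simp
  exact Real.cosh_sq_sub_sinh_sq _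

lemma hasDerivAt_hflux (hn : 2 ≤ n) {U : OneForm n} {ρ R : ℝ} (hρ : 0 ≤ ρ) (hR : ρ < R)
    (hU : ∀ j, ∀ y ∈ ext n ρ, ContDiffAt ℝ ∞ (fun y => U y j) y) :
    HasDerivAt (hflux U) (Real.tanh (R / 2) ^ (n - 1) *
      (∫ x : Sph n, ∑ j, pd j (fun y => om y ^ (n - 2) * U y j) (Real.tanh (R / 2) • (x : E n))
        ∂sph n) * (1 / (2 * Real.cosh (R / 2) ^ 2))) R := by
  have hR0 : 0 < R := hρ.trans_lt hR
  have hs := tanh_pos_of_pos (r := R / 2) (by linarith)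
  have hW : ∀ r ∈ Ioo (Real.tanh (ρ / 2)) 1, ∀ x : Sph n, ∀ j,
      ContDiffAt ℝ ∞ (fun y => om y ^ (n - 2) * U y j) (r • (x : E n)) := by
    rintro r ⟨hr, h1⟩ x j
    have h0 : -1 < r := (Real.neg_one_lt_tanh _).trans hr
    -- Every Euclidean radius in the interval is tanh of half a geodesic radius, which identifies
    -- the point as lying in the exterior region.
    have e : Real.tanh ((2 * Real.artanh r) / 2) = r := by
      rw [mul_div_cancel_left₀ _ (by norm_num : (2 : ℝ) ≠ 0)]
      exact Real.tanh_artanh ⟨h0, h1⟩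
    rw [← e] at hr
    have hr' : ρ < 2 * Real.artanh r := by linarith [tanh_lt_tanh_iff.1 hr]
    have hm := tanh_smul_mem_ext (hρ.trans_lt hr') hr' x
    rw [e] at hm
    exact ((contDiffAt_om hm.1).pow _).mul (hU j _ hm)
  have hU' : Ioo (Real.tanh (ρ / 2)) 1 ∈ 𝓝 (Real.tanh (R / 2)) :=
    Ioo_mem_nhds (tanh_lt_tanh_iff.2 (by linarith)) (tanh_lt_one' _)
  have h1 := (hasDerivAt_eflux hU' hs.ne' (by omega) hW).comp R (hasDerivAt_tanh_half R)
  refine h1.congr_of_eventuallyEq ?_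
  filter_upwards [Ioi_mem_nhds hR0] with r hr
  exact hflux_eq_eflux hn U hr

lemma abs_integral_sph_le {f : Sph n → ℝ} {C : ℝ} (h : ∀ x, |f x| ≤ C) :
    |∫ x, f x ∂sph n| ≤ C * (sph n).real univ :=
  norm_integral_le_of_norm_le_const (μ := sph n) (f := f) (C := C) (Eventually.of_forall h)

/-- Mean value inequality against the antiderivative of C e^{-δr} that vanishes at R. Dropping its
negative part gives a bound independent of R'. -/
lemma abs_sub_le_of_abs_deriv_le_exp {F F' : ℝ → ℝ} {C δ ρ : ℝ} (hδ : 0 < δ)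
    (hF : ∀ R, ρ < R → HasDerivAt F (F' R) R)
    (hF' : ∀ R, ρ < R → |F' R| ≤ C * Real.exp (-(δ * R))) {R R' : ℝ} (hR : ρ < R)
    (hRR' : R ≤ R') : |F R' - F R| ≤ C / δ * Real.exp (-(δ * R)) := by
  have hC : 0 ≤ C := by
    have := (abs_nonneg _).trans (hF' R hR)
    exact nonneg_of_mul_nonneg_left this (Real.exp_pos _)
  have hB : ∀ r : ℝ, HasDerivAt (fun r => C / δ * (Real.exp (-(δ * R)) - Real.exp (-(δ * r))))
      (C * Real.exp (-(δ * r))) r := by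
    intro r
    have h1 : HasDerivAt (fun r : ℝ => -(δ * r)) (-δ) r := by
      simpa using ((hasDerivAt_id r).const_mul δ).fun_neg
    refine ((h1.exp.const_sub _).const_mul (C / δ)).congr_deriv ?_
    field_simp
  have key := image_norm_le_of_norm_deriv_right_le_deriv_boundary (f := fun r => F r - F R)
    (f' := F') (a := R) (b := R')
    (B := fun r => C / δ * (Real.exp (-(δ * R)) - Real.exp (-(δ * r))))
    (B' := fun r => C * Real.exp (-(δ * r)))
    (fun r hr => ((hF r (hR.trans_le hr.1)).sub_const _).continuousAt.continuousWithinAt)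
    (fun r hr => ((hF r (hR.trans_le hr.1)).sub_const _).hasDerivWithinAt)
    (by simp) hB (fun r hr => hF' r (hR.trans_le hr.1))
    (x := R') ⟨hRR', le_rfl⟩
  refine (show |F R' - F R| ≤ _ from key).trans ?_
  exact mul_le_mul_of_nonneg_left (by linarith [Real.exp_pos (-(δ * R'))]) (by positivity)

lemma tendsto_exp_neg_mul {δ : ℝ} (hδ : 0 < δ) (C : ℝ) :
    Tendsto (fun R : ℝ => C * Real.exp (-(δ * R))) atTop (𝓝 0) := by
  have h1 : Tendsto (fun R : ℝ => δ * R) atTop atTop := tendsto_id.const_mul_atTop hδ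
  simpa using (Real.tendsto_exp_neg_atTop_nhds_zero.comp h1).const_mul C

/-- Letting R' tend to infinity in the Cauchy estimate transfers the rate to the limit. The
constants are those of the hypothesis, so uniformity in a parameter survives. -/
lemma exists_limit_of_exp_cauchy {F : ℝ → ℝ} {C δ ρ : ℝ} (hδ : 0 < δ)
    (h : ∀ R R', ρ < R → R ≤ R' → |F R' - F R| ≤ C * Real.exp (-(δ * R))) :
    ∃ q, Tendsto F atTop (𝓝 q) ∧ ∀ R, ρ < R → |F R - q| ≤ C * Real.exp (-(δ * R)) := by
  have hc : CauchySeq F := by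
    refine Metric.cauchySeq_iff'.2 fun ε hε => ?_
    obtain ⟨R, hR, hlt⟩ := ((eventually_gt_atTop ρ).and
      ((tendsto_exp_neg_mul hδ C).eventually_lt_const hε)).exists
    exact ⟨R, fun R' hR' => (h R R' hR hR').trans_lt hlt⟩
  obtain ⟨q, hq⟩ := cauchySeq_tendsto_of_complete hc
  refine ⟨q, hq, fun R hR => ?_⟩
  have h1 : Tendsto (fun R' => |F R' - F R|) atTop (𝓝 |q - F R|) := (hq.sub_const _).abs
  rw [abs_sub_comm]
  exact le_of_tendsto h1 (by
    filter_upwards [eventually_ge_atTop R] with R' hR' using h R R' hR hR')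

/-- If the divergence of `U(t)` is `O(e^{-(n - 1 + δ) r})`, its flux converges at rate
`e^{-δ r}`, uniformly in `t`. -/
theorem exists_limit_hflux (hn : 2 ≤ n) {I : Set ℝ} {U : ℝ → OneForm n} {δ : ℝ} (hδ : 0 < δ)
    (hU : ∀ j, JS I (fun t y => U t y j))
    (hdiv : BO I (1 - δ) (fun t y => ∑ j, pd j (fun y => om y ^ (n - 2) * U t y j) y)) :
    ∃ C ρ : ℝ, ∀ t ∈ I, ∃ q, Tendsto (hflux (U t)) atTop (𝓝 q) ∧
      ∀ R, ρ < R → |hflux (U t) R - q| ≤ C * Real.exp (-(δ * R)) := by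
  obtain ⟨C, hC, h⟩ := hdiv.nonneg_bound
  obtain ⟨ρ, hρ⟩ := (NearInf.all hU).and h
  refine ⟨C * (sph n).real univ * 2 ^ |-δ| / δ, max ρ 0, fun t ht =>
    exists_limit_of_exp_cauchy hδ fun R R' hR hRR' =>
    abs_sub_le_of_abs_deriv_le_exp hδ (fun R hR => hasDerivAt_hflux hn (le_max_right _ _) hR
      fun j y hy => contDiffAt_slice (f := fun t y => U t y j) ((hρ t ht y (ext_mono (le_max_left _ _) hy)).1 j))
      ?_ hR hRR'⟩
  intro R hR
  have hR0 : 0 < R := (le_max_right _ _).trans_lt hR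
  have hRρ : ρ < R := (le_max_left _ _).trans_lt hR
  have hs := tanh_pos_of_pos (r := R / 2) (by linarith)
  have hW : 0 < 2 * Real.cosh (R / 2) ^ 2 := by have := Real.cosh_pos (R / 2); positivity
  rw [abs_mul, abs_mul, abs_of_nonneg (pow_nonneg hs.le _), abs_of_pos (one_div_pos.2 hW)]
  have h1 : |∫ x : Sph n, ∑ j, pd j (fun y => om y ^ (n - 2) * U t y j)
      (Real.tanh (R / 2) • (x : E n)) ∂sph n| ≤
      C * (2 * Real.cosh (R / 2) ^ 2) ^ (1 - δ) * (sph n).real univ := by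
    refine abs_integral_sph_le fun x => ?_
    have := (hρ t ht _ (tanh_smul_mem_ext hR0 hRρ x)).2
    rwa [om_tanh_smul hR0] at this
  have h2 : Real.tanh (R / 2) ^ (n - 1) ≤ 1 := pow_le_one₀ hs.le (tanh_lt_one' _).le
  have h3 : (2 * Real.cosh (R / 2) ^ 2) ^ (-δ) ≤ 2 ^ |-δ| * Real.exp (-(δ * R)) := by
    -- The comparison of ω with e^r is stated at points of the ball, so a point of the sphere is
    -- needed; it exists because n ≥ 2.
    have : Nonempty (Sph n) := by
      have : Nontrivial (E n) := by
        have : Nonempty (Fin n) := ⟨⟨0, by omega⟩⟩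
        infer_instance
      exact (NormedSpace.sphere_nonempty (x := (0 : E n)) (r := 1)).2 zero_le_one |>.to_subtype
    obtain ⟨x⟩ := this
    have := om_rpow_le (-δ) (tanh_smul_mem_ext hR0 hRρ x).1
    rw [om_tanh_smul hR0, rad_tanh_smul hR0] at this
    convert this using 2
    ring_nf
  -- The factor ds/dR of s = tanh(R/2) equals 1/ω and lowers the exponent from 1 - δ to -δ.
  have h4 : (2 * Real.cosh (R / 2) ^ 2) ^ (1 - δ) * (1 / (2 * Real.cosh (R / 2) ^ 2)) =
      (2 * Real.cosh (R / 2) ^ 2) ^ (-δ) := by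
    rw [sub_eq_add_neg, Real.rpow_add hW, Real.rpow_one]; field_simp
  have hm : 0 ≤ (sph n).real univ := measureReal_nonneg
  calc _ ≤ 1 * (C * (2 * Real.cosh (R / 2) ^ 2) ^ (1 - δ) * (sph n).real univ) *
        (1 / (2 * Real.cosh (R / 2) ^ 2)) := by
        refine mul_le_mul_of_nonneg_right ?_ (one_div_pos.2 hW).le
        exact mul_le_mul h2 h1 (abs_nonneg _) zero_le_one
    _ = C * (sph n).real univ * (2 * Real.cosh (R / 2) ^ 2) ^ (-δ) := by rw [← h4]; ring
    _ ≤ C * (sph n).real univ * (2 ^ |-δ| * Real.exp (-(δ * R))) :=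
        mul_le_mul_of_nonneg_left h3 (by positivity)
    _ = _ := by ring

/-- If `U(t) = O(ω^{2 - n - δ})`, its flux is `O(e^{-δ r})`, uniformly in `t`. -/
theorem abs_hflux_le (hn : 2 ≤ n) {I : Set ℝ} {U : ℝ → OneForm n} {δ : ℝ}
    (hU : ∀ j, BO I (2 - n - δ) (fun t y => U t y j)) :
    ∃ C ρ : ℝ, ∀ t ∈ I, ∀ R, ρ < R → |hflux (U t) R| ≤ C * Real.exp (-(δ * R)) := by
  -- Absolute values are summed so that the factors |x_j| ≤ 1 of the normal can be discarded term by
  -- term.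
  have h0 : BO I (-δ) (fun t y => ∑ j, |om y ^ (n - 2) * U t y j|) := by
    refine BO.sum fun j _ => ?_
    have h1 : BO I (-δ) (fun t y => om y ^ (n - 2) * U t y j) := by
      refine (BO.om_pow (n - 2)).mul_le (hU j) ?_
      rw [Nat.cast_sub hn]; push_cast; linarith
    obtain ⟨C, h1⟩ := h1
    exact ⟨C, NearInf.mono h1 fun t _ y _ h => by rwa [abs_abs]⟩
  obtain ⟨C, hC, ρ, hρ⟩ := h0.nonneg_bound
  refine ⟨C * 2 ^ |-δ| * (sph n).real univ, max ρ 0, fun t ht R hR => ?_⟩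
  have hR0 : 0 < R := (le_max_right _ _).trans_lt hR
  have hRρ : ρ < R := (le_max_left _ _).trans_lt hR
  have hs := tanh_pos_of_pos (r := R / 2) (by linarith)
  have h2 : Real.tanh (R / 2) ^ (n - 1) ≤ 1 := pow_le_one₀ hs.le (tanh_lt_one' _).le
  rw [hflux_eq_eflux hn _ hR0, eflux, abs_mul, abs_of_nonneg (pow_nonneg hs.le _)]
  refine (mul_le_of_le_one_left (abs_nonneg _) h2).trans ?_
  have h3 : ∀ x : Sph n, |∑ j, om (Real.tanh (R / 2) • (x : E n)) ^ (n - 2) *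
      U t (Real.tanh (R / 2) • (x : E n)) j * (x : E n) j| ≤
        C * (2 ^ |-δ| * Real.exp (-(δ * R))) := by
    intro x
    have hm := tanh_smul_mem_ext hR0 hRρ x
    have h4 := (le_abs_self _).trans (hρ t ht _ hm)
    have h5 := om_rpow_le (-δ) hm.1
    rw [rad_tanh_smul hR0, neg_mul] at h5
    refine (Finset.abs_sum_le_sum_abs _ _).trans ((Finset.sum_le_sum fun j _ => ?_).trans
      (h4.trans (mul_le_mul_of_nonneg_left h5 hC)))
    rw [abs_mul]
    refine mul_le_of_le_one_right (abs_nonneg _) ?_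
    have := PiLp.norm_apply_le (x : E n) j
    rwa [sph_norm_eq] at this
  refine (abs_integral_sph_le h3).trans (le_of_eq ?_)
  ring

/-! ### The hyperbolic metric and decay in coordinates -/

/-- The Kronecker symbol. -/
def kd (i j : Fin n) : ℝ := if i = j then 1 else 0

lemma kd_comm (i j : Fin n) : kd i j = kd j i := by simp [kd, eq_comm]

@[simp] lemma kd_self (i : Fin n) : kd i i = 1 := by simp [kd]

@[simp] lemma sum_kd_mul (j : Fin n) (f : Fin n → ℝ) : ∑ i, kd i j * f i = f j := by simp [kd]

@[simp] lemma sum_kd_mul' (j : Fin n) (f : Fin n → ℝ) : ∑ i, kd j i * f i = f j := by simp [kd]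

@[simp] lemma sum_mul_kd (j : Fin n) (f : Fin n → ℝ) : ∑ i, f i * kd i j = f j := by simp [kd]

@[simp] lemma sum_mul_kd' (j : Fin n) (f : Fin n → ℝ) : ∑ i, f i * kd j i = f j := by simp [kd]

lemma hyp_apply (y : E n) (i j : Fin n) : hyp n y i j = om y ^ 2 * kd i j := by
  simp [hyp, om, kd, Matrix.one_apply]

lemma hyp_inv_apply {y : E n} (hy : ‖y‖ < 1) (i j : Fin n) :
    (hyp n y)⁻¹ i j = (om y ^ 2)⁻¹ * kd i j := by
  have h : (hyp n y)⁻¹ = ((om y ^ 2)⁻¹) • (1 : Matrix (Fin n) (Fin n) ℝ) := by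
    refine Matrix.inv_eq_left_inv ?_
    have := (om_pos hy).ne'
    have e : hyp n y = om y ^ 2 • (1 : Matrix (Fin n) (Fin n) ℝ) := rfl
    rw [e, smul_mul_smul_comm, mul_one, inv_mul_cancel₀ (by positivity), one_smul]
  rw [h]; simp [kd, Matrix.one_apply]

lemma hasPd_hyp {y : E n} (hy : ‖y‖ < 1) (l i j : Fin n) :
    HasPd l (fun x => hyp n x i j) (2 * om y ^ 3 * y l * kd i j) y := by
  simp only [hyp_apply]
  exact ((HasPd.om_pow l 2 hy).mul_const _).congr_deriv (by push_cast; ring)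

lemma christoffel_hyp {y : E n} (hy : ‖y‖ < 1) (l i j : Fin n) :
    christoffel (hyp n) y l i j = om y * (y i * kd l j + y j * kd l i - y l * kd i j) := by
  have h0 := (om_pos hy).ne'
  simp only [christoffel, hyp_inv_apply hy, (hasPd_hyp hy _ _ _).2]
  have : ∀ p, (om y ^ 2)⁻¹ * kd l p * (2 * om y ^ 3 * y i * kd p j + 2 * om y ^ 3 * y j * kd p i
      - 2 * om y ^ 3 * y p * kd i j) = kd l p * (2 * om y *
        (y i * kd p j + y j * kd p i - y p * kd i j)) := by
    intro p; field_simp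
  simp only [this, sum_kd_mul']
  ring

lemma contDiffAt_christoffel_hyp {y : E n} (hy : ‖y‖ < 1) (l i j : Fin n) :
    ContDiffAt ℝ ∞ (fun x => christoffel (hyp n) x l i j) y := by
  have h : ContDiffAt ℝ ∞ (fun x : E n => om x * (x i * kd l j + x j * kd l i - x l * kd i j)) y :=
    (contDiffAt_om hy).mul ((((contDiffAt_coord i y).mul contDiffAt_const).add
      ((contDiffAt_coord j y).mul contDiffAt_const)).sub
      ((contDiffAt_coord l y).mul contDiffAt_const))
  refine h.congr_of_eventuallyEq ?_
  filter_upwards [Metric.isOpen_ball.mem_nhds (x := y) (s := Metric.ball 0 1) (by simpa using hy)]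
    with x hx
  exact christoffel_hyp (by simpa using hx) l i j

lemma b1_christoffel_hyp {I : Set ℝ} (l i j : Fin n) :
    B1 I 1 (fun _ y => christoffel (hyp n) y l i j) := by
  have h : B1 I 1 (fun _ (y : E n) => om y * (y i * kd l j + y j * kd l i - y l * kd i j)) := by
    have h1 : ∀ i l j : Fin n, B1 I 0 (fun _ (y : E n) => y i * kd l j) := fun i l j =>
      (B1.coord i).mul_le (B1.const _) (by norm_num)
    exact B1.om.mul_le (((h1 i l j).add (h1 j l i)).sub (h1 l i j)) (by norm_num)
  exact h.congr (JS.of_space fun y hy => contDiffAt_christoffel_hyp hy l i j)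
    (nearInf_true.mono fun _ _ y hy _ => christoffel_hyp hy l i j)

lemma normSq_hyp (T : CovTensor n m) {y : E n} (hy : ‖y‖ < 1) :
    normSq (hyp n) T y = ((om y ^ 2)⁻¹) ^ m * ∑ J, T y J ^ 2 := by
  have h1 : ∀ J J' : Fin m → Fin n, ∏ s, (hyp n y)⁻¹ (J s) (J' s) =
      if J = J' then ((om y ^ 2)⁻¹) ^ m else 0 := by
    intro J J'
    simp only [hyp_inv_apply hy, Finset.prod_mul_distrib, Finset.prod_const, Finset.card_univ,
      Fintype.card_fin]
    split_ifs with h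
    · subst h; simp
    · obtain ⟨s, hs⟩ := Function.ne_iff.1 h
      rw [Finset.prod_eq_zero (Finset.mem_univ s) (by simp [kd, hs]), mul_zero]
  simp only [normSq, h1, ite_mul, zero_mul, Finset.sum_ite_eq, Finset.mem_univ, if_true,
    Finset.mul_sum]
  exact Finset.sum_congr rfl fun J _ => by ring

/-- The fields ω^{-1}∂_i form a b-orthonormal frame, so each covariant index contributes one factor
ω to a coordinate component. -/
lemma abs_le_tnorm_hyp (T : CovTensor n m) {y : E n} (hy : ‖y‖ < 1) (J : Fin m → Fin n) :
    |T y J| ≤ om y ^ m * tnorm (hyp n) T y := by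
  have h0 := om_pos hy
  rw [tnorm, ← Real.sqrt_sq_eq_abs, normSq_hyp T hy]
  rw [← Real.sqrt_sq (by positivity : 0 ≤ om y ^ m), ← Real.sqrt_mul (by positivity)]
  refine Real.sqrt_le_sqrt ?_
  have e : (om y ^ m) ^ 2 * (((om y ^ 2)⁻¹) ^ m * ∑ J, T y J ^ 2) = ∑ J, T y J ^ 2 := by
    rw [← mul_assoc, inv_pow, ← pow_mul, ← pow_mul, mul_comm m 2, mul_inv_cancel₀ (by positivity),
      one_mul]
  rw [e]
  exact Finset.single_le_sum (f := fun J => T y J ^ 2) (fun _ _ => sq_nonneg _) (Finset.mem_univ J)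

lemma DecaysOn.bO {I : Set ℝ} {p : ℕ} {l : ℝ} {T : ℝ → CovTensor n m} (h : DecaysOn I p l T)
    {q : ℕ} (hq : q ≤ p) (J : Fin (m + q) → Fin n) :
    BO I (((m + q : ℕ) : ℝ) - l) (fun t y => iterCovDeriv (hyp n) (T t) q y J) := by
  obtain ⟨C, ρ, h⟩ := h
  refine ⟨|C| * 2 ^ |-l|, ρ, fun t ht y hy => ?_⟩
  have h0 := om_pos hy.1
  have h1 := abs_le_tnorm_hyp (iterCovDeriv (hyp n) (T t) q) hy.1 J
  have h2 := h t ht y hy q hq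
  have h3 := exp_rad_mul_le (-l) hy.1
  rw [neg_mul] at h3
  have h4 : tnorm (hyp n) (iterCovDeriv (hyp n) (T t) q) y ≤ |C| * (2 ^ |-l| * om y ^ (-l)) :=
    h2.trans (mul_le_mul (le_abs_self C) h3 (Real.exp_pos _).le (abs_nonneg _))
  refine h1.trans ((mul_le_mul_of_nonneg_left h4 (by positivity)).trans (le_of_eq ?_))
  rw [sub_eq_add_neg, Real.rpow_add h0, Real.rpow_natCast]; ring

lemma JS.covDeriv_hyp {I : Set ℝ} {T : ℝ → CovTensor n m} (h : ∀ J, JS I (fun t y => T t y J))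
    (J : Fin (m + 1) → Fin n) : JS I (fun t y => covDeriv (hyp n) (T t) y J) := by
  unfold covDeriv
  exact ((h _).pd _).sub (JS.sum fun s => JS.sum fun l => (b1_christoffel_hyp _ _ _).smooth.mul (h _))

lemma pd_eq_covDeriv_hyp_add (T : CovTensor n m) (i : Fin n) (J : Fin m → Fin n) (y : E n) :
    pd i (fun x => T x J) y = covDeriv (hyp n) T y (Fin.cons i J) +
      ∑ s : Fin m, ∑ l : Fin n,
        christoffel (hyp n) y l i (J s) * T y (Function.update J s l) := by
  simp [covDeriv]

/-- The Christoffel symbols of b are O(ω). Covariant and partial derivatives therefore differ by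
terms of the order expected of a derivative. -/
lemma BO.pd_of_covDeriv {I : Set ℝ} {a : ℝ} {T : ℝ → CovTensor n m}
    (h : ∀ J, BO I a (fun t y => T t y J))
    (h' : ∀ J, BO I (a + 1) (fun t y => covDeriv (hyp n) (T t) y J)) (i : Fin n)
    (J : Fin m → Fin n) : BO I (a + 1) (fun t y => pd i (fun x => T t x J) y) := by
  simp only [pd_eq_covDeriv_hyp_add]
  exact (h' _).add (BO.sum fun s _ => BO.sum fun l _ =>
    (b1_christoffel_hyp _ _ _).bO.mul_le (h _) (by linarith))

lemma B1.of_covDeriv {I : Set ℝ} {a : ℝ} {T : ℝ → CovTensor n m}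
    (hs : ∀ J, JS I (fun t y => T t y J)) (h : ∀ J, BO I a (fun t y => T t y J))
    (h' : ∀ J, BO I (a + 1) (fun t y => covDeriv (hyp n) (T t) y J)) (J : Fin m → Fin n) :
    B1 I a (fun t y => T t y J) :=
  ⟨h J, fun i => BO.pd_of_covDeriv h h' i J, hs J⟩

lemma B1.pd_of_covDeriv {I : Set ℝ} {a : ℝ} {T : ℝ → CovTensor n m}
    (h : ∀ J, B1 I a (fun t y => T t y J))
    (h' : ∀ J, B1 I (a + 1) (fun t y => covDeriv (hyp n) (T t) y J)) (i : Fin n)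
    (J : Fin m → Fin n) : B1 I (a + 1) (fun t y => pd i (fun x => T t x J) y) := by
  simp only [pd_eq_covDeriv_hyp_add]
  exact (h' _).add (B1.sum fun s => B1.sum fun l =>
    (b1_christoffel_hyp _ _ _).mul_le (h _) (by linarith))

/-! ### Rescaled components and their decay -/

/-- The components of a symmetric 2-tensor relative to the metric `ω² δ`. -/
noncomputable def rs (T : Tensor2 n) : Tensor2 n := fun y => (om y ^ 2)⁻¹ • T y

lemma rs_apply (T : Tensor2 n) (y : E n) (i j : Fin n) : rs T y i j = (om y ^ 2)⁻¹ * T y i j := rfl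

lemma om_sq_mul_rs (T : Tensor2 n) {y : E n} (hy : ‖y‖ < 1) (i j : Fin n) :
    T y i j = om y ^ 2 * rs T y i j := by
  have := (om_pos hy).ne'
  rw [rs_apply]; field_simp

lemma contDiffAt_om_sq_inv {y : E n} (hy : ‖y‖ < 1) :
    ContDiffAt ℝ ∞ (fun x : E n => (om x ^ 2)⁻¹) y :=
  ((contDiffAt_om hy).pow 2).inv (by have := om_pos hy; positivity)

lemma hasPd_om_sq_inv (i : Fin n) {y : E n} (hy : ‖y‖ < 1) :
    HasPd i (fun x : E n => (om x ^ 2)⁻¹) (-2 * (om y)⁻¹ * y i) y := by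
  have h0 := (om_pos hy).ne'
  have hd : DifferentiableAt ℝ (fun x : E n => (om x ^ 2)⁻¹) y :=
    (contDiffAt_om_sq_inv hy).differentiableAt (by simp)
  refine ⟨hd, ?_⟩
  -- The derivative is found by differentiating ω^{-2} ω² = 1.
  have h1 := ((hasPd_pd i hd).mul (HasPd.om_pow i 2 hy)).2
  have h2 : HasPd i (fun x : E n => (om x ^ 2)⁻¹ * om x ^ 2) 0 y := by
    refine (HasPd.const 1).congr_of_eventuallyEq ?_
    filter_upwards [Metric.isOpen_ball.mem_nhds (x := y) (s := Metric.ball 0 1)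
      (by simpa using hy)] with x hx
    have := (om_pos (y := x) (by simpa using hx)).ne'
    field_simp
  rw [h2.2] at h1
  have h3 : om y ^ 2 * (pd i (fun x : E n => (om x ^ 2)⁻¹) y) = om y ^ 2 * (-2 * (om y)⁻¹ * y i) := by
    generalize pd i (fun x : E n => (om x ^ 2)⁻¹) y = D at h1 ⊢
    field_simp at h1 ⊢
    push_cast at h1
    have h4 : om y ^ 3 * (D * om y + 2 * y i) = 0 := by linear_combination -h1
    have h5 := (mul_eq_zero.1 h4).resolve_left (by positivity)
    linear_combination h5
  exact mul_left_cancel₀ (by positivity) h3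

lemma b1_om_inv {I : Set ℝ} : B1 I (-1) (fun _ (y : E n) => (om y)⁻¹) := by
  have hs : ∀ y : E n, ‖y‖ < 1 → ContDiffAt ℝ ∞ (fun x : E n => (om x)⁻¹) y := fun y hy =>
    (contDiffAt_om hy).inv (om_pos hy).ne'
  refine ⟨(BO.om_rpow (-1)).congr (nearInf_true.mono fun _ _ y hy _ => ?_), fun i => ?_,
    JS.of_space hs⟩
  · rw [Real.rpow_neg_one]
  · refine ((BO.coord i).neg.congr (nearInf_true.mono fun _ _ y hy _ => ?_)).mono (by norm_num)
    have h0 := (om_pos hy).ne'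
    have h1 := ((hasPd_pd i ((hs y hy).differentiableAt (by simp))).mul (HasPd.om i hy)).2
    have h2 : HasPd i (fun x : E n => (om x)⁻¹ * om x) 0 y := by
      refine (HasPd.const 1).congr_of_eventuallyEq ?_
      filter_upwards [Metric.isOpen_ball.mem_nhds (x := y) (s := Metric.ball 0 1)
        (by simpa using hy)] with x hx
      have := (om_pos (y := x) (by simpa using hx)).ne'
      field_simp
    rw [h2.2] at h1
    refine mul_left_cancel₀ h0 ?_
    have h3 : (om y)⁻¹ * (om y ^ 2 * y i) = om y * y i := by field_simp
    linear_combination -h3 - h1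

lemma b1_om_sq_inv {I : Set ℝ} : B1 I (-2) (fun _ (y : E n) => (om y ^ 2)⁻¹) := by
  have := (b1_om_inv (I := I) (n := n)).mul_le b1_om_inv (c := -2) (by norm_num)
  refine this.congr (JS.of_space fun y hy => contDiffAt_om_sq_inv hy) ?_
  exact nearInf_true.mono fun _ _ y _ _ => by rw [sq, mul_inv]

lemma B1.rs {I : Set ℝ} {a : ℝ} {T : ℝ → Tensor2 n} {i j : Fin n}
    (h : B1 I a (fun t y => T t y i j)) : B1 I (a - 2) (fun t y => rs (T t) y i j) := by
  simp only [rs_apply]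
  exact b1_om_sq_inv.mul_le h (by linarith)

lemma BO.rs {I : Set ℝ} {a : ℝ} {T : ℝ → Tensor2 n} {i j : Fin n}
    (h : BO I a (fun t y => T t y i j)) : BO I (a - 2) (fun t y => rs (T t) y i j) := by
  simp only [rs_apply]
  exact b1_om_sq_inv.bO.mul_le h (by linarith)

lemma B1.pd_rs {I : Set ℝ} {a : ℝ} {T : ℝ → Tensor2 n} {i j l : Fin n}
    (h : B1 I a (fun t y => T t y i j))
    (h' : B1 I (a + 1) (fun t y => pd l (fun x => T t x i j) y)) :
    B1 I (a - 1) (fun t y => pd l (fun x => AHData.rs (T t) x i j) y) := by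
  have h1 : B1 I (a - 1) (fun t y => -2 * ((AHData.om y)⁻¹ * y l) * T t y i j
      + (AHData.om y ^ 2)⁻¹ * pd l (fun x => T t x i j) y) := by
    have h2 : B1 I (-1) (fun _ (y : E n) => -2 * ((AHData.om y)⁻¹ * y l)) :=
      (b1_om_inv.mul_le (B1.coord l) (by norm_num)).const_mul _
    exact (h2.mul_le h (by linarith)).add (b1_om_sq_inv.mul_le h' (by linarith))
  refine h1.congr (h.rs.smooth.pd l) (h.smooth.differentiableAt.mono fun t _ y hy hd => ?_)
  have := ((hasPd_om_sq_inv l hy).mul (hasPd_pd l hd)).2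
  simp only [rs_apply]
  rw [this]; ring

/-- Decay of the metric perturbation, in coordinates. -/
lemma DecaysOn.b1_two {I : Set ℝ} {l : ℝ} {T : ℝ → Tensor2 n}
    (h : DecaysOn I 2 l (fun t => ofTensor2 (T t))) (hs : ∀ i j, JS I (fun t y => T t y i j)) :
    (∀ i j, B1 I (-l) (fun t y => rs (T t) y i j)) ∧
    ∀ p i j, B1 I (1 - l) (fun t y => pd p (fun x => rs (T t) x i j) y) := by
  have s0 : ∀ J, JS I (fun t y => ofTensor2 (T t) y J) := fun J => hs _ _
  have b0 : ∀ J, B1 I (2 - l) (fun t y => ofTensor2 (T t) y J) := by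
    refine B1.of_covDeriv s0 (fun J => (h.bO (q := 0) (by norm_num) J).mono (by norm_num))
      fun J => (h.bO (q := 1) (by norm_num) J).mono (by norm_num; linarith)
  have s1 : ∀ J, JS I (fun t y => covDeriv (hyp n) (ofTensor2 (T t)) y J) := JS.covDeriv_hyp s0
  have b1 : ∀ J, B1 I (2 - l + 1) (fun t y => covDeriv (hyp n) (ofTensor2 (T t)) y J) := by
    refine B1.of_covDeriv s1
      (fun J => (h.bO (q := 1) (by norm_num) J).mono (by norm_num; linarith))
      fun J => (h.bO (q := 2) (by norm_num) J).mono (by norm_num; linarith)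
  have b0' : ∀ i j, B1 I (2 - l) (fun t y => T t y i j) := fun i j => b0 ![i, j]
  refine ⟨fun i j => (b0' i j).rs.mono (by linarith), fun p i j => ?_⟩
  exact (B1.pd_rs (b0' i j) (B1.pd_of_covDeriv b0 b1 p ![i, j])).mono (by linarith)

lemma DecaysOn.b1_one {I : Set ℝ} {l : ℝ} {T : ℝ → Tensor2 n}
    (h : DecaysOn I 1 l (fun t => ofTensor2 (T t))) (hs : ∀ i j, JS I (fun t y => T t y i j))
    (i j : Fin n) : B1 I (-l) (fun t y => rs (T t) y i j) := by
  have b0 : ∀ J, B1 I (2 - l) (fun t y => ofTensor2 (T t) y J) := by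
    refine B1.of_covDeriv (fun J => hs _ _)
      (fun J => (h.bO (q := 0) (by norm_num) J).mono (by norm_num))
      fun J => (h.bO (q := 1) (by norm_num) J).mono (by norm_num; linarith)
  have b0' : B1 I (2 - l) (fun t y => T t y i j) := b0 ![i, j]
  exact b0'.rs.mono (by linarith)

lemma DecaysOn.bO_zero {I : Set ℝ} {l : ℝ} {T : ℝ → Tensor2 n}
    (h : DecaysOn I 0 l (fun t => ofTensor2 (T t))) (i j : Fin n) :
    BO I (-l) (fun t y => rs (T t) y i j) := by
  have b0 : BO I (2 - l) (fun t y => T t y i j) :=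
    (h.bO (q := 0) le_rfl ![i, j]).mono (by norm_num)
  exact b0.rs.mono (by linarith)

lemma DecaysOn.bO_ofOneForm {I : Set ℝ} {l : ℝ} {w : ℝ → OneForm n}
    (h : DecaysOn I 0 l (fun t => ofOneForm (w t))) (j : Fin n) :
    BO I (1 - l) (fun t y => w t y j) :=
  (h.bO (q := 0) le_rfl ![j]).mono (by norm_num)

lemma DecaysOn.bO_ofFun {I : Set ℝ} {l : ℝ} {f : ℝ → E n → ℝ}
    (h : DecaysOn I 0 l (fun t => ofFun (f t))) : BO I (-l) f :=
  (h.bO (q := 0) le_rfl ![]).mono (by norm_num)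

/-! ### Inverses of matrix-valued functions -/

section MatrixInverse

variable {X : Type*} [NormedAddCommGroup X] [NormedSpace ℝ X] {N : X → Matrix (Fin n) (Fin n) ℝ}
  {x : X}

lemma contDiffAt_det (h : ∀ i j, ContDiffAt ℝ ∞ (fun x => N x i j) x) :
    ContDiffAt ℝ ∞ (fun x => (N x).det) x := by
  simp only [Matrix.det_apply]
  exact ContDiffAt.sum fun σ _ => (contDiffAt_prod fun i _ => h _ _).const_smul _

/-- Cramer's rule: an entry of the inverse is a determinant with one row replaced, divided by the
determinant. -/
lemma contDiffAt_matrix_inv (h : ∀ i j, ContDiffAt ℝ ∞ (fun x => N x i j) x)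
    (hdet : IsUnit (N x).det) (l j : Fin n) : ContDiffAt ℝ ∞ (fun x => (N x)⁻¹ l j) x := by
  simp only [Matrix.inv_def, Ring.inverse_eq_inv', Matrix.smul_apply, smul_eq_mul,
    Matrix.adjugate_apply]
  refine ((contDiffAt_det h).inv hdet.ne_zero).mul (contDiffAt_det fun a b => ?_)
  by_cases hab : a = j
  · subst hab
    simp only [Matrix.updateRow_self]
    exact contDiffAt_const
  · simp only [Matrix.updateRow_ne hab]
    exact h a b

lemma isUnit_det_eventually (h : ∀ i j, ContDiffAt ℝ ∞ (fun x => N x i j) x)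
    (hdet : IsUnit (N x).det) : ∀ᶠ z in 𝓝 x, IsUnit (N z).det := by
  have := (contDiffAt_det h).continuousAt.eventually_ne hdet.ne_zero
  filter_upwards [this] with z hz using isUnit_iff_ne_zero.2 hz

lemma sum_inv_mul {A : Matrix (Fin n) (Fin n) ℝ} (h : IsUnit A.det) (l j : Fin n) :
    ∑ p, A⁻¹ l p * A p j = kd l j := by
  rw [← Matrix.mul_apply, Matrix.nonsing_inv_mul _ h, Matrix.one_apply, kd]

lemma sum_mul_inv {A : Matrix (Fin n) (Fin n) ℝ} (h : IsUnit A.det) (l j : Fin n) :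
    ∑ p, A l p * A⁻¹ p j = kd l j := by
  rw [← Matrix.mul_apply, Matrix.mul_nonsing_inv _ h, Matrix.one_apply, kd]

/-- Differentiate N^{-1}N = 1 and multiply by N^{-1} from the right. The parameter space is left
general because the formula serves for space derivatives and for the time derivative. -/
lemma fderiv_matrix_inv (h : ∀ i j, ContDiffAt ℝ ∞ (fun x => N x i j) x)
    (hdet : IsUnit (N x).det) (v : X) (l q : Fin n) :
    fderiv ℝ (fun x => (N x)⁻¹ l q) x v =
      -∑ j, ∑ p, (N x)⁻¹ l p * fderiv ℝ (fun x => N x p j) x v * (N x)⁻¹ j q := by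
  have hd : ∀ i j, DifferentiableAt ℝ (fun x => N x i j) x := fun i j =>
    (h i j).differentiableAt (by simp)
  have hi : ∀ i j, DifferentiableAt ℝ (fun x => (N x)⁻¹ i j) x := fun i j =>
    (contDiffAt_matrix_inv h hdet i j).differentiableAt (by simp)
  have key : ∀ j, ∑ p, ((N x)⁻¹ l p * fderiv ℝ (fun x => N x p j) x v
      + fderiv ℝ (fun x => (N x)⁻¹ l p) x v * N x p j) = 0 := by
    intro j
    have h1 : fderiv ℝ (fun x => ∑ p, (N x)⁻¹ l p * N x p j) x = 0 := by
      have : (fun x => ∑ p, (N x)⁻¹ l p * N x p j) =ᶠ[𝓝 x] fun _ => kd l j := by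
        filter_upwards [isUnit_det_eventually h hdet] with z hz using sum_inv_mul hz l j
      rw [this.fderiv_eq]; simp
    rw [fderiv_fun_sum fun p _ => (hi l p).fun_mul (hd p j)] at h1
    have h2 := congrArg (fun L => L v) h1
    simp only [FunLike.coe_sum, Finset.sum_apply] at h2
    rw [← (show _ = (0 : ℝ) from h2)]
    refine Finset.sum_congr rfl fun p _ => ?_
    rw [fderiv_fun_mul (hi l p) (hd p j)]
    simp; ring
  have h3 : ∑ j, (∑ p, ((N x)⁻¹ l p * fderiv ℝ (fun x => N x p j) x v
      + fderiv ℝ (fun x => (N x)⁻¹ l p) x v * N x p j)) * (N x)⁻¹ j q = 0 := by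
    simp [key]
  simp only [Finset.sum_mul, add_mul, Finset.sum_add_distrib] at h3
  have h4 : ∑ j, ∑ p, fderiv ℝ (fun x => (N x)⁻¹ l p) x v * N x p j * (N x)⁻¹ j q =
      fderiv ℝ (fun x => (N x)⁻¹ l q) x v := by
    rw [Finset.sum_comm]
    simp only [mul_assoc, ← Finset.mul_sum, sum_mul_inv hdet, sum_mul_kd]
  rw [h4] at h3
  linarith

end MatrixInverse

/-! ### Families of asymptotically hyperbolic metrics in coordinates -/

/-- A smooth family of metrics `ω² (δ + h)` with `h, ∂h, ∂∂h` decaying at rate `τ`. -/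
structure MetricData (I : Set ℝ) (τ : ℝ) (g : ℝ → Tensor2 n) : Prop where
  τ_pos : 0 < τ
  symm : ∀ t y i j, g t y i j = g t y j i
  smooth : ∀ i j, JS I (fun t y => g t y i j)
  b1 : ∀ i j, B1 I (-τ) (fun t y => rs (g t - hyp n) y i j)
  b1_pd : ∀ p i j, B1 I (1 - τ) (fun t y => pd p (fun x => rs (g t - hyp n) x i j) y)

/-- The inverse of the rescaled metric `ω⁻² g`. -/
noncomputable def up (G : Tensor2 n) : Tensor2 n := fun y => (rs G y)⁻¹

lemma rs_sub_hyp (G : Tensor2 n) {y : E n} (hy : ‖y‖ < 1) (i j : Fin n) :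
    rs G y i j = kd i j + rs (G - hyp n) y i j := by
  have h0 := (om_pos hy).ne'
  rw [rs_apply, rs_apply, Pi.sub_apply, Matrix.sub_apply, hyp_apply]
  field_simp
  ring

lemma isUnit_det_rs_iff (G : Tensor2 n) {y : E n} (hy : ‖y‖ < 1) :
    IsUnit (rs G y).det ↔ IsUnit (G y).det := by
  have h0 := (om_pos hy).ne'
  simp only [rs, Matrix.det_smul, isUnit_iff_ne_zero, ne_eq, mul_eq_zero, not_or]
  exact ⟨fun h => h.2, fun h => ⟨by positivity, h⟩⟩

lemma inv_eq_up (G : Tensor2 n) {y : E n} (hy : ‖y‖ < 1) (h : IsUnit (rs G y).det)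
    (i j : Fin n) : (G y)⁻¹ i j = (om y ^ 2)⁻¹ * up G y i j := by
  have h0 := (om_pos hy).ne'
  have h1 : (G y)⁻¹ = (om y ^ 2)⁻¹ • up G y := by
    refine Matrix.inv_eq_left_inv ?_
    have e : G y = om y ^ 2 • rs G y := by
      rw [rs, smul_smul, mul_inv_cancel₀ (by positivity), one_smul]
    conv_lhs => rw [e]
    rw [smul_mul_smul_comm, up, Matrix.nonsing_inv_mul _ h, inv_mul_cancel₀ (by positivity),
      one_smul]
  rw [h1]; rfl

/-- Since A^{-1} = 1 - A^{-1}(A - 1), the absolute sum σ of a row of A^{-1} satisfies σ ≤ 1 + n c σ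
≤ 1 + σ/2, hence σ ≤ 2. -/
lemma abs_inv_le {A : Matrix (Fin n) (Fin n) ℝ} {c : ℝ} (hc : n * c ≤ 1 / 2)
    (hA : ∀ i j, |A i j - kd i j| ≤ c) (hdet : IsUnit A.det) (l j : Fin n) : |A⁻¹ l j| ≤ 2 := by
  have h1 : ∀ j, |A⁻¹ l j| ≤ kd l j + (∑ p, |A⁻¹ l p|) * c := by
    intro j
    have e : A⁻¹ l j = kd l j - ∑ p, A⁻¹ l p * (A p j - kd p j) := by
      simp only [mul_sub, Finset.sum_sub_distrib, sum_inv_mul hdet, sum_mul_kd]; ring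
    rw [e]
    refine (abs_sub _ _).trans (add_le_add ?_ ((Finset.abs_sum_le_sum_abs _ _).trans ?_))
    · rw [abs_of_nonneg]; unfold kd; split_ifs <;> norm_num
    · rw [Finset.sum_mul]
      refine Finset.sum_le_sum fun p _ => ?_
      rw [abs_mul]
      exact mul_le_mul_of_nonneg_left (hA p j) (abs_nonneg _)
  have h2 : ∑ j, |A⁻¹ l j| ≤ 1 + n * c * ∑ p, |A⁻¹ l p| := by
    refine (Finset.sum_le_sum fun j _ => h1 j).trans (le_of_eq ?_)
    rw [Finset.sum_add_distrib]
    have : ∑ j, kd l j = 1 := by simpa using sum_kd_mul' l (fun _ => (1 : ℝ))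
    rw [this]; simp; ring
  have h3 : 0 ≤ ∑ p, |A⁻¹ l p| := Finset.sum_nonneg fun _ _ => abs_nonneg _
  have h4 : ∑ p, |A⁻¹ l p| ≤ 2 := by nlinarith
  exact (Finset.single_le_sum (f := fun p => |A⁻¹ l p|) (fun _ _ => abs_nonneg _)
    (Finset.mem_univ j)).trans h4

/-- Diagonal dominance: the off-diagonal entries of a row sum to at most n c ≤ 1/2, while the
diagonal entry is at least 1 - c > 1/2. -/
lemma det_ne_zero_of_near_one {A : Matrix (Fin n) (Fin n) ℝ} {c : ℝ} (hc : n * c ≤ 1 / 2)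
    (hc' : c < 1 / 2) (hA : ∀ i j, |A i j - kd i j| ≤ c) : IsUnit A.det := by
  rw [isUnit_iff_ne_zero]
  refine det_ne_zero_of_sum_row_lt_diag fun k => ?_
  have hc0 : 0 ≤ c := (abs_nonneg _).trans (hA k k)
  have h1 : ∑ j ∈ Finset.univ.erase k, ‖A k j‖ ≤ ∑ _j ∈ Finset.univ.erase k, c := by
    refine Finset.sum_le_sum fun j hj => ?_
    have := hA k j
    rwa [kd, if_neg (Finset.ne_of_mem_erase hj).symm, sub_zero] at this
  have h2 : ∑ _j ∈ Finset.univ.erase k, c ≤ n * c := by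
    refine (Finset.sum_le_sum_of_subset_of_nonneg (Finset.erase_subset k _)
      fun _ _ _ => hc0).trans (le_of_eq (by simp))
  have h3 : 1 - c ≤ ‖A k k‖ := by
    have h4 := hA k k
    rw [kd_self, abs_le] at h4
    have := le_abs_self (A k k)
    rw [Real.norm_eq_abs]; linarith
  linarith

namespace MetricData

variable {I : Set ℝ} {τ : ℝ} {g : ℝ → Tensor2 n}

lemma nearInf_det (hg : MetricData I τ g) :
    NearInf I (fun t y => IsUnit (rs (g t) y).det ∧ ∀ l j, |up (g t) y l j| ≤ 2) := by
  -- The constant 1/(2n+3) satisfies both n c ≤ 1/2 and c < 1/2, for every n including 0.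
  have hc : (0 : ℝ) < 1 / (2 * n + 3) := by positivity
  have := NearInf.all fun i => NearInf.all fun j =>
    NearInf.bO_le (hg.b1 i j).bO (b := 0) (by linarith [hg.τ_pos]) hc
  refine this.mono fun t _ y hy h => ?_
  have hA : ∀ i j, |rs (g t) y i j - kd i j| ≤ 1 / (2 * n + 3) := by
    intro i j
    have := h i j
    rwa [Real.rpow_zero, mul_one, ← add_sub_cancel_left (kd i j) (rs (g t - hyp n) y i j),
      ← rs_sub_hyp _ hy] at this
  have h1 : (n : ℝ) * (1 / (2 * n + 3)) ≤ 1 / 2 := by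
    rw [mul_one_div, div_le_div_iff₀ (by positivity) (by norm_num)]; linarith
  have h2 : (1 : ℝ) / (2 * n + 3) < 1 / 2 := by
    rw [div_lt_div_iff₀ (by positivity) (by norm_num)]
    have : (0 : ℝ) ≤ n := Nat.cast_nonneg n
    linarith
  have hdet := det_ne_zero_of_near_one h1 h2 hA
  exact ⟨hdet, fun l j => abs_inv_le h1 hA hdet l j⟩

lemma smooth_rs (hg : MetricData I τ g) (i j : Fin n) : JS I (fun t y => rs (g t) y i j) := by
  simp only [rs_apply]
  exact (b1_om_sq_inv.smooth).mul (hg.smooth i j)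

lemma smooth_up (hg : MetricData I τ g) (i j : Fin n) : JS I (fun t y => up (g t) y i j) :=
  (hg.nearInf_det.and (NearInf.all fun i => NearInf.all fun j => hg.smooth_rs i j)).mono
    fun t _ y _ h => contDiffAt_matrix_inv (N := fun p : ℝ × E n => rs (g p.1) p.2)
      (x := (t, y)) h.2 h.1.1 i j

lemma smooth_inv (hg : MetricData I τ g) (i j : Fin n) : JS I (fun t y => (g t y)⁻¹ i j) :=
  (hg.nearInf_det.and (NearInf.all fun i => NearInf.all fun j => hg.smooth i j)).mono
    fun t _ y hy h => contDiffAt_matrix_inv (N := fun p : ℝ × E n => g p.1 p.2)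
      (x := (t, y)) h.2 ((isUnit_det_rs_iff (g t) hy).1 h.1.1) i j

lemma nearInf_pd_rs (hg : MetricData I τ g) : NearInf I (fun t y => ∀ i j l,
    HasPd l (fun x => rs (g t) x i j) (pd l (fun x => rs (g t - hyp n) x i j) y) y) := by
  have hd : NearInf I (fun t y => ∀ i j, DifferentiableAt ℝ (fun x => rs (g t - hyp n) x i j) y) :=
    NearInf.all fun i => NearInf.all fun j => (hg.b1 i j).smooth.differentiableAt
  refine hd.mono fun t _ y hy hd i j l => ?_
  refine (((HasPd.const (kd i j)).add (hasPd_pd l (hd i j))).congr_deriv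
    (zero_add _)).congr_of_eventuallyEq ?_
  filter_upwards [Metric.isOpen_ball.mem_nhds (x := y) (s := Metric.ball 0 1) (by simpa using hy)]
    with x hx
  exact rs_sub_hyp (g t) (by simpa using hx) i j

lemma bO_up (hg : MetricData I τ g) (i j : Fin n) : BO I 0 (fun t y => up (g t) y i j) :=
  BO.of_le (C := 2) (hg.nearInf_det.mono fun t _ y _ h => by simpa using h.2 i j)

lemma up_sub_kd {G : Tensor2 n} {y : E n} (hy : ‖y‖ < 1) (h : IsUnit (rs G y).det)
    (l j : Fin n) : up G y l j - kd l j = -∑ p, up G y l p * rs (G - hyp n) y p j := by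
  have h1 := sum_inv_mul h l j
  simp only [rs_sub_hyp G hy, mul_add, Finset.sum_add_distrib, sum_mul_kd] at h1
  rw [up]; linarith

/-- With A the inverse of 1 + h, one has A - 1 = -Ah and ∂A = -A(∂h)A. As A is bounded, both inherit
the orders of h and ∂h. -/
lemma b1_up_sub (hg : MetricData I τ g) (i j : Fin n) :
    B1 I (-τ) (fun t y => up (g t) y i j - kd i j) := by
  refine ⟨?_, fun l => ?_, (hg.smooth_up i j).sub (JS.const _)⟩
  · refine BO.congr (BO.neg (BO.sum (s := Finset.univ) fun p _ => (hg.bO_up i p).mul_le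
      (hg.b1 p j).bO (c := -τ) (by linarith))) ?_
    exact hg.nearInf_det.mono fun t _ y hy h => up_sub_kd hy h.1 i j
  · refine BO.congr (f := fun t y => -∑ b, ∑ a, up (g t) y i a *
      pd l (fun x => rs (g t - hyp n) x a b) y * up (g t) y b j) ?_ ?_
    · exact BO.neg (BO.sum fun b _ => BO.sum fun a _ => ((hg.bO_up i a).mul_le
        (hg.b1_pd l a b).bO (c := 1 - τ) (by linarith)).mul_le (hg.bO_up b j) (by linarith))
    · refine ((hg.nearInf_det.and (NearInf.all fun i => NearInf.all fun j =>
        hg.smooth_rs i j)).and (hg.nearInf_pd_rs)).mono fun t _ y hy h => ?_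
      have h1 := fderiv_matrix_inv (N := rs (g t)) (x := y)
        (fun i j => contDiffAt_slice (f := fun t y => rs (g t) y i j) (h.1.2 i j)) h.1.1.1
        (EuclideanSpace.single l 1) i j
      have h2 : ∀ a b, fderiv ℝ (fun x => rs (g t) x a b) y (EuclideanSpace.single l 1) =
        pd l (fun x => rs (g t - hyp n) x a b) y := fun a b => (h.2 a b l).2
      simp only [h2] at h1
      rw [pd, fderiv_sub_const]
      exact h1

/-- `Â - 1 + h` is quadratic in `h`. -/
lemma b1_up_sub_add (hg : MetricData I τ g) (i j : Fin n) :
    B1 I (-(2 * τ)) (fun t y => up (g t) y i j - kd i j + rs (g t - hyp n) y i j) := by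
  refine B1.congr (f := fun t y => -∑ p, (up (g t) y i p - kd i p) * rs (g t - hyp n) y p j) ?_
    (((hg.smooth_up i j).sub (JS.const _)).add (hg.b1 i j).smooth) ?_
  · exact (B1.sum fun p => (hg.b1_up_sub i p).mul_le (hg.b1 p j) (by linarith)).neg
  · refine hg.nearInf_det.mono fun t _ y hy h => ?_
    rw [up_sub_kd hy h.1]
    simp only [sub_mul, Finset.sum_sub_distrib, sum_kd_mul']
    ring

end MetricData

/-! ### Christoffel symbols: linear part and quadratic remainder -/

/-- The linearisation of the Christoffel symbols at the hyperbolic metric, for the metric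
perturbation `ω² h`. -/
noncomputable def linChr (h : Tensor2 n) (y : E n) (l i j : Fin n) : ℝ :=
  1 / 2 * (pd i (fun x => h x l j) y + pd j (fun x => h x l i) y - pd l (fun x => h x i j) y)
    - om y * (y l * h y i j - kd i j * ∑ p, y p * h y p l)

/-- The part of the Christoffel symbols which is at least quadratic in the perturbation. -/
noncomputable def quadChr (G : Tensor2 n) (y : E n) (l i j : Fin n) : ℝ :=
  christoffel G y l i j - christoffel (hyp n) y l i j - linChr (rs (G - hyp n)) y l i j

/-- Differentiating G = ω²(1 + h) and using A(1 + h) = 1 turns the terms carrying ∂_iω and ∂_jω into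
those of b exactly. In what is left beyond the linear part, every summand contains (A - 1) times h
or ∂h, or the quadratic quantity A - 1 + h. -/
lemma quadChr_eq {G : Tensor2 n} {y : E n} (hy : ‖y‖ < 1) (h : IsUnit (rs G y).det)
    (hs : ∀ y i j, G y i j = G y j i) (hd : ∀ i j l, HasPd l (fun x => rs G x i j)
      (pd l (fun x => rs (G - hyp n) x i j) y) y) (l i j : Fin n) :
    quadChr G y l i j = ∑ p, (1 / 2 * (up G y l p - kd l p) *
      (pd i (fun x => rs (G - hyp n) x p j) y + pd j (fun x => rs (G - hyp n) x p i) y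
        - pd p (fun x => rs (G - hyp n) x i j) y)
      - om y * y p * ((up G y l p - kd l p + rs (G - hyp n) y l p) * kd i j
        + (up G y l p - kd l p) * rs (G - hyp n) y i j)) := by
  have h0 := (om_pos hy).ne'
  have hpd : ∀ a b c, pd c (fun x => G x a b) y = 2 * om y ^ 3 * y c * rs G y a b
      + om y ^ 2 * pd c (fun x => rs (G - hyp n) x a b) y := by
    intro a b c
    have h1 : HasPd c (fun x => G x a b) _ y :=
      ((HasPd.om_pow c 2 hy).mul (hd a b c)).congr_of_eventuallyEq (by
        filter_upwards [Metric.isOpen_ball.mem_nhds (x := y) (s := Metric.ball 0 1)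
          (by simpa using hy)] with x hx using om_sq_mul_rs G (by simpa using hx) a b)
    rw [h1.2]; push_cast; ring
  have hsym : ∀ p, rs (G - hyp n) y p l = rs (G - hyp n) y l p := by
    intro p
    have h1 := rs_sub_hyp G hy p l
    have h2 := rs_sub_hyp G hy l p
    rw [rs_apply, hs, ← rs_apply, h2, kd_comm] at h1
    linarith
  have e1 := sum_inv_mul h l j
  have e2 := sum_inv_mul h l i
  rw [quadChr, christoffel_hyp hy, linChr, christoffel]
  simp only [inv_eq_up G hy h, hpd, hsym]
  have e3 : ∑ p, (om y ^ 2)⁻¹ * up G y l p *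
      ((2 * om y ^ 3 * y i * rs G y p j + om y ^ 2 * pd i (fun x => rs (G - hyp n) x p j) y) +
        (2 * om y ^ 3 * y j * rs G y p i + om y ^ 2 * pd j (fun x => rs (G - hyp n) x p i) y) -
        (2 * om y ^ 3 * y p * rs G y i j + om y ^ 2 * pd p (fun x => rs (G - hyp n) x i j) y))
      = 2 * om y * y i * ∑ p, up G y l p * rs G y p j
        + 2 * om y * y j * ∑ p, up G y l p * rs G y p i
        + ∑ p, up G y l p * (pd i (fun x => rs (G - hyp n) x p j) y
          + pd j (fun x => rs (G - hyp n) x p i) y - pd p (fun x => rs (G - hyp n) x i j) y)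
        - 2 * om y * rs G y i j * ∑ p, up G y l p * y p := by
    simp only [Finset.mul_sum, ← Finset.sum_add_distrib, ← Finset.sum_sub_distrib]
    refine Finset.sum_congr rfl fun p _ => ?_
    field_simp
    ring
  rw [e3]
  rw [show ∑ p, up G y l p * rs G y p j = kd l j from e1,
    show ∑ p, up G y l p * rs G y p i = kd l i from e2, rs_sub_hyp G hy i j]
  have e4 : ∀ F : Fin n → ℝ, ∑ p, (up G y l p - kd l p) * F p = ∑ p, up G y l p * F p - F l := by
    intro F; simp [sub_mul]
  have e5 : ∑ p, (1 / 2 * (up G y l p - kd l p) *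
      (pd i (fun x => rs (G - hyp n) x p j) y + pd j (fun x => rs (G - hyp n) x p i) y
        - pd p (fun x => rs (G - hyp n) x i j) y)
      - om y * y p * ((up G y l p - kd l p + rs (G - hyp n) y l p) * kd i j
        + (up G y l p - kd l p) * rs (G - hyp n) y i j))
      = 1 / 2 * ∑ p, (up G y l p - kd l p) * (pd i (fun x => rs (G - hyp n) x p j) y
          + pd j (fun x => rs (G - hyp n) x p i) y - pd p (fun x => rs (G - hyp n) x i j) y)
        - om y * kd i j * ∑ p, (up G y l p - kd l p) * y p
        - om y * kd i j * ∑ p, y p * rs (G - hyp n) y l p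
        - om y * rs (G - hyp n) y i j * ∑ p, (up G y l p - kd l p) * y p := by
    simp only [Finset.mul_sum, ← Finset.sum_sub_distrib]
    exact Finset.sum_congr rfl fun p _ => by ring
  rw [e5, e4, e4]
  ring

namespace MetricData

variable {I : Set ℝ} {τ : ℝ} {g : ℝ → Tensor2 n}

lemma b1_linChr (hg : MetricData I τ g) (l i j : Fin n) :
    B1 I (1 - τ) (fun t y => linChr (rs (g t - hyp n)) y l i j) := by
  unfold linChr
  refine B1.sub (B1.const_mul _ (((hg.b1_pd i l j).add (hg.b1_pd j l i)).sub (hg.b1_pd l i j))) ?_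
  refine B1.om.mul_le (b := -τ) (B1.sub ?_ ?_) (by linarith)
  · exact (B1.coord l).mul_le (hg.b1 i j) (by linarith)
  · exact (B1.const _).mul_le (B1.sum fun p => (B1.coord p).mul_le (hg.b1 p l) (c := -τ)
      (by linarith)) (by linarith)

lemma smooth_christoffel (hg : MetricData I τ g) (l i j : Fin n) :
    JS I (fun t y => christoffel (g t) y l i j) := by
  unfold christoffel
  exact (JS.const _).mul (JS.sum fun p => (hg.smooth_inv l p).mul
    ((((hg.smooth p j).pd i).add ((hg.smooth p i).pd j)).sub ((hg.smooth i j).pd p)))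

lemma b1_quadChr (hg : MetricData I τ g) (l i j : Fin n) :
    B1 I (1 - 2 * τ) (fun t y => quadChr (g t) y l i j) := by
  have hs : JS I (fun t y => quadChr (g t) y l i j) := by
    unfold quadChr
    exact ((hg.smooth_christoffel l i j).sub (b1_christoffel_hyp l i j).smooth).sub
      (hg.b1_linChr l i j).smooth
  refine B1.congr ?_ hs ((hg.nearInf_det.and hg.nearInf_pd_rs).mono fun t _ y hy h =>
    quadChr_eq hy h.1.1 (hg.symm t) h.2 l i j)
  refine B1.sum fun p => B1.sub ?_ ?_
  · exact ((hg.b1_up_sub l p).const_mul _).mul_le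
      (((hg.b1_pd i p j).add (hg.b1_pd j p i)).sub (hg.b1_pd p i j)) (by linarith)
  · refine (B1.om.mul_le (B1.coord p) (c := 1) (by norm_num)).mul_le (b := -(2 * τ))
      (B1.add ?_ ?_) (by linarith)
    · exact (hg.b1_up_sub_add l p).mul_le (B1.const _) (by linarith)
    · exact (hg.b1_up_sub l p).mul_le (hg.b1 i j) (by linarith)

end MetricData

/-! ### Expansion of the scalar curvature at the hyperbolic metric -/

section HypContraction

variable {y : E n} (hy : ‖y‖ < 1)
include hy

lemma sum_christoffel_hyp_mul (l j : Fin n) (F : Fin n → ℝ) :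
    ∑ p, christoffel (hyp n) y l j p * F p =
      om y * (y j * F l + kd l j * ∑ p, y p * F p - y l * F j) := by
  have : ∀ p, christoffel (hyp n) y l j p * F p = om y * (y j * (kd l p * F p)
      + kd l j * (y p * F p) - y l * (kd j p * F p)) := by
    intro p; rw [christoffel_hyp hy]; ring
  simp only [this, ← Finset.mul_sum, Finset.sum_add_distrib, Finset.sum_sub_distrib, sum_kd_mul']

lemma sum_christoffel_hyp_mul' (j p : Fin n) (F : Fin n → ℝ) :
    ∑ l, christoffel (hyp n) y l j p * F l =
      om y * (y j * F p + y p * F j - kd j p * ∑ l, y l * F l) := by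
  have : ∀ l, christoffel (hyp n) y l j p * F l = om y * (y j * (kd l p * F l)
      + y p * (kd l j * F l) - kd j p * (y l * F l)) := by
    intro l; rw [christoffel_hyp hy]; ring
  simp only [this, ← Finset.mul_sum, Finset.sum_add_distrib, Finset.sum_sub_distrib, sum_kd_mul]

lemma christoffel_hyp_trace (p : Fin n) :
    ∑ l, christoffel (hyp n) y l l p = n * om y * y p := by
  have : ∀ l, christoffel (hyp n) y l l p = om y * y p := by
    intro l; rw [christoffel_hyp hy, kd_self]; ring
  simp only [this, Finset.sum_const, Finset.card_univ, Fintype.card_fin, nsmul_eq_mul]; ring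

lemma christoffel_hyp_trace' (p : Fin n) :
    ∑ l, christoffel (hyp n) y l p l = n * om y * y p := by
  rw [← christoffel_hyp_trace hy]
  refine Finset.sum_congr rfl fun l _ => ?_
  rw [christoffel_hyp hy, christoffel_hyp hy, kd_comm l p]; ring

lemma christoffel_hyp_sum_diag (p : Fin n) :
    ∑ i, christoffel (hyp n) y p i i = (2 - n) * om y * y p := by
  have : ∀ i, christoffel (hyp n) y p i i = om y * (2 * (kd p i * y i) - y p) := by
    intro i; rw [christoffel_hyp hy, kd_self]; ring
  simp only [this, ← Finset.mul_sum, Finset.sum_sub_distrib, sum_kd_mul', Finset.sum_const,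
    Finset.card_univ, Fintype.card_fin, nsmul_eq_mul]; ring

lemma om_mul_sum_sq : om y * ∑ p, y p * y p = om y - 2 := by
  rw [← om_mul_sq hy, EuclideanSpace.norm_sq_eq]
  congr 1
  exact Finset.sum_congr rfl fun p _ => by rw [Real.norm_eq_abs, sq_abs, sq]

lemma hasPd_christoffel_hyp (a l i j : Fin n) :
    HasPd a (fun x => christoffel (hyp n) x l i j)
      (om y ^ 2 * y a * (y i * kd l j + y j * kd l i - y l * kd i j)
        + om y * (kd i a * kd l j + kd j a * kd l i - kd l a * kd i j)) y := by
  have h : HasPd a (fun x : E n => om x * (x i * kd l j + x j * kd l i - x l * kd i j))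
      (om y ^ 2 * y a * (y i * kd l j + y j * kd l i - y l * kd i j)
        + om y * (kd i a * kd l j + kd j a * kd l i - kd l a * kd i j)) y :=
    (HasPd.om a hy).mul ((((HasPd.coord a i y).mul_const _).add
      ((HasPd.coord a j y).mul_const _)).sub ((HasPd.coord a l y).mul_const _))
  refine h.congr_of_eventuallyEq ?_
  filter_upwards [Metric.isOpen_ball.mem_nhds (x := y) (s := Metric.ball 0 1) (by simpa using hy)]
    with x hx
  exact christoffel_hyp (by simpa using hx) l i j

/-- Hyperbolic space is Einstein, Ric = -(n-1)b. After the sums over the explicit Christoffel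
symbols are carried out, only ω|y|² = ω - 2 is needed. The value of the constant matters: contracted
with the perturbation of the inverse metric it yields the zeroth-order term of the linearised scalar
curvature. -/
lemma ricci_hyp (i j : Fin n) : ricci (hyp n) y i j = -((n : ℝ) - 1) * om y ^ 2 * kd i j := by
  have e1 : ∑ l, pd l (fun x => christoffel (hyp n) x l i j) y =
      om y ^ 2 * (2 * (y i * y j) - kd i j * ∑ p, y p * y p) + (2 - n) * om y * kd i j := by
    have : ∀ l, pd l (fun x => christoffel (hyp n) x l i j) y =
        om y ^ 2 * (y i * (y l * kd l j) + y j * (y l * kd l i) - kd i j * (y l * y l))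
        + om y * (kd i l * kd l j + kd j l * kd l i - kd i j) := by
      intro l; rw [(hasPd_christoffel_hyp hy l l i j).2, kd_self]; ring
    simp only [this, ← Finset.mul_sum, Finset.sum_add_distrib, Finset.sum_sub_distrib, sum_mul_kd,
      Finset.sum_const, Finset.card_univ, Fintype.card_fin, nsmul_eq_mul]
    rw [kd_comm j i]; ring
  have e2 : ∑ l, pd j (fun x => christoffel (hyp n) x l i l) y =
      n * (om y ^ 2 * y i * y j + om y * kd i j) := by
    have : ∀ l, pd j (fun x => christoffel (hyp n) x l i l) y =
        (om y ^ 2 * y i * y j + om y * kd i j) + om y ^ 2 * y j * (kd l i * y l - y l * kd l i)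
          + om y * (kd l j * kd l i - kd l j * kd l i) := by
      intro l; rw [(hasPd_christoffel_hyp hy j l i l).2, kd_self, kd_comm i l]; ring
    simp only [this, sub_self, mul_comm (kd _ i), mul_zero, add_zero, Finset.sum_const,
      Finset.card_univ, Fintype.card_fin, nsmul_eq_mul]
  have e3 : ∑ l, ∑ p, christoffel (hyp n) y l l p * christoffel (hyp n) y p i j =
      n * om y ^ 2 * (2 * (y i * y j) - kd i j * ∑ p, y p * y p) := by
    rw [Finset.sum_comm]
    simp only [← Finset.sum_mul, christoffel_hyp_trace hy]
    have : ∀ p, n * om y * y p * christoffel (hyp n) y p i j =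
        n * om y * (christoffel (hyp n) y p i j * y p) := fun p => by ring
    simp only [this, ← Finset.mul_sum, sum_christoffel_hyp_mul' hy]
    ring
  have e4 : ∑ l, ∑ p, christoffel (hyp n) y l j p * christoffel (hyp n) y p i l =
      om y ^ 2 * ((n + 2) * (y i * y j) - 2 * kd i j * ∑ p, y p * y p) := by
    have h1 : ∀ l, ∑ p, y p * christoffel (hyp n) y p i l =
        om y * (2 * (y i * y l) - kd i l * ∑ p, y p * y p) := by
      intro l
      simp only [mul_comm (y.ofLp _) (christoffel _ _ _ _ _), sum_christoffel_hyp_mul' hy]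
      ring
    have h2 : ∑ l, y l * christoffel (hyp n) y j i l = om y * (y i * y j
        + kd j i * ∑ p, y p * y p - y j * y i) := by
      simp only [mul_comm (y.ofLp _) (christoffel _ _ _ _ _), sum_christoffel_hyp_mul hy]
    simp only [sum_christoffel_hyp_mul hy, h1, ← Finset.mul_sum, Finset.sum_add_distrib,
      Finset.sum_sub_distrib, christoffel_hyp_trace' hy, sum_kd_mul, h2]
    rw [kd_comm j i]; ring
  have e5 := om_mul_sum_sq hy
  simp only [ricci, Matrix.of_apply, Finset.sum_sub_distrib, e1, e2, e3, e4]
  linear_combination (1 - (n : ℝ)) * om y * kd i j * e5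

end HypContraction

/-- The linearisation of the Ricci tensor at the hyperbolic metric in terms of the variation `C` of
the Christoffel symbols. -/
noncomputable def linRic (C : E n → Fin n → Fin n → Fin n → ℝ) (y : E n) (i j : Fin n) : ℝ :=
  ∑ l, (pd l (fun x => C x l i j) y - pd j (fun x => C x l i l) y)
    + ∑ l, ∑ p, (christoffel (hyp n) y l l p * C y p i j + C y l l p * christoffel (hyp n) y p i j
      - christoffel (hyp n) y l j p * C y p i l - C y l j p * christoffel (hyp n) y p i l)

/-- The linearisation at the hyperbolic metric of `div - d tr`, applied to `ω² h`. -/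
noncomputable def divTr (h : Tensor2 n) : OneForm n := fun y j =>
  ∑ i, (pd i (fun x => h x i j) y - pd j (fun x => h x i i) y)
    + om y * (n * ∑ i, y i * h y i j - y j * ∑ i, h y i i)

lemma BO.linRic {I : Set ℝ} {a : ℝ} {C : ℝ → E n → Fin n → Fin n → Fin n → ℝ}
    (h : ∀ l i j, B1 I a (fun t y => C t y l i j)) (i j : Fin n) :
    BO I (a + 1) (fun t y => AHData.linRic (C t) y i j) := by
  unfold AHData.linRic
  refine (BO.sum fun l _ => ((h l i j).bO_pd l).sub ((h l i l).bO_pd j)).add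
    (BO.sum fun l _ => BO.sum fun p _ => ((BO.add ?_ ?_).sub ?_).sub ?_)
  · exact (b1_christoffel_hyp _ _ _).bO.mul_le (h _ _ _).bO (by linarith)
  · exact (h _ _ _).bO.mul_le (b1_christoffel_hyp _ _ _).bO (by linarith)
  · exact (b1_christoffel_hyp _ _ _).bO.mul_le (h _ _ _).bO (by linarith)
  · exact (h _ _ _).bO.mul_le (b1_christoffel_hyp _ _ _).bO (by linarith)

/-- Ricci curvature is linear in ∂Γ and quadratic in Γ. Substituting Γ = Γ_b + L + Q, with L linear
and Q quadratic in the perturbation, leaves the product of L + Q with itself as the only nonlinear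
term. -/
lemma ricci_expansion {G : Tensor2 n} {y : E n} (hy : ‖y‖ < 1)
    (h1 : ∀ l i j, DifferentiableAt ℝ (fun x => linChr (rs (G - hyp n)) x l i j) y)
    (h2 : ∀ l i j, DifferentiableAt ℝ (fun x => quadChr G x l i j) y) (i j : Fin n) :
    ricci G y i j = ricci (hyp n) y i j + linRic (linChr (rs (G - hyp n))) y i j
      + linRic (quadChr G) y i j
      + ∑ l, ∑ p, ((linChr (rs (G - hyp n)) y l l p + quadChr G y l l p)
          * (linChr (rs (G - hyp n)) y p i j + quadChr G y p i j)
        - (linChr (rs (G - hyp n)) y l j p + quadChr G y l j p)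
          * (linChr (rs (G - hyp n)) y p i l + quadChr G y p i l)) := by
  have e : ∀ x l i j, christoffel G x l i j = christoffel (hyp n) x l i j
      + linChr (rs (G - hyp n)) x l i j + quadChr G x l i j := by
    intro x l i j; rw [quadChr]; ring
  have hp : ∀ a l i j, pd a (fun x => christoffel G x l i j) y =
      pd a (fun x => christoffel (hyp n) x l i j) y
      + pd a (fun x => linChr (rs (G - hyp n)) x l i j) y + pd a (fun x => quadChr G x l i j) y := by
    intro a l i j
    simp only [e]
    exact (((hasPd_pd a (hasPd_christoffel_hyp hy a l i j).1).add (hasPd_pd a (h1 l i j))).add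
      (hasPd_pd a (h2 l i j))).2
  simp only [ricci, linRic, Matrix.of_apply, hp]
  simp only [e, mul_add, add_mul, Finset.sum_add_distrib, Finset.sum_sub_distrib]
  ring

/-- The linearised Ricci tensor is ∇_l L^l_{ij} - ∇_j L^l_{il}, so its trace is the divergence of
the one-form with components L^l_{ii} - L^i_{il}, summed over i. That one-form is div - d tr of the
perturbation. The sums X and Z below are its two halves. -/
lemma trace_linRic {h : Tensor2 n} {y : E n} (hy : ‖y‖ < 1) (hs : ∀ x i j, h x i j = h x j i)
    (hd : ∀ l i j, DifferentiableAt ℝ (fun x => linChr h x l i j) y) :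
    ∑ i, linRic (linChr h) y i i = ∑ l, pd l (fun x => divTr h x l) y
      + (n - 2) * om y * ∑ l, y l * divTr h y l := by
  have hsym : ∀ x l i j, linChr h x l i j = linChr h x l j i := by
    intro x l i j
    simp only [linChr, hs x i j, kd_comm i j]
    have : (fun x => h x i j) = fun x => h x j i := by ext x; rw [hs]
    rw [this]; ring
  have hXZ : ∀ x l, ∑ i, (linChr h x l i i - linChr h x i l i) = divTr h x l := by
    intro x l
    have e : ∀ i, linChr h x l i i - linChr h x i l i =
        (pd i (fun x => h x i l) x - pd l (fun x => h x i i) x)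
        + om x * ((∑ p, x p * h x p l) + x i * h x i l - x l * h x i i
          - kd l i * ∑ p, x p * h x p i) := by
      intro i
      have h1 : (fun x => h x l i) = fun x => h x i l := by ext x; rw [hs]
      simp only [linChr, h1, kd_self, hs x l i]
      ring
    simp only [e, Finset.sum_add_distrib, ← Finset.mul_sum, Finset.sum_sub_distrib, sum_kd_mul',
      divTr, Finset.sum_const, Finset.card_univ, Fintype.card_fin, nsmul_eq_mul]
    ring
  have e1 : ∑ i, ∑ l, (pd l (fun x => linChr h x l i i) y - pd i (fun x => linChr h x l i l) y) =
      ∑ l, pd l (fun x => divTr h x l) y := by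
    simp only [Finset.sum_sub_distrib]
    rw [Finset.sum_comm, ← Finset.sum_sub_distrib]
    refine Finset.sum_congr rfl fun l _ => ?_
    simp only [← hXZ]
    rw [(HasPd.sum fun i _ => (hasPd_pd l (hd l i i)).sub (hasPd_pd l (hd i l i))).2,
      Finset.sum_sub_distrib]
  set X : Fin n → ℝ := fun l => ∑ i, linChr h y l i i with hX
  set Z : Fin n → ℝ := fun l => ∑ i, linChr h y i l i with hZ
  have e2 : ∑ i, ∑ l, ∑ p, christoffel (hyp n) y l l p * linChr h y p i i
      = n * om y * ∑ p, y p * X p := by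
    have : ∀ i, ∑ l, ∑ p, christoffel (hyp n) y l l p * linChr h y p i i =
        ∑ p, n * om y * (y p * linChr h y p i i) := by
      intro i
      rw [Finset.sum_comm]
      simp only [← Finset.sum_mul, christoffel_hyp_trace hy, mul_assoc]
    simp only [this]
    rw [Finset.sum_comm]
    simp only [← Finset.mul_sum, hX]
  have e3 : ∑ i, ∑ l, ∑ p, linChr h y l l p * christoffel (hyp n) y p i i
      = (2 - n) * om y * ∑ p, y p * Z p := by
    have h1 : ∀ i, ∑ l, ∑ p, linChr h y l l p * christoffel (hyp n) y p i i =
        ∑ p, Z p * christoffel (hyp n) y p i i := by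
      intro i
      rw [Finset.sum_comm]
      refine Finset.sum_congr rfl fun p _ => ?_
      rw [← Finset.sum_mul, hZ]
      simp only [hsym y _ p]
    simp only [h1]
    rw [Finset.sum_comm]
    simp only [← Finset.mul_sum, christoffel_hyp_sum_diag hy]
    rw [Finset.mul_sum]
    exact Finset.sum_congr rfl fun p _ => by ring
  have e4 : ∑ i, ∑ l, ∑ p, christoffel (hyp n) y l i p * linChr h y p i l
      = om y * ∑ p, y p * X p := by
    have h1 : ∀ i l, ∑ p, christoffel (hyp n) y l i p * linChr h y p i l =
        om y * (y i * linChr h y l i l + kd l i * ∑ p, y p * linChr h y p i l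
          - y l * linChr h y i i l) := fun i l => sum_christoffel_hyp_mul hy l i _
    simp only [h1, ← Finset.mul_sum, Finset.sum_sub_distrib, Finset.sum_add_distrib, sum_kd_mul]
    have h2 : ∑ i, ∑ l, y l * linChr h y i i l = ∑ l, y l * ∑ i, linChr h y i l i := by
      rw [Finset.sum_comm]
      simp only [Finset.mul_sum, hsym y _ _ _]
    have h3 : ∑ i, ∑ p, y p * linChr h y p i i = ∑ p, y p * X p := by
      rw [Finset.sum_comm]
      simp only [← Finset.mul_sum, hX]
    rw [h2, h3]; ring
  have e5 : ∑ i, ∑ l, ∑ p, linChr h y l i p * christoffel (hyp n) y p i l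
      = om y * ∑ p, y p * X p := by
    rw [← e4]
    refine Finset.sum_congr rfl fun i _ => ?_
    rw [Finset.sum_comm]
    exact Finset.sum_congr rfl fun l _ => Finset.sum_congr rfl fun p _ => mul_comm _ _
  have e6 : ∀ l, divTr h y l = X l - Z l := by
    intro l; rw [← hXZ, Finset.sum_sub_distrib]
  simp only [linRic, Finset.sum_add_distrib, e1]
  simp only [Finset.sum_sub_distrib, Finset.sum_add_distrib, e2, e3, e4, e5, e6, mul_sub]
  ring

namespace MetricData

variable {I : Set ℝ} {τ : ℝ} {g : ℝ → Tensor2 n}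

lemma symm_rs_sub (hg : MetricData I τ g) (t : ℝ) (y : E n) (i j : Fin n) :
    rs (g t - hyp n) y i j = rs (g t - hyp n) y j i := by
  simp only [rs_apply, Pi.sub_apply, Matrix.sub_apply, hyp_apply, hg.symm t y i j, kd_comm i j]

/-- The b-trace of the linearised Ricci tensor gives the divergence term. The term (n-1) tr h comes
from A = 1 - h + O(h²) contracted with Ric_b = -(n-1)b. The rest is quadratic: A - 1 + h against
Ric_b, A - 1 against the linearised Ricci tensor, and A against the Ricci remainder. -/
theorem scal_expansion (hg : MetricData I τ g) :
    BO I (-(2 * τ)) (fun t y => scal (g t) y + n * (n - 1)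
      - ((n - 1) * ∑ i, rs (g t - hyp n) y i i + (om y ^ 2)⁻¹ *
        (∑ l, pd l (fun x => divTr (rs (g t - hyp n)) x l) y
          + (n - 2) * om y * ∑ l, y l * divTr (rs (g t - hyp n)) y l))) := by
  set L : ℝ → E n → Fin n → Fin n → Fin n → ℝ := fun t => linChr (rs (g t - hyp n)) with hL
  set Q : ℝ → E n → Fin n → Fin n → Fin n → ℝ := fun t => quadChr (g t) with hQ
  have bL : ∀ l i j, B1 I (1 - τ) (fun t y => L t y l i j) := hg.b1_linChr
  have bQ : ∀ l i j, B1 I (1 - 2 * τ) (fun t y => Q t y l i j) := hg.b1_quadChr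
  have bC : ∀ l i j, BO I (1 - τ) (fun t y => L t y l i j + Q t y l i j) := fun l i j =>
    (bL l i j).bO.add ((bQ l i j).bO.mono (by linarith [hg.τ_pos]))
  -- Everything in Ric_g of at least second order in h. It is O(ω^{2-2τ}) because L + Q =
  -- O(ω^{1-τ}), Q = O(ω^{1-2τ}), and a derivative or a background symbol costs ω.
  set rem : ℝ → E n → Fin n → Fin n → ℝ := fun t y i j => linRic (Q t) y i j
      + ∑ l, ∑ p, ((L t y l l p + Q t y l l p) * (L t y p i j + Q t y p i j)
        - (L t y l j p + Q t y l j p) * (L t y p i l + Q t y p i l)) with hrem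
  have brem : ∀ i j, BO I (2 - 2 * τ) (fun t y => rem t y i j) := by
    intro i j
    refine ((BO.linRic bQ i j).mono (by linarith)).add (BO.sum fun l _ => BO.sum fun p _ => ?_)
    exact ((bC _ _ _).mul_le (bC _ _ _) (by linarith)).sub
      ((bC _ _ _).mul_le (bC _ _ _) (by linarith))
  have bLR : ∀ i j, BO I (2 - τ) (fun t y => linRic (L t) y i j) := fun i j =>
    (BO.linRic bL i j).mono (by linarith)
  have main : BO I (-(2 * τ)) (fun t y =>
      -((n : ℝ) - 1) * ∑ i, (up (g t) y i i - kd i i + rs (g t - hyp n) y i i)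
      + (om y ^ 2)⁻¹ * (∑ i, ∑ j, ((up (g t) y i j - kd i j) * linRic (L t) y i j
        + up (g t) y i j * rem t y i j))) := by
    refine ((BO.sum fun i _ => (hg.b1_up_sub_add i i).bO).const_mul _).add
      (b1_om_sq_inv.bO.mul_le (b := 2 - 2 * τ) (BO.sum fun i _ => BO.sum fun j _ => ?_)
        (by linarith))
    exact ((hg.b1_up_sub i j).bO.mul_le (bLR i j) (by linarith)).add
      ((hg.bO_up i j).mul_le (brem i j) (by linarith))
  refine main.congr ?_
  have dL : NearInf I (fun t y => ∀ l i j, DifferentiableAt ℝ (fun x => L t x l i j) y) :=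
    NearInf.all fun l => NearInf.all fun i => NearInf.all fun j => (bL l i j).smooth.differentiableAt
  have dQ : NearInf I (fun t y => ∀ l i j, DifferentiableAt ℝ (fun x => Q t x l i j) y) :=
    NearInf.all fun l => NearInf.all fun i => NearInf.all fun j => (bQ l i j).smooth.differentiableAt
  refine ((hg.nearInf_det.and dL).and dQ).mono fun t _ y hy h => ?_
  have h0 := (om_pos hy).ne'
  have hric : ∀ i j, ricci (g t) y i j = -((n : ℝ) - 1) * om y ^ 2 * kd i j
      + linRic (L t) y i j + rem t y i j := by
    intro i j
    rw [ricci_expansion hy h.1.2 h.2, ricci_hyp hy, hrem, add_assoc (_ + _)]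
  rw [← trace_linRic hy (hg.symm_rs_sub t) h.1.2]
  have hsum : scal (g t) y = -((n : ℝ) - 1) * ∑ i, up (g t) y i i
      + (om y ^ 2)⁻¹ * ∑ i, ∑ j, up (g t) y i j * (linRic (L t) y i j + rem t y i j) := by
    simp only [scal, tr, inv_eq_up (g t) hy h.1.1.1, hric]
    have : ∀ i j, (om y ^ 2)⁻¹ * up (g t) y i j * (-((n : ℝ) - 1) * om y ^ 2 * kd i j
        + linRic (L t) y i j + rem t y i j) = -((n : ℝ) - 1) * (up (g t) y i j * kd i j)
        + (om y ^ 2)⁻¹ * (up (g t) y i j * (linRic (L t) y i j + rem t y i j)) := by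
      intro i j; field_simp; ring
    simp only [this, Finset.sum_add_distrib, ← Finset.mul_sum, sum_mul_kd']
  rw [hsum]
  have e1 : ∑ i, (up (g t) y i i - kd i i + rs (g t - hyp n) y i i) =
      ∑ i, up (g t) y i i - n + ∑ i, rs (g t - hyp n) y i i := by
    simp [Finset.sum_add_distrib, Finset.sum_sub_distrib]
  have e2 : ∑ i, ∑ j, ((up (g t) y i j - kd i j) * linRic (L t) y i j
        + up (g t) y i j * rem t y i j) =
      ∑ i, ∑ j, up (g t) y i j * (linRic (L t) y i j + rem t y i j)
        - ∑ i, linRic (L t) y i i := by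
    rw [← Finset.sum_sub_distrib]
    refine Finset.sum_congr rfl fun i _ => ?_
    rw [← sum_kd_mul' i (fun j => linRic (L t) y i j), ← Finset.sum_sub_distrib]
    exact Finset.sum_congr rfl fun j _ => by ring
  rw [e1, e2]
  ring

end MetricData

/-! ### Expansion of the constraints -/

lemma covDeriv_ofTensor2 (G k : Tensor2 n) (y : E n) (l i j : Fin n) :
    covDeriv G (ofTensor2 k) y ![l, i, j] = pd l (fun x => k x i j) y
      - (∑ p, christoffel G y p l i * k y p j + ∑ p, christoffel G y p l j * k y i p) := by
  have h1 : Fin.tail ![l, i, j] = ![i, j] := rfl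
  simp [covDeriv, h1, ofTensor2, Fin.sum_univ_two]

/-- `G^{il} (∂_l h_{ij} - ∂_j h_{il})` in rescaled components, with the lower order terms of
`div_b - d tr_b`. -/
noncomputable def divTrUp (A h : Tensor2 n) : OneForm n := fun y j =>
  ∑ i, ∑ l, A y i l * (pd l (fun x => h x i j) y - pd j (fun x => h x i l) y)
    + om y * (n * ∑ i, y i * h y i j - y j * ∑ i, h y i i)

lemma divTrUp_sub_divTr (A h : Tensor2 n) (y : E n) (j : Fin n) :
    divTrUp A h y j - divTr h y j = ∑ i, ∑ l, (A y i l - kd i l) *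
      (pd l (fun x => h x i j) y - pd j (fun x => h x i l) y) := by
  simp only [divTrUp, divTr, sub_mul, Finset.sum_sub_distrib, sum_kd_mul']
  ring

namespace MetricData

variable {I : Set ℝ} {τ a : ℝ} {g k : ℝ → Tensor2 n}

lemma bO_inv (hg : MetricData I τ g) (i j : Fin n) : BO I (-2) (fun t y => (g t y)⁻¹ i j) :=
  ((b1_om_sq_inv.bO.mul_le (hg.bO_up i j) (c := -2) (by norm_num))).congr
    (hg.nearInf_det.mono fun t _ _ hy h => inv_eq_up (g t) hy h.1 i j)

lemma bO_of_rs (h : ∀ i j, BO I a (fun t y => rs (k t) y i j)) (i j : Fin n) :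
    BO I (2 + a) (fun t y => k t y i j) :=
  ((BO.om_pow 2).mul_le (h i j) (by norm_num)).congr
    (nearInf_true.mono fun t _ _ hy _ => om_sq_mul_rs (k t) hy i j)

/-- The constant n(n-1) is -2Λ; the difference consists of (tr k)² and |k|², which are quadratic in
k. -/
lemma bO_energy_sub_scal (hg : MetricData I τ g) (hk : ∀ i j, BO I a (fun t y => rs (k t) y i j)) :
    BO I (2 * a) (fun t y => energyDensity (g t) (k t) y - (scal (g t) y + n * (n - 1))) := by
  have hk' := bO_of_rs hk
  have h1 : BO I a (fun t y => tr (g t) (k t) y) := BO.sum fun i _ => BO.sum fun j _ =>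
    (hg.bO_inv i j).mul_le (hk' i j) (by linarith)
  have h2 : BO I (2 * a) (fun t y => normSq (g t) (ofTensor2 (k t)) y) := by
    unfold normSq
    simp only [Fin.prod_univ_two, ofTensor2]
    refine BO.sum fun J _ => BO.sum fun J' _ => BO.mul_le (a := -2 + -2)
      ((hg.bO_inv _ _).mul (hg.bO_inv _ _)) ((hk' _ _).mul (hk' _ _)) (by linarith)
  refine ((h1.mul_le h1 (c := 2 * a) (by linarith)).sub h2).congr
    (nearInf_true.mono fun t _ y _ _ => ?_)
  rw [energyDensity, cosmo]; ring

/-- All derivatives of k are kept, contracted with the true inverse metric A. The error contains k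
only undifferentiated, multiplied by A - 1, by Γ_g - Γ_b or by ∂A, so a pointwise bound on k
suffices, without one on ∂k. This is what makes the weaker decay hypothesis on k usable. -/
theorem momentum_expansion (hg : MetricData I τ g) (hks : ∀ t y i j, k t y i j = k t y j i)
    (hkJ : ∀ i j, JS I (fun t y => rs (k t) y i j))
    (hk : ∀ i j, BO I a (fun t y => rs (k t) y i j)) (j : Fin n) :
    BO I (1 - τ + a) (fun t y => momentumDensity (g t) (k t) y j
      - divTrUp (up (g t)) (rs (k t)) y j) := by
  set C : ℝ → E n → Fin n → Fin n → Fin n → ℝ := fun t y l i j =>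
    linChr (rs (g t - hyp n)) y l i j + quadChr (g t) y l i j with hC
  have bC : ∀ l i j, BO I (1 - τ) (fun t y => C t y l i j) := fun l i j =>
    (hg.b1_linChr l i j).bO.add ((hg.b1_quadChr l i j).bO.mono (by linarith [hg.τ_pos]))
  set q : ℝ → Tensor2 n := fun t => rs (k t) with hq
  -- The undifferentiated part of ω^{-2}∇_l k_{ij} for the background connection: the derivative
  -- falling on ω², and the symbols of b.
  set b : ℝ → E n → Fin n → Fin n → ℝ := fun t y i l => 2 * (om y * (y l * q t y i j))
    - (∑ p, christoffel (hyp n) y p l i * q t y p j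
      + ∑ p, christoffel (hyp n) y p l j * q t y i p) with hb
  have bb : ∀ i l, BO I (1 + a) (fun t y => b t y i l) := by
    intro i l
    refine (BO.const_mul _ (BO.om.mul_le (b := a) ((BO.coord l).mul_le (hk i j) (by linarith))
      (by linarith))).sub ((BO.sum fun p _ => ?_).add (BO.sum fun p _ => ?_))
    · exact (b1_christoffel_hyp _ _ _).bO.mul_le (hk p j) (by linarith)
    · exact (b1_christoffel_hyp _ _ _).bO.mul_le (hk i p) (by linarith)
  have main : BO I (1 - τ + a) (fun t y => ∑ i, ∑ l, ((up (g t) y i l - kd i l) * b t y i l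
      - up (g t) y i l * (∑ p, C t y p l i * q t y p j + ∑ p, C t y p l j * q t y i p)
      - pd j (fun x => up (g t) x i l - kd i l) y * q t y i l)) := by
    refine BO.sum fun i _ => BO.sum fun l _ => BO.sub (BO.sub ?_ ?_) ?_
    · exact (hg.b1_up_sub i l).bO.mul_le (bb i l) (by linarith)
    · refine (hg.bO_up i l).mul_le (b := 1 - τ + a) (BO.add (BO.sum fun p _ => ?_)
        (BO.sum fun p _ => ?_)) (by linarith)
      · exact (bC _ _ _).mul_le (hk p j) (by linarith)
      · exact (bC _ _ _).mul_le (hk i p) (by linarith)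
    · exact ((hg.b1_up_sub i l).bO_pd j).mul_le (hk i l) (by linarith)
  refine main.congr ?_
  have dq : NearInf I (fun t y => ∀ i j, DifferentiableAt ℝ (fun x => q t x i j) y) :=
    NearInf.all fun i => NearInf.all fun j => (hkJ i j).differentiableAt
  have dA : NearInf I (fun t y => ∀ i j, DifferentiableAt ℝ (fun x => up (g t) x i j) y) :=
    NearInf.all fun i => NearInf.all fun j => (hg.smooth_up i j).differentiableAt
  refine ((hg.nearInf_det.and hg.nearInf_det.eventually).and (dq.and dA)).mono
    fun t _ y hy h => ?_
  obtain ⟨⟨hdet, hdet'⟩, hdq, hdA⟩ := h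
  have h0 := (om_pos hy).ne'
  have hball : ∀ᶠ x in 𝓝 y, ‖x‖ < 1 := by
    filter_upwards [Metric.isOpen_ball.mem_nhds (x := y) (s := Metric.ball 0 1)
      (by simpa using hy)] with x hx using by simpa using hx
  have hpk : ∀ l i j, pd l (fun x => k t x i j) y = om y ^ 2 * (2 * (om y * (y l * q t y i j))
      + pd l (fun x => q t x i j) y) := by
    intro l i j
    have h1 : HasPd l (fun x => k t x i j) _ y :=
      ((HasPd.om_pow l 2 hy).mul (hasPd_pd l (hdq i j))).congr_of_eventuallyEq (by
        filter_upwards [hball] with x hx using om_sq_mul_rs (k t) hx i j)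
    rw [h1.2]; push_cast; ring
  have hptr : pd j (tr (g t) (k t)) y = ∑ i, ∑ l, (pd j (fun x => up (g t) x i l) y * q t y i l
      + up (g t) y i l * pd j (fun x => q t x i l) y) := by
    have h1 : HasPd j (tr (g t) (k t)) _ y :=
      (HasPd.sum fun i _ => HasPd.sum fun l _ => (hasPd_pd j (hdA i l)).mul
        (hasPd_pd j (hdq i l))).congr_of_eventuallyEq (by
        filter_upwards [hball, hdet'] with x hx hx'
        refine Finset.sum_congr rfl fun i _ => Finset.sum_congr rfl fun l _ => ?_
        have := (om_pos hx).ne'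
        rw [inv_eq_up (g t) hx hx'.1, om_sq_mul_rs (k t) hx]
        field_simp
        rfl)
    exact h1.2
  have hΓ : ∀ p l i, christoffel (g t) y p l i = christoffel (hyp n) y p l i + C t y p l i := by
    intro p l i; simp only [hC, quadChr]; ring
  have hdiv : divg (g t) (k t) y j = ∑ i, ∑ l, up (g t) y i l * (b t y i l
      - (∑ p, C t y p l i * q t y p j + ∑ p, C t y p l j * q t y i p)
      + pd l (fun x => q t x i j) y) := by
    refine Finset.sum_congr rfl fun i _ => Finset.sum_congr rfl fun l _ => ?_
    rw [covDeriv_ofTensor2, inv_eq_up (g t) hy hdet.1, hpk]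
    have e1 : ∀ F : Fin n → ℝ, ∀ K : Fin n → ℝ, (∑ p, F p * (om y ^ 2 * K p)) =
      om y ^ 2 * ∑ p, F p * K p := fun F K => by
        rw [Finset.mul_sum]; exact Finset.sum_congr rfl fun p _ => by ring
    have e2 : ∀ i j, k t y i j = om y ^ 2 * q t y i j := fun i j => om_sq_mul_rs (k t) hy i j
    simp only [e2, e1, hΓ, hb, add_mul, Finset.sum_add_distrib]
    field_simp
    ring
  -- Its Euclidean trace supplies exactly the lower-order terms built into `divTrUp`.
  have hbd : ∑ i, b t y i i = om y * (n * ∑ i, y i * q t y i j - y j * ∑ i, q t y i i) := by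
    have e1 : ∑ i, ∑ p, christoffel (hyp n) y p i i * q t y p j =
        (2 - n) * om y * ∑ i, y i * q t y i j := by
      rw [Finset.sum_comm]
      simp only [← Finset.sum_mul, christoffel_hyp_sum_diag hy, mul_assoc, ← Finset.mul_sum]
    have e2 : ∑ i, ∑ p, christoffel (hyp n) y p i j * q t y i p = om y * (y j * ∑ i, q t y i i) := by
      simp only [sum_christoffel_hyp_mul' hy, ← Finset.mul_sum, Finset.sum_add_distrib,
        Finset.sum_sub_distrib, sum_kd_mul]
      have : ∀ p, q t y j p = q t y p j := fun p => by simp only [hq, rs_apply, hks t y j p]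
      simp only [this]
      ring
    simp only [hb, Finset.sum_sub_distrib, Finset.sum_add_distrib, e1, e2, ← Finset.mul_sum]
    ring
  have hA' : ∀ i l, pd j (fun x => up (g t) x i l - kd i l) y = pd j (fun x => up (g t) x i l) y :=
    fun i l => by rw [pd, fderiv_sub_const]; rfl
  have hbd' : ∑ i, ∑ l, kd i l * b t y i l = ∑ i, b t y i i := by simp only [sum_kd_mul']
  rw [momentumDensity, hdiv, hptr, divTrUp, ← hbd, ← hbd']
  simp only [hA', ← Finset.sum_add_distrib, ← Finset.sum_sub_distrib]
  refine Finset.sum_congr rfl fun i _ => Finset.sum_congr rfl fun l _ => ?_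
  ring

end MetricData

/-! ### Static potentials and Killing fields -/

/-- A function with `∇² V = V b`. -/
structure StaticPotential (V : E n → ℝ) : Prop where
  smooth : ∀ y : E n, ‖y‖ < 1 → ContDiffAt ℝ ∞ V y
  bO : ∀ I, BO I 1 (fun _ y => V y)
  hess : ∀ y : E n, ‖y‖ < 1 → ∀ i j, pd j (fun x => pd i V x) y = om y ^ 2 * V y * kd i j
    + om y * (y i * pd j V y + y j * pd i V y - kd i j * ∑ p, y p * pd p V y)

/-- A Killing field of hyperbolic space, bounded in the coordinates of the ball. -/
structure KillingField (Y : VField n) : Prop where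
  smooth : ∀ y : E n, ‖y‖ < 1 → ∀ j, ContDiffAt ℝ ∞ (fun x => Y x j) y
  bO : ∀ I j, BO I 0 (fun _ y => Y y j)
  killing : ∀ y : E n, ‖y‖ < 1 → ∀ i j, pd i (fun x => Y x j) y + pd j (fun x => Y x i) y =
    -2 * om y * (∑ p, y p * Y y p) * kd i j

lemma ball_eventually {y : E n} (hy : ‖y‖ < 1) : ∀ᶠ x in 𝓝 y, ‖x‖ < 1 := by
  filter_upwards [Metric.isOpen_ball.mem_nhds (x := y) (s := Metric.ball 0 1)
    (by simpa using hy)] with x hx using by simpa using hx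

lemma hasPd_V₀ (i : Fin n) {y : E n} (hy : ‖y‖ < 1) : HasPd i V₀ (om y ^ 2 * y i) y := by
  have h := ((HasPd.om i hy).sub (HasPd.const 1)).congr_deriv (sub_zero _)
  exact h.congr_of_eventuallyEq ((ball_eventually hy).mono fun x hx => V₀_eq_om hx)

lemma hasPd_Vᵢ (a i : Fin n) {y : E n} (hy : ‖y‖ < 1) :
    HasPd i (Vᵢ a) (om y ^ 2 * y i * y a + om y * kd a i) y :=
  ((HasPd.om i hy).mul (HasPd.coord i a y)).congr_of_eventuallyEq
    (Eventually.of_forall fun x => Vᵢ_eq_om a x)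

lemma hasPd_om_sq (i : Fin n) {y : E n} (hy : ‖y‖ < 1) :
    HasPd i (fun x : E n => om x ^ 2) (2 * om y ^ 3 * y i) y :=
  (HasPd.om_pow i 2 hy).congr_deriv (by norm_num)

lemma staticPotential_V₀ : StaticPotential (V₀ : E n → ℝ) where
  smooth y hy := ((contDiffAt_om hy).sub contDiffAt_const).congr_of_eventuallyEq
    ((ball_eventually hy).mono fun x hx => V₀_eq_om hx)
  bO I := (BO.om.sub ((BO.const 1).mono zero_le_one)).congr
    (nearInf_true.mono fun _ _ y hy _ => V₀_eq_om hy)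
  hess y hy i j := by
    have h : HasPd j (fun x => pd i V₀ x) _ y :=
      ((hasPd_om_sq j hy).mul (HasPd.coord j i y)).congr_of_eventuallyEq
        ((ball_eventually hy).mono fun x hx => (hasPd_V₀ i hx).2)
    have e := om_mul_sum_sq hy
    have e' : ∑ p, y p * (om y ^ 2 * y p) = om y * (om y - 2) := by
      rw [← e, Finset.mul_sum, Finset.mul_sum]; exact Finset.sum_congr rfl fun p _ => by ring
    rw [h.2]
    simp only [(hasPd_V₀ _ hy).2, V₀_eq_om hy, e']
    rw [show (if i = j then (1 : ℝ) else 0) = kd i j from rfl]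
    ring

lemma staticPotential_Vᵢ (a : Fin n) : StaticPotential (Vᵢ a) where
  smooth y hy := ((contDiffAt_om hy).mul (contDiffAt_coord a y)).congr_of_eventuallyEq
    (Eventually.of_forall fun x => Vᵢ_eq_om a x)
  bO I := (BO.om.mul_le (BO.coord a) (by norm_num)).congr
    (nearInf_true.mono fun _ _ y _ _ => Vᵢ_eq_om a y)
  hess y hy i j := by
    have h : HasPd j (fun x => pd i (Vᵢ a) x) _ y :=
      ((((hasPd_om_sq j hy).mul (HasPd.coord j i y)).mul (HasPd.coord j a y)).add
        ((HasPd.om j hy).mul_const (kd a i))).congr_of_eventuallyEq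
        ((ball_eventually hy).mono fun x hx => (hasPd_Vᵢ a i hx).2)
    have e := om_mul_sum_sq hy
    have e' : ∑ p, y p * (om y ^ 2 * y p * y a + om y * kd a p) = om y * (om y - 1) * y a := by
      have : ∀ p, y p * (om y ^ 2 * y p * y a + om y * kd a p) =
        om y ^ 2 * y a * (y p * y p) + om y * (y p * kd a p) := fun p => by ring
      simp only [this, Finset.sum_add_distrib, ← Finset.mul_sum, sum_mul_kd']
      linear_combination om y * y a * e
    rw [h.2]
    simp only [(hasPd_Vᵢ a _ hy).2, Vᵢ_eq_om, e']
    rw [show (if i = j then (1 : ℝ) else 0) = kd i j from rfl,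
      show (if a = j then (1 : ℝ) else 0) = kd a j from rfl]
    ring

lemma hasPd_Cᵢ (a i j : Fin n) (y : E n) : HasPd i (fun x => Cᵢ a x j)
    (-y i * kd j a + kd a i * y j + y a * kd j i) y := by
  have h := ((((HasPd.const 1).add (HasPd.normSq i y)).const_mul (1 / 2)).neg.mul_const
    (kd j a)).add ((HasPd.coord i a y).mul (HasPd.coord i j y))
  refine (h.congr_of_eventuallyEq (Eventually.of_forall fun x => ?_)).congr_deriv ?_
  · simp only [Cᵢ, kd]; ring
  · simp only [kd]; ring

/-- Needed as the field conjugate to V_(0). -/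
lemma killingField_zero : KillingField (0 : VField n) where
  smooth y _ j := contDiffAt_const
  bO I j := BO.zero
  killing y _ i j := by
    have : pd i (fun _ : E n => (0 : ℝ)) y = 0 := (HasPd.const 0).2
    have h' : pd j (fun _ : E n => (0 : ℝ)) y = 0 := (HasPd.const 0).2
    simp [this, h']

lemma killingField_Cᵢ (a : Fin n) : KillingField (Cᵢ a) where
  smooth y _ j := by
    unfold Cᵢ
    exact (((contDiffAt_const.add (contDiff_norm_sq ℝ).contDiffAt).div_const 2).neg.mul
      contDiffAt_const).add ((contDiffAt_coord a y).mul (contDiffAt_coord j y))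
  bO I j := by
    have h1 : BO I 0 (fun _ (y : E n) => ‖y‖ ^ 2) :=
      ⟨1, 0, fun t _ y hy => by
        rw [abs_of_nonneg (by positivity), Real.rpow_zero, mul_one]
        exact pow_le_one₀ (norm_nonneg _) hy.1.le⟩
    have h2 : BO I 0 (fun _ (y : E n) => -(1 / 2 * (1 + ‖y‖ ^ 2)) * kd j a + y a * y j) :=
      (((((BO.const 1).add h1).const_mul _).neg.mul_le (BO.const _) (by norm_num)).add
        ((BO.coord a).mul_le (BO.coord j) (by norm_num)))
    refine h2.congr (nearInf_true.mono fun _ _ y _ _ => ?_)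
    simp only [Cᵢ, kd]; ring
  killing y hy i j := by
    have e : ∑ p, y p * Cᵢ a y p = -(1 + ‖y‖ ^ 2) / 2 * y a + y a * ‖y‖ ^ 2 := by
      have h1 : ∀ p, y p * Cᵢ a y p = -(1 + ‖y‖ ^ 2) / 2 * (y p * kd p a) + y a * (y p * y p) := by
        intro p; simp only [Cᵢ, kd]; ring
      have h2 : ∑ p, y p * y p = ‖y‖ ^ 2 := by
        rw [EuclideanSpace.norm_sq_eq]
        exact Finset.sum_congr rfl fun p _ => by rw [Real.norm_eq_abs, sq_abs, sq]
      simp only [h1, Finset.sum_add_distrib, ← Finset.mul_sum, sum_mul_kd, h2]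
    rw [(hasPd_Cᵢ a i j y).2, (hasPd_Cᵢ a j i y).2, e, kd_comm j i, kd_comm j a, kd_comm i a]
    have h0 := one_sub_pos hy
    rw [om]
    field_simp
    ring

/-- The pair `(V, Y)` with `ω² Y = ω² V y - V_(0) dV`, that is `Y = V ∇V_(0) - V_(0) ∇V`. -/
def Conjugate (V : E n → ℝ) (Y : VField n) : Prop :=
  ∀ y : E n, ‖y‖ < 1 → ∀ i, om y ^ 2 * Y y i = om y ^ 2 * V y * y i - V₀ y * pd i V y

lemma conjugate_V₀ : Conjugate (V₀ : E n → ℝ) 0 := fun y hy i => by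
  rw [(hasPd_V₀ i hy).2]
  simp only [Pi.zero_apply]; ring

/-- This is where the boosts C_(i) enter: they are the antisymmetrised gradients of V_(i) and V_(0).
The identity reduces to ω|y|² = ω - 2. -/
lemma conjugate_Vᵢ (a : Fin n) : Conjugate (Vᵢ a) (Cᵢ a) := fun y hy i => by
  rw [(hasPd_Vᵢ a i hy).2, Vᵢ_eq_om, V₀_eq_om hy, Cᵢ, kd_comm a i]
  rw [show (if i = a then (1 : ℝ) else 0) = kd i a from rfl]
  have h0 := om_mul_sq hy
  linear_combination -(1 / 2) * om y * kd i a * h0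

/-! ### Charge densities in rescaled components -/

/-- The charge density of a function `V`, with `A` in place of the inverse background metric in the
derivative terms. -/
noncomputable def potUp (V : E n → ℝ) (A h : Tensor2 n) : OneForm n := fun y j =>
  V y * divTrUp A h y j - ∑ i, pd i V y * h y i j + (∑ i, h y i i) * pd j V y

/-- The charge density of a function `V`. -/
noncomputable def potDensity (V : E n → ℝ) (h : Tensor2 n) : OneForm n := fun y j =>
  V y * divTr h y j - ∑ i, pd i V y * h y i j + (∑ i, h y i i) * pd j V y

/-- The charge density of a vector field `Y`. -/
noncomputable def killDensity (Y : VField n) (q : Tensor2 n) : OneForm n := fun y j =>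
  2 * om y ^ 2 * (∑ i, Y y i * q y i j - (∑ i, q y i i) * Y y j)

lemma divTrUp_one (h : Tensor2 n) : divTrUp (fun _ => 1) h = divTr h := by
  ext y j
  have e : ∀ i l, (1 : Matrix (Fin n) (Fin n) ℝ) i l = kd i l := fun i l => by
    rw [Matrix.one_apply, kd]
  simp only [divTrUp, divTr, e, sum_kd_mul']

/-- Allows one formula for the time derivative to serve both the actual flux (A = 1) and the
modified one (A = g^{-1} rescaled). -/
lemma potUp_one (V : E n → ℝ) (h : Tensor2 n) : potUp V (fun _ => 1) h = potDensity V h := by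
  ext y j; rw [potUp, potDensity, divTrUp_one]

lemma tr_hyp (γ : Tensor2 n) {y : E n} (hy : ‖y‖ < 1) : tr (hyp n) γ y = ∑ i, rs γ y i i := by
  simp only [tr, hyp_inv_apply hy, mul_assoc, ← Finset.mul_sum, sum_kd_mul']
  rw [Finset.mul_sum]; rfl

/-- The derivatives of ω² and the traced background symbols combine to the terms n y·h and -y tr h.
Symmetry of γ is used to contract the symbols. -/
lemma divTr_eq {γ : Tensor2 n} {y : E n} (hy : ‖y‖ < 1) (hs : ∀ i j, γ y i j = γ y j i)
    (hd : ∀ i j, DifferentiableAt ℝ (fun x => rs γ x i j) y) (j : Fin n) :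
    divg (hyp n) γ y j - pd j (tr (hyp n) γ) y = divTr (rs γ) y j := by
  have h0 := (om_pos hy).ne'
  have h1 : HasPd j (tr (hyp n) γ) _ y := (HasPd.sum fun i _ =>
    hasPd_pd j (hd i i)).congr_of_eventuallyEq ((ball_eventually hy).mono fun x hx => tr_hyp γ hx)
  have hp : ∀ l i j, pd l (fun x => γ x i j) y = om y ^ 2 * (2 * (om y * (y l * rs γ y i j))
      + pd l (fun x => rs γ x i j) y) := by
    intro l i j
    have h1 : HasPd l (fun x => γ x i j) _ y :=
      ((HasPd.om_pow l 2 hy).mul (hasPd_pd l (hd i j))).congr_of_eventuallyEq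
        ((ball_eventually hy).mono fun x hx => om_sq_mul_rs γ hx i j)
    rw [h1.2]; push_cast; ring
  have e1 : ∑ i, ∑ p, christoffel (hyp n) y p i i * rs γ y p j =
      (2 - n) * om y * ∑ i, y i * rs γ y i j := by
    rw [Finset.sum_comm]
    simp only [← Finset.sum_mul, christoffel_hyp_sum_diag hy, mul_assoc, ← Finset.mul_sum]
  have e2 : ∑ i, ∑ p, christoffel (hyp n) y p i j * rs γ y i p =
      om y * (y j * ∑ i, rs γ y i i) := by
    simp only [sum_christoffel_hyp_mul' hy, ← Finset.mul_sum, Finset.sum_add_distrib,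
      Finset.sum_sub_distrib, sum_kd_mul]
    have : ∀ p, rs γ y j p = rs γ y p j := fun p => by simp only [rs_apply, hs j p]
    simp only [this]
    ring
  have e3 : ∀ i j, γ y i j = om y ^ 2 * rs γ y i j := om_sq_mul_rs γ hy
  have e4 : ∀ F K : Fin n → ℝ, (∑ p, F p * (om y ^ 2 * K p)) =
    om y ^ 2 * ∑ p, F p * K p := fun F K => by
      rw [Finset.mul_sum]; exact Finset.sum_congr rfl fun p _ => by ring
  have e5 : divg (hyp n) γ y j = ∑ i, (2 * (om y * (y i * rs γ y i j))
      + pd i (fun x => rs γ x i j) y - (∑ p, christoffel (hyp n) y p i i * rs γ y p j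
        + ∑ p, christoffel (hyp n) y p i j * rs γ y i p)) := by
    simp only [divg, covDeriv_ofTensor2, hyp_inv_apply hy, mul_assoc, ← Finset.mul_sum,
      sum_kd_mul', hp]
    simp only [e3, e4]
    rw [Finset.mul_sum]
    refine Finset.sum_congr rfl fun i _ => ?_
    field_simp
  rw [e5, h1.2]
  simp only [Finset.sum_sub_distrib, Finset.sum_add_distrib, e1, e2, ← Finset.mul_sum, divTr]
  ring

lemma chargeDensity_zero_right (V : E n → ℝ) {γ : Tensor2 n} (κ : Tensor2 n) {y : E n}
    (hy : ‖y‖ < 1) (hs : ∀ i j, γ y i j = γ y j i)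
    (hd : ∀ i j, DifferentiableAt ℝ (fun x => rs γ x i j) y) (j : Fin n) :
    chargeDensity V 0 γ κ y j = potDensity V (rs γ) y j := by
  rw [chargeDensity, divTr_eq hy hs hd, tr_hyp γ hy, potDensity]
  have e : contr (grad (hyp n) V) γ y j = ∑ i, pd i V y * rs γ y i j := by
    simp only [contr, grad, hyp_inv_apply hy, mul_assoc, ← Finset.mul_sum, sum_kd_mul', rs_apply]
    rw [Finset.mul_sum]
    exact Finset.sum_congr rfl fun i _ => by ring
  rw [e]
  simp [contr]

lemma chargeDensity_zero_left (Y : VField n) (γ κ : Tensor2 n) {y : E n}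
    (hy : ‖y‖ < 1) (j : Fin n) :
    chargeDensity 0 Y γ κ y j = killDensity Y (rs κ) y j := by
  have h0 : ∀ i, pd i (0 : E n → ℝ) y = 0 := fun i => (HasPd.const 0).2
  have e1 : contr (grad (hyp n) 0) γ y j = 0 := by simp [contr, grad, h0]
  have e2 : contr Y κ y j = om y ^ 2 * ∑ i, Y y i * rs κ y i j := by
    rw [contr, Finset.mul_sum]
    exact Finset.sum_congr rfl fun i _ => by rw [om_sq_mul_rs κ hy]; ring
  have e3 : contr Y (hyp n) y j = om y ^ 2 * Y y j := by
    have : ∀ i, Y y i * (om y ^ 2 * kd i j) = om y ^ 2 * (Y y i * kd i j) := fun i => by ring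
    simp only [contr, hyp_apply, this, ← Finset.mul_sum, sum_mul_kd]
  rw [chargeDensity, tr_hyp κ hy, killDensity, e1, e2, e3, h0]
  simp only [Pi.zero_apply]
  ring

/-! ### Divergences of the charge densities -/

lemma hasPd_om_pow_sub_two (hn : 2 ≤ n) (j : Fin n) {y : E n} (hy : ‖y‖ < 1) :
    HasPd j (fun x : E n => om x ^ (n - 2)) (((n : ℝ) - 2) * om y * y j * om y ^ (n - 2)) y :=
  (HasPd.om_pow j (n - 2) hy).congr_deriv (by rw [Nat.cast_sub hn, pow_succ]; push_cast; ring)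

/-- The operator ω^{-n}∂_j(ω^{n-2} ·) is the b-divergence. For V D - γ(∇V,·) + tr γ dV with D = div
γ - d tr γ, the first-order terms in V cancel, and ∇²V = Vb turns -⟨∇²V,γ⟩ + tr γ ΔV into (n-1) V tr
γ. What remains is V times the linearised scalar curvature. -/
theorem div_potDensity (hn : 2 ≤ n) {V : E n → ℝ} (hV : StaticPotential V) {h : Tensor2 n} {y : E n}
    (hy : ‖y‖ < 1) (hs : ∀ x i j, h x i j = h x j i)
    (hd : ∀ i j, DifferentiableAt ℝ (fun x => h x i j) y)
    (hdd : ∀ j, DifferentiableAt ℝ (fun x => divTr h x j) y) :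
    ∑ j, pd j (fun x => om x ^ (n - 2) * potDensity V h x j) y = om y ^ (n - 2) * (V y *
      (om y ^ 2 * ((n - 1) * ∑ i, h y i i) + (∑ l, pd l (fun x => divTr h x l) y
        + (n - 2) * om y * ∑ l, y l * divTr h y l))) := by
  have hVd : DifferentiableAt ℝ V y := (hV.smooth y hy).differentiableAt (by simp)
  have hVdd : ∀ i, DifferentiableAt ℝ (fun x => pd i V x) y := fun i =>
    ((hV.smooth y hy).fderiv_right (m := ∞) (by simp)).differentiableAt (by simp) |>.clm_apply
      (differentiableAt_const _)
  have hpot : ∀ j, HasPd j (fun x => potDensity V h x j)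
      (pd j V y * divTr h y j + V y * pd j (fun x => divTr h x j) y
      - ∑ i, (pd j (fun x => pd i V x) y * h y i j + pd i V y * pd j (fun x => h x i j) y)
      + ((∑ i, pd j (fun x => h x i i) y) * pd j V y
        + (∑ i, h y i i) * pd j (fun x => pd j V x) y)) y := fun j =>
    (((hasPd_pd j hVd).mul (hasPd_pd j (hdd j))).sub (HasPd.sum fun i _ =>
      (hasPd_pd j (hVdd i)).mul (hasPd_pd j (hd i j)))).add
      ((HasPd.sum fun i _ => hasPd_pd j (hd i i)).mul (hasPd_pd j (hVdd j)))
  have hj : ∀ j, pd j (fun x => om x ^ (n - 2) * potDensity V h x j) y = om y ^ (n - 2) *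
      (((n : ℝ) - 2) * om y * (y j * potDensity V h y j) +
      (pd j V y * divTr h y j + V y * pd j (fun x => divTr h x j) y
      - ∑ i, (pd j (fun x => pd i V x) y * h y i j + pd i V y * pd j (fun x => h x i j) y)
      + ((∑ i, pd j (fun x => h x i i) y) * pd j V y
        + (∑ i, h y i i) * pd j (fun x => pd j V x) y))) := fun j => by
    rw [((hasPd_om_pow_sub_two hn j hy).mul (hpot j)).2]; ring
  simp only [hj, ← Finset.mul_sum]
  congr 1
  simp only [hV.hess y hy]
  set s := ∑ i, h y i i with hs_def
  set P := ∑ p, y p * pd p V y with hP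
  set Hy := ∑ j, ∑ i, y j * (pd i V y * h y i j) with hHy
  have a1 : ∑ j, pd j V y * divTr h y j = ∑ j, ∑ i, pd j V y * pd i (fun x => h x i j) y
      - ∑ j, (∑ i, pd j (fun x => h x i i) y) * pd j V y + om y * (n * Hy - P * s) := by
    have : ∀ j, pd j V y * divTr h y j = ∑ i, pd j V y * pd i (fun x => h x i j) y
        - (∑ i, pd j (fun x => h x i i) y) * pd j V y
        + om y * (n * ∑ i, y i * (pd j V y * h y j i) - (y j * pd j V y) * s) := by
      intro j
      have h1 : ∑ i, y i * (pd j V y * h y j i) = pd j V y * ∑ i, y i * h y i j := by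
        rw [Finset.mul_sum]
        exact Finset.sum_congr rfl fun i _ => by rw [hs y j i]; ring
      have h2 : ∑ i, pd j V y * pd i (fun x => h x i j) y =
        pd j V y * ∑ i, pd i (fun x => h x i j) y := by rw [Finset.mul_sum]
      rw [h1, h2, divTr, Finset.sum_sub_distrib]
      ring
    simp only [this, Finset.sum_add_distrib, Finset.sum_sub_distrib, ← Finset.mul_sum,
      ← Finset.sum_mul]
    have h3 : ∑ j, ∑ i, y i * (pd j V y * h y j i) = Hy := by rw [hHy, Finset.sum_comm]
    -- Moving all factors into the sums and out again brings the auxiliary identity and the goal to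
    -- the same normal form.
    simp only [Finset.mul_sum] at h3 ⊢
    simp only [← Finset.mul_sum] at h3 ⊢
    rw [h3]
  have a2 : ∑ j, ∑ i, ((om y ^ 2 * V y * kd i j
      + om y * (y i * pd j V y + y j * pd i V y - kd i j * P)) * h y i j
      + pd i V y * pd j (fun x => h x i j) y) =
      om y ^ 2 * V y * s + om y * (2 * Hy - P * s)
      + ∑ j, ∑ i, pd j V y * pd i (fun x => h x i j) y := by
    have h1 : ∑ j, ∑ i, pd i V y * pd j (fun x => h x i j) y =
        ∑ j, ∑ i, pd j V y * pd i (fun x => h x i j) y := by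
      rw [Finset.sum_comm]
      refine Finset.sum_congr rfl fun j _ => Finset.sum_congr rfl fun i _ => ?_
      have : (fun x => h x j i) = fun x => h x i j := by ext x; rw [hs]
      rw [this]
    have h2 : ∑ j, ∑ i, y i * (pd j V y * h y i j) = Hy := by
      rw [hHy, Finset.sum_comm]
      exact Finset.sum_congr rfl fun j _ => Finset.sum_congr rfl fun i _ => by rw [hs y j i]
    have h3 : ∀ j i, (om y ^ 2 * V y * kd i j
      + om y * (y i * pd j V y + y j * pd i V y - kd i j * P)) * h y i j =
      om y ^ 2 * V y * (kd i j * h y i j) + om y * (y i * (pd j V y * h y i j)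
        + y j * (pd i V y * h y i j) - P * (kd i j * h y i j)) := fun j i => by ring
    simp only [Finset.sum_add_distrib, h3, ← Finset.mul_sum, Finset.sum_sub_distrib, sum_kd_mul]
    rw [h1]
    simp only [Finset.mul_sum] at h2 hHy ⊢
    simp only [← Finset.mul_sum] at h2 hHy ⊢
    rw [h2, ← hHy, ← hs_def]
    ring
  have a3 : ∑ j, y j * potDensity V h y j = V y * ∑ l, y l * divTr h y l - Hy + s * P := by
    have : ∀ j, y j * potDensity V h y j = V y * (y j * divTr h y j)
        - ∑ i, y j * (pd i V y * h y i j) + s * (y j * pd j V y) := by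
      intro j; rw [potDensity, ← Finset.mul_sum]; ring
    simp only [this, Finset.sum_add_distrib, Finset.sum_sub_distrib, ← Finset.mul_sum, hP]
    simp only [Finset.mul_sum] at hHy ⊢
    simp only [← Finset.mul_sum] at hHy ⊢
    rw [← hHy]
  have a4 : ∑ j, s * (om y ^ 2 * V y * kd j j
      + om y * (y j * pd j V y + y j * pd j V y - kd j j * P)) =
      s * (n * om y ^ 2 * V y + om y * ((2 - n) * P)) := by
    have : ∀ j, s * (om y ^ 2 * V y * kd j j
      + om y * (y j * pd j V y + y j * pd j V y - kd j j * P)) =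
      s * om y ^ 2 * V y - s * om y * P + 2 * s * om y * (y j * pd j V y) := fun j => by
        rw [kd_self]; ring
    simp only [this, Finset.sum_add_distrib, ← Finset.mul_sum, ← hP, Finset.sum_const,
      Finset.card_univ, Fintype.card_fin, nsmul_eq_mul]
    ring
  rw [Finset.sum_add_distrib, ← Finset.mul_sum, a3, Finset.sum_add_distrib, Finset.sum_sub_distrib,
    Finset.sum_add_distrib, Finset.sum_add_distrib, a1, a2, a4, ← Finset.mul_sum]
  ring

/-- The symmetrised covariant derivative of Y vanishes, so ⟨∇Y, k⟩ and div Y drop out and only the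
pairing of Y with div k - d tr k is left. -/
theorem div_killDensity (hn : 2 ≤ n) {Y : VField n} (hY : KillingField Y) {q : Tensor2 n} {y : E n}
    (hy : ‖y‖ < 1) (hs : ∀ x i j, q x i j = q x j i)
    (hd : ∀ i j, DifferentiableAt ℝ (fun x => q x i j) y) :
    ∑ j, pd j (fun x => om x ^ (n - 2) * killDensity Y q x j) y =
      om y ^ (n - 2) * (2 * om y ^ 2 * ∑ j, Y y j * divTr q y j) := by
  have hYd : ∀ i, DifferentiableAt ℝ (fun x => Y x i) y := fun i =>
    (hY.smooth y hy i).differentiableAt (by simp)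
  have hj : ∀ j, pd j (fun x => om x ^ (n - 2) * killDensity Y q x j) y =
      om y ^ (n - 2) * (2 * om y ^ 2 * (n * om y * (y j *
        (∑ i, Y y i * q y i j - (∑ i, q y i i) * Y y j))
      + (∑ i, (pd j (fun x => Y x i) y * q y i j + Y y i * pd j (fun x => q x i j) y)
        - ((∑ i, pd j (fun x => q x i i) y) * Y y j
          + (∑ i, q y i i) * pd j (fun x => Y x j) y)))) := by
    intro j
    have := ((hasPd_om_pow_sub_two hn j hy).mul (((hasPd_om_sq j hy).const_mul 2).mul
      ((HasPd.sum (s := Finset.univ) fun i _ => (hasPd_pd j (hYd i)).mul (hasPd_pd j (hd i j))).sub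
        ((HasPd.sum (s := Finset.univ) fun i _ => hasPd_pd j (hd i i)).mul
          (hasPd_pd j (hYd j)))))).2
    unfold killDensity
    rw [this]; ring
  simp only [hj, ← Finset.mul_sum]
  congr 2
  set s := ∑ i, q y i i with hs_def
  set P := ∑ p, y p * Y y p with hP
  set D := ∑ j, ∑ i, Y y j * pd i (fun x => q x i j) y with hD
  set Hy := ∑ j, ∑ i, y j * (Y y i * q y i j) with hHy
  have a1 : ∑ j, Y y j * divTr q y j = D - ∑ j, (∑ i, pd j (fun x => q x i i) y) * Y y j
      + om y * (n * Hy - P * s) := by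
    have : ∀ j, Y y j * divTr q y j = ∑ i, Y y j * pd i (fun x => q x i j) y
        - (∑ i, pd j (fun x => q x i i) y) * Y y j
        + om y * (n * ∑ i, y i * (Y y j * q y j i) - (y j * Y y j) * s) := by
      intro j
      have h1 : ∑ i, y i * (Y y j * q y j i) = Y y j * ∑ i, y i * q y i j := by
        rw [Finset.mul_sum]
        exact Finset.sum_congr rfl fun i _ => by rw [hs y j i]; ring
      have h2 : ∑ i, Y y j * pd i (fun x => q x i j) y =
        Y y j * ∑ i, pd i (fun x => q x i j) y := by rw [Finset.mul_sum]
      rw [h1, h2, divTr, Finset.sum_sub_distrib]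
      ring
    simp only [this]
    rw [Finset.sum_add_distrib, Finset.sum_sub_distrib, ← Finset.mul_sum, Finset.sum_sub_distrib,
      ← Finset.mul_sum, ← Finset.sum_mul, Finset.sum_comm (f := fun j i => y i * (Y y j * q y j i))]
  have a2 : ∑ j, ∑ i, pd j (fun x => Y x i) y * q y i j = -om y * P * s := by
    have h1 : ∑ j, ∑ i, pd j (fun x => Y x i) y * q y i j =
        ∑ j, ∑ i, pd i (fun x => Y x j) y * q y i j := by
      rw [Finset.sum_comm]
      exact Finset.sum_congr rfl fun j _ => Finset.sum_congr rfl fun i _ => by rw [hs y j i]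
    have h2 : ∑ j, ∑ i, pd j (fun x => Y x i) y * q y i j
        + ∑ j, ∑ i, pd i (fun x => Y x j) y * q y i j = -2 * om y * P * s := by
      simp only [← Finset.sum_add_distrib, ← add_mul]
      have : ∀ j i, (pd j (fun x => Y x i) y + pd i (fun x => Y x j) y) * q y i j =
          -2 * om y * P * (kd j i * q y i j) := fun j i => by rw [hY.killing y hy j i]; ring
      simp only [this, ← Finset.mul_sum, sum_kd_mul']
      rw [hs_def]
    linarith
  have a3 : ∑ j, ∑ i, Y y i * pd j (fun x => q x i j) y = D := by
    rw [hD, Finset.sum_comm]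
    refine Finset.sum_congr rfl fun j _ => Finset.sum_congr rfl fun i _ => ?_
    have : (fun x => q x j i) = fun x => q x i j := by ext x; rw [hs]
    rw [this]
  have a4 : ∑ j, pd j (fun x => Y x j) y = -n * om y * P := by
    have : ∀ j, pd j (fun x => Y x j) y = -om y * P := fun j => by
      have := hY.killing y hy j j
      rw [kd_self] at this
      linarith
    simp only [this, Finset.sum_const, Finset.card_univ, Fintype.card_fin, nsmul_eq_mul]
    ring
  have a5 : ∑ j, y j * (∑ i, Y y i * q y i j - s * Y y j) = Hy - s * P := by
    rw [hHy, hP, Finset.mul_sum, ← Finset.sum_sub_distrib]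
    refine Finset.sum_congr rfl fun j _ => ?_
    rw [← Finset.mul_sum]; ring
  rw [Finset.sum_add_distrib, ← Finset.mul_sum, a5, Finset.sum_sub_distrib, Finset.sum_add_distrib,
    a1]
  simp only [Finset.sum_add_distrib]
  rw [a2, a3, ← Finset.mul_sum, a4]
  ring

/-! ### Existence of the charges -/

/-- The decay conditions, in rescaled components. -/
structure RescaledData (I : Set ℝ) (τ ε : ℝ) (g k : ℝ → Tensor2 n) : Prop where
  metric : MetricData I τ g
  symm : ∀ t y i j, k t y i j = k t y j i
  second : ∀ i j, B1 I (-τ) (fun t y => rs (k t) y i j)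
  second_extra : ∀ i j, BO I (-(τ + 1)) (fun t y => rs (k t) y i j)
  energy : BO I (-(n + ε)) (fun t y => energyDensity (g t) (k t) y)
  momentum : ∀ j, BO I (-(n + ε)) (fun t y => momentumDensity (g t) (k t) y j)

lemma JS.divTrUp {I : Set ℝ} {A h : ℝ → Tensor2 n} (hA : ∀ i j, JS I (fun t y => A t y i j))
    (hh : ∀ i j, JS I (fun t y => h t y i j)) (j : Fin n) :
    JS I (fun t y => divTrUp (A t) (h t) y j) := by
  unfold AHData.divTrUp
  refine (JS.sum fun i => JS.sum fun l => (hA i l).mul (((hh i j).pd l).sub ((hh i l).pd j))).add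
    (JS.mul B1.om.smooth (JS.sub ?_ ?_))
  · exact (JS.const _).mul (JS.sum fun i => (B1.coord i).smooth.mul (hh i j))
  · exact (B1.coord j).smooth.mul (JS.sum fun i => hh i i)

lemma JS.potUp {I : Set ℝ} {A h : ℝ → Tensor2 n} {V : E n → ℝ} (hV : StaticPotential V)
    (hA : ∀ i j, JS I (fun t y => A t y i j)) (hh : ∀ i j, JS I (fun t y => h t y i j))
    (j : Fin n) : JS I (fun t y => potUp V (A t) (h t) y j) := by
  have hVs : JS I (fun _ y => V y) := JS.of_space hV.smooth
  unfold AHData.potUp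
  exact ((hVs.mul (JS.divTrUp hA hh j)).sub (JS.sum fun i => (hVs.pd i).mul (hh i j))).add
    ((JS.sum fun i => hh i i).mul (hVs.pd j))

lemma JS.potDensity {I : Set ℝ} {h : ℝ → Tensor2 n} {V : E n → ℝ} (hV : StaticPotential V)
    (hh : ∀ i j, JS I (fun t y => h t y i j)) (j : Fin n) :
    JS I (fun t y => potDensity V (h t) y j) := by
  simp only [← potUp_one]
  exact JS.potUp (A := fun _ _ => 1) hV (fun i j => JS.const _) hh j

lemma JS.killDensity {I : Set ℝ} {q : ℝ → Tensor2 n} {Y : VField n} (hY : KillingField Y)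
    (hq : ∀ i j, JS I (fun t y => q t y i j)) (j : Fin n) :
    JS I (fun t y => killDensity Y (q t) y j) := by
  have hYs : ∀ i, JS I (fun _ y => Y y i) := fun i => JS.of_space fun y hy => hY.smooth y hy i
  unfold AHData.killDensity
  simp only [sq]
  exact ((JS.const 2).mul (B1.om.smooth.mul B1.om.smooth)).mul ((JS.sum fun i =>
    (hYs i).mul (hq i j)).sub ((JS.sum fun i => hq i i).mul (hYs j)))

lemma hflux_congr {U U' : OneForm n} {ρ R : ℝ} (hR : 0 < R) (hρ : ρ < R)
    (h : ∀ y ∈ ext n ρ, ∀ j, U y j = U' y j) : hflux U R = hflux U' R := by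
  unfold hflux
  refine integral_congr_ae (Eventually.of_forall fun x => ?_)
  simp only [h _ (tanh_smul_mem_ext hR hρ x)]

lemma continuous_hflux_integrand {U : OneForm n} {ρ R : ℝ} (hR : 0 < R) (hρ : ρ < R)
    (h : ∀ y ∈ ext n ρ, ∀ j, ContinuousAt (fun y => U y j) y) :
    Continuous fun x : Sph n => (∑ j, U (Real.tanh (R / 2) • (x : E n)) j
      * normal (Real.tanh (R / 2) • (x : E n)) j) * Real.sinh R ^ (n - 1) := by
  refine (continuous_finsetSum _ fun j _ => ?_).mul continuous_const
  have h1 : Continuous fun x : Sph n => U (Real.tanh (R / 2) • (x : E n)) j :=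
    continuous_comp_smul (f := fun y => U y j) fun x => h _ (tanh_smul_mem_ext hR hρ x) j
  refine h1.mul ?_
  unfold normal
  refine Continuous.mul (by fun_prop) (Continuous.div (by fun_prop) (by fun_prop) fun x => ?_)
  rw [norm_tanh_smul hR]
  exact (tanh_pos_of_pos (by linarith)).ne'

lemma hflux_sub {U U' : OneForm n} {ρ R : ℝ} (hR : 0 < R) (hρ : ρ < R)
    (h : ∀ y ∈ ext n ρ, ∀ j, ContinuousAt (fun y => U y j) y)
    (h' : ∀ y ∈ ext n ρ, ∀ j, ContinuousAt (fun y => U' y j) y) :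
    hflux (fun y j => U y j - U' y j) R = hflux U R - hflux U' R := by
  unfold hflux
  rw [← integral_sub (integrable_sph (continuous_hflux_integrand hR hρ h))
    (integrable_sph (continuous_hflux_integrand hR hρ h'))]
  refine integral_congr_ae (Eventually.of_forall fun x => ?_)
  simp only [sub_mul, Finset.sum_sub_distrib]

namespace RescaledData

variable {I : Set ℝ} {τ ε : ℝ} {g k : ℝ → Tensor2 n}

/-- The energy constraint expresses the scalar curvature through μ, absorbed by δ ≤ ε, and terms
quadratic in k, absorbed by n + δ ≤ 2τ. -/
lemma bO_scal (hD : RescaledData I τ ε g k) {δ : ℝ} (hδ : δ ≤ ε) (hδ' : n + δ ≤ 2 * τ) :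
    BO I (-(n + δ)) (fun t y => scal (g t) y + n * (n - 1)) := by
  have h1 := hD.metric.bO_energy_sub_scal (a := -τ) fun i j => (hD.second i j).bO
  refine ((hD.energy.mono (b := -(n + δ)) (by linarith)).sub (h1.mono (by linarith))).congr
    (nearInf_true.mono fun t _ y _ _ => by ring)

/-- Count of powers: ω^{n-2}·ω² from the volume, one ω from V, and -(n + δ) from the linearised
scalar curvature, which differs from Scal + n(n-1) by O(ω^{-2τ}). -/
lemma bO_div_potDensity (hn : 2 ≤ n) (hD : RescaledData I τ ε g k) {V : E n → ℝ}
    (hV : StaticPotential V) {δ : ℝ} (hδ : δ ≤ ε) (hδ' : n + δ ≤ 2 * τ) :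
    BO I (1 - δ) (fun t y => ∑ j, pd j (fun y => om y ^ (n - 2) *
      potDensity V (rs (g t - hyp n)) y j) y) := by
  have h1 := (hD.bO_scal hδ hδ').sub (hD.metric.scal_expansion.mono
    (b := -(n + δ)) (by linarith))
  have h2 := (BO.om_pow (I := I) (n := n) (n - 2)).mul_le ((hV.bO I).mul ((BO.om_pow 2).mul h1))
    (c := 1 - δ) (by rw [Nat.cast_sub hn]; push_cast; linarith)
  have d1 : NearInf I (fun t y => ∀ i j, DifferentiableAt ℝ
      (fun x => rs (g t - hyp n) x i j) y) :=
    NearInf.all fun i => NearInf.all fun j => (hD.metric.b1 i j).smooth.differentiableAt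
  have d2 : NearInf I (fun t y => ∀ j, DifferentiableAt ℝ
      (fun x => divTr (rs (g t - hyp n)) x j) y) := by
    simp only [← divTrUp_one]
    exact NearInf.all fun j => (JS.divTrUp (A := fun _ _ => 1) (fun i j => JS.const _)
      (fun i j => (hD.metric.b1 i j).smooth) j).differentiableAt
  refine h2.congr ((d1.and d2).mono fun t _ y hy h => ?_)
  have h0 := (om_pos hy).ne'
  rw [div_potDensity hn hV hy (hD.metric.symm_rs_sub t) h.1 h.2]
  field_simp
  ring

lemma symm_rs (hD : RescaledData I τ ε g k) (t : ℝ) (y : E n) (i j : Fin n) :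
    rs (k t) y i j = rs (k t) y j i := by
  simp only [rs_apply, hD.symm t y i j]

lemma bO_divTrUp (hD : RescaledData I τ ε g k) {a : ℝ}
    (hk : ∀ i j, BO I a (fun t y => rs (k t) y i j)) {c : ℝ} (h1 : -(n + ε) ≤ c)
    (h2 : 1 - τ + a ≤ c) (j : Fin n) :
    BO I c (fun t y => divTrUp (up (g t)) (rs (k t)) y j) :=
  ((((hD.momentum j).mono h1).sub ((hD.metric.momentum_expansion hD.symm
    (fun i j => (hD.second i j).smooth) hk j).mono h2))).congr
    (nearInf_true.mono fun t _ y _ _ => by ring)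

/-- Returning from g^{-1} to the background costs (A - 1)∂q, so here, unlike for `divTrUp`, the
first derivatives of k must decay at the rate a as well. -/
lemma bO_divTr (hD : RescaledData I τ ε g k) {a : ℝ}
    (hk : ∀ i j, B1 I a (fun t y => rs (k t) y i j)) {c : ℝ} (h1 : -(n + ε) ≤ c)
    (h2 : 1 - τ + a ≤ c) (j : Fin n) :
    BO I c (fun t y => divTr (rs (k t)) y j) := by
  have h3 : BO I c (fun t y => ∑ i, ∑ l, (up (g t) y i l - kd i l) *
      (pd l (fun x => rs (k t) x i j) y - pd j (fun x => rs (k t) x i l) y)) :=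
    BO.sum fun i _ => BO.sum fun l _ => (hD.metric.b1_up_sub i l).bO.mul_le
      (((hk i j).bO_pd l).sub ((hk i l).bO_pd j)) (by linarith)
  refine ((hD.bO_divTrUp (fun i j => (hk i j).bO) h1 h2 j).sub h3).congr
    (nearInf_true.mono fun t _ y _ _ => ?_)
  rw [← divTrUp_sub_divTr]; ring

/-- Killing fields are bounded in ball coordinates, so there is no further weight and the basic rate
τ for k and ∂k is enough. -/
lemma bO_div_killDensity (hn : 2 ≤ n) (hD : RescaledData I τ ε g k) {Y : VField n}
    (hY : KillingField Y) {δ : ℝ} (hδ : δ ≤ ε) (hδ' : n + δ ≤ 2 * τ) :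
    BO I (1 - δ) (fun t y => ∑ j, pd j (fun y => om y ^ (n - 2) *
      killDensity Y (rs (k t)) y j) y) := by
  have h1 := hD.bO_divTr hD.second (c := 1 - n - δ) (by linarith) (by linarith)
  have h2 : BO I (1 - n - δ) (fun t y => ∑ j, Y y j * divTr (rs (k t)) y j) :=
    BO.sum fun j _ => (hY.bO I j).mul_le (h1 j) (by linarith)
  have h3 := (BO.om_pow (I := I) (n := n) (n - 2)).mul_le (((BO.om_pow 2).const_mul 2).mul h2)
    (c := 1 - δ) (by rw [Nat.cast_sub hn]; push_cast; linarith)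
  have d1 : NearInf I (fun t y => ∀ i j, DifferentiableAt ℝ (fun x => rs (k t) x i j) y) :=
    NearInf.all fun i => NearInf.all fun j => (hD.second i j).smooth.differentiableAt
  refine h3.congr (d1.mono fun t _ y hy h => ?_)
  rw [div_killDensity hn hY hy (hD.symm_rs t) h]

/-- The flux of a potential in rescaled components. -/
lemma nearInf_chargeDensity_pot (hD : RescaledData I τ ε g k) (V : E n → ℝ) :
    NearInf I (fun t y => ∀ j, chargeDensity V 0 (g t - hyp n) (k t) y j =
      potDensity V (rs (g t - hyp n)) y j) := by
  have d1 : NearInf I (fun t y => ∀ i j, DifferentiableAt ℝ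
      (fun x => rs (g t - hyp n) x i j) y) :=
    NearInf.all fun i => NearInf.all fun j => (hD.metric.b1 i j).smooth.differentiableAt
  refine d1.mono fun t _ y hy h j => chargeDensity_zero_right V (k t) hy (fun i j => ?_) h j
  simp only [Pi.sub_apply, Matrix.sub_apply, hyp_apply, hD.metric.symm t y i j, kd_comm i j]

theorem exists_limit_flux_pot (hn : 2 ≤ n) (hD : RescaledData I τ ε g k) {V : E n → ℝ}
    (hV : StaticPotential V) {δ : ℝ} (hδ0 : 0 < δ) (hδ : δ ≤ ε) (hδ' : n + δ ≤ 2 * τ) :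
    ∃ C ρ : ℝ, ∀ t ∈ I, ∃ q, Tendsto (flux V 0 (g t - hyp n) (k t)) atTop (𝓝 q) ∧
      ∀ R, ρ < R → |hflux (potDensity V (rs (g t - hyp n))) R - q| ≤ C * Real.exp (-(δ * R)) := by
  obtain ⟨C, ρ, h⟩ := exists_limit_hflux hn hδ0
    (JS.potDensity hV fun i j => (hD.metric.b1 i j).smooth) (hD.bO_div_potDensity hn hV hδ hδ')
  obtain ⟨ρ', h'⟩ := hD.nearInf_chargeDensity_pot V
  refine ⟨C, ρ, fun t ht => ?_⟩
  obtain ⟨q, hq, hq'⟩ := h t ht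
  refine ⟨q, hq.congr' ?_, hq'⟩
  filter_upwards [eventually_gt_atTop 0, eventually_gt_atTop ρ'] with R hR hR'
  exact (hflux_congr hR hR' fun y hy j => (h' t ht y hy j)).symm

theorem exists_limit_flux_kill (hn : 2 ≤ n) (hD : RescaledData I τ ε g k) {Y : VField n}
    (hY : KillingField Y) {δ : ℝ} (hδ0 : 0 < δ) (hδ : δ ≤ ε) (hδ' : n + δ ≤ 2 * τ) :
    ∃ C ρ : ℝ, ∀ t ∈ I, ∃ q, Tendsto (flux 0 Y (g t - hyp n) (k t)) atTop (𝓝 q) ∧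
      ∀ R, ρ < R → |hflux (killDensity Y (rs (k t))) R - q| ≤ C * Real.exp (-(δ * R)) := by
  obtain ⟨C, ρ, h⟩ := exists_limit_hflux hn hδ0
    (JS.killDensity hY fun i j => (hD.second i j).smooth) (hD.bO_div_killDensity hn hY hδ hδ')
  refine ⟨C, ρ, fun t ht => ?_⟩
  obtain ⟨q, hq, hq'⟩ := h t ht
  refine ⟨q, hq.congr' ?_, hq'⟩
  filter_upwards [eventually_gt_atTop 0] with R hR
  exact (hflux_congr hR hR fun y hy j => chargeDensity_zero_left Y _ _ hy.1 j).symm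

end RescaledData

/-! ### Evolution of the fluxes -/

lemma hasDerivAt_slice {f : ℝ → E n → ℝ} {t : ℝ} {y : E n}
    (h : DifferentiableAt ℝ (fun p : ℝ × E n => f p.1 p.2) (t, y)) :
    HasDerivAt (fun s => f s y) (fderiv ℝ (fun p : ℝ × E n => f p.1 p.2) (t, y) (1, 0)) t := by
  have h1 : HasFDerivAt (fun s : ℝ => (s, y)) (ContinuousLinearMap.inl ℝ ℝ (E n)) t :=
    hasFDerivAt_prodMk_left _ _
  have h2 : HasFDerivAt (fun s => f s y) ((fderiv ℝ (fun p : ℝ × E n => f p.1 p.2) (t, y)).comp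
      (ContinuousLinearMap.inl ℝ ℝ (E n))) t :=
    HasFDerivAt.comp (x := t) (f := fun s : ℝ => (s, y))
      (g := fun p : ℝ × E n => f p.1 p.2) h.hasFDerivAt h1
  simpa using h2.hasDerivAt

/-- Time and space derivatives commute. -/
lemma hasDerivAt_pd {f : ℝ → E n → ℝ} {t : ℝ} {y : E n} (l : Fin n) {φ : E n → ℝ}
    (h : ContDiffAt ℝ ∞ (fun p : ℝ × E n => f p.1 p.2) (t, y))
    (hφ : ∀ᶠ x in 𝓝 y, HasDerivAt (fun s => f s x) (φ x) t) :
    HasDerivAt (fun s => pd l (f s) y) (pd l φ y) t := by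
  set F : ℝ × E n → ℝ := fun p => f p.1 p.2 with hF
  have hsymm : IsSymmSndFDerivAt ℝ F (t, y) := h.isSymmSndFDerivAt (by
    rw [minSmoothness_of_isRCLikeNormedField]; exact WithTop.coe_le_coe.2 (le_top (a := (2 : ℕ∞))))
  have hd1 : ∀ᶠ p in 𝓝 (t, y), DifferentiableAt ℝ F p := by
    have h1 : ContDiffAt ℝ 1 F (t, y) := h.of_le (by simp)
    filter_upwards [h1.eventually (by simp)] with p hp using hp.differentiableAt (by simp)
  have hd2 : DifferentiableAt ℝ (fderiv ℝ F) (t, y) :=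
    (h.fderiv_right (m := ∞) (by simp)).differentiableAt (by simp)
  have hmk1 : HasFDerivAt (fun s : ℝ => (s, y)) (ContinuousLinearMap.inl ℝ ℝ (E n)) t :=
    hasFDerivAt_prodMk_left _ _
  have hmk2 : HasFDerivAt (fun x : E n => (t, x)) (ContinuousLinearMap.inr ℝ ℝ (E n)) y :=
    hasFDerivAt_prodMk_right _ _
  have e1 : HasDerivAt (fun s => fderiv ℝ F (s, y) (0, EuclideanSpace.single l 1))
      (fderiv ℝ (fderiv ℝ F) (t, y) (1, 0) (0, EuclideanSpace.single l 1)) t := by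
    have h1 := HasFDerivAt.comp (x := t) (f := fun s : ℝ => (s, y)) (g := fderiv ℝ F)
      hd2.hasFDerivAt hmk1
    have h2 := (h1.clm_apply (hasFDerivAt_const ((0 : ℝ), EuclideanSpace.single l (1 : ℝ)) t))
    simpa using h2.hasDerivAt
  have e2 : HasFDerivAt (fun x => fderiv ℝ F (t, x) (1, 0))
      (((fderiv ℝ (fderiv ℝ F) (t, y)).comp (ContinuousLinearMap.inr ℝ ℝ (E n))).flip (1, 0)) y := by
    have h1 := HasFDerivAt.comp (x := y) (f := fun x : E n => (t, x)) (g := fderiv ℝ F)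
      hd2.hasFDerivAt hmk2
    have h2 := (h1.clm_apply (hasFDerivAt_const ((1 : ℝ), (0 : E n)) y))
    simpa using h2
  have e3 : pd l φ y = fderiv ℝ (fderiv ℝ F) (t, y) (1, 0) (0, EuclideanSpace.single l 1) := by
    have hev : φ =ᶠ[𝓝 y] fun x => fderiv ℝ F (t, x) (1, 0) := by
      have hc : Tendsto (fun x : E n => (t, x)) (𝓝 y) (𝓝 (t, y)) :=
        Continuous.tendsto (by fun_prop) y
      filter_upwards [hφ, hc.eventually hd1] with x hx hx'
      exact hx.unique (hasDerivAt_slice hx')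
    rw [pd, hev.fderiv_eq, e2.fderiv]
    simpa using hsymm.eq (0, EuclideanSpace.single l 1) (1, 0)
  rw [e3]
  refine e1.congr_of_eventuallyEq ?_
  have hc : Tendsto (fun s : ℝ => (s, y)) (𝓝 t) (𝓝 (t, y)) :=
    Continuous.tendsto (by fun_prop) t
  filter_upwards [hc.eventually hd1] with s hs
  have h2 := HasFDerivAt.comp (x := y) (f := fun x : E n => (s, x)) (g := F) hs.hasFDerivAt
    (hasFDerivAt_prodMk_right s y)
  have h3 : HasFDerivAt (f s) ((fderiv ℝ F (s, y)).comp (ContinuousLinearMap.inr ℝ ℝ (E n))) y := h2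
  rw [pd, h3.fderiv]; simp

/-- The flux of a smooth family of one-forms can be differentiated under the integral. -/
lemma hasDerivAt_hflux_param {I : Set ℝ} (hI : IsOpen I) {U U' : ℝ → OneForm n} {ρ : ℝ}
    (hU : ∀ t ∈ I, ∀ y ∈ ext n ρ, ∀ j, ContDiffAt ℝ ∞ (fun p : ℝ × E n => U p.1 p.2 j) (t, y))
    (hU' : ∀ t ∈ I, ∀ y ∈ ext n ρ, ∀ j, HasDerivAt (fun s => U s y j) (U' t y j) t)
    {t R : ℝ} (ht : t ∈ I) (hR : 0 < R) (hρ : ρ < R) :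
    HasDerivAt (fun s => hflux (U s) R) (hflux (U' t) R) t := by
  have hm := fun x : Sph n => tanh_smul_mem_ext hR hρ x
  have hnor : ∀ j, Continuous fun x : Sph n => normal (Real.tanh (R / 2) • (x : E n)) j := by
    intro j
    unfold normal
    refine Continuous.mul (by fun_prop) (Continuous.div (by fun_prop) (by fun_prop) fun x => ?_)
    rw [norm_tanh_smul hR]
    exact (tanh_pos_of_pos (by linarith)).ne'
  unfold hflux
  refine hasDerivAt_integral_sph
    (Φ := fun s (x : Sph n) => (∑ j, U s (Real.tanh (R / 2) • (x : E n)) j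
      * normal (Real.tanh (R / 2) • (x : E n)) j) * Real.sinh R ^ (n - 1))
    (Φ' := fun s (x : Sph n) => (∑ j, U' s (Real.tanh (R / 2) • (x : E n)) j
      * normal (Real.tanh (R / 2) • (x : E n)) j) * Real.sinh R ^ (n - 1)) (hI.mem_nhds ht) (fun s hs => ?_) (fun s hs x => ?_)
    (fun s hs x => ?_)
  · exact continuous_hflux_integrand hR hρ fun y hy j =>
      (contDiffAt_slice (f := fun t y => U t y j) (hU s hs y hy j)).continuousAt
  · exact (HasDerivAt.fun_sum fun j _ => (hU' s hs _ (hm x) j).mul_const _).mul_const _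
  · refine ContinuousAt.mul (tendsto_finsetSum _ fun j _ => ContinuousAt.mul ?_ ?_)
      continuousAt_const
    · have hopen : ∀ᶠ p in 𝓝 (s, Real.tanh (R / 2) • (x : E n)), p ∈ I ×ˢ ext n ρ :=
        (hI.prod (isOpen_ext ρ)).mem_nhds ⟨hs, hm x⟩
      -- U' is the time derivative of the jointly smooth U, which is why it is continuous in (t, y)
      -- without a separate hypothesis.
      have h1 : ContinuousAt (fun p : ℝ × E n => U' p.1 p.2 j)
          (s, Real.tanh (R / 2) • (x : E n)) := by
        have h2 : ContinuousAt (fun p : ℝ × E n => fderiv ℝ (fun p : ℝ × E n => U p.1 p.2 j) p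
            (1, 0)) (s, Real.tanh (R / 2) • (x : E n)) :=
          (((hU s hs _ (hm x) j).fderiv_right (m := 0) (by simp)).continuousAt).clm_apply
            continuousAt_const
        refine h2.congr ?_
        filter_upwards [hopen] with p hp
        exact (hasDerivAt_slice (f := fun s y => U s y j)
          ((hU p.1 hp.1 p.2 hp.2 j).differentiableAt (by simp))).unique (hU' p.1 hp.1 p.2 hp.2 j)
      exact h1.comp (f := fun p : ℝ × Sph n => (p.1, Real.tanh (R / 2) • (p.2 : E n)))
        (x := (s, x)) (Continuous.continuousAt (by fun_prop))
    · exact ((hnor j).comp continuous_snd).continuousAt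

/-! ### Time derivative of the charge densities -/

/-- The time derivative of `potUp V A h` when `∂_t h = 2 V_(0) q` and `∂_t A = A'`. -/
noncomputable def potUpRate (V : E n → ℝ) (Y : VField n) (A A' h q : Tensor2 n) : OneForm n :=
  fun y j => killDensity Y q y j + 2 * V₀ y * V y * divTrUp A q y j
    + V y * ∑ i, ∑ l, A' y i l * (pd l (fun x => h x i j) y - pd j (fun x => h x i l) y)
    + 2 * V y * om y ^ 2 * ∑ i, ∑ l, (A y i l - kd i l) * (y l * q y i j - y j * q y i l)

/-- When the spatial derivative of 2V_(0)q falls on q, it contributes 2V_(0)V times the divergence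
term of q. When it falls on V_(0), the result combines with the terms containing dV into V dV_(0) -
V_(0) dV, the conjugate Killing field, up to a factor A - 1 wherever A replaces the identity. -/
lemma hasDerivAt_potUp {V : E n → ℝ} {Y : VField n} (hVY : Conjugate V Y) {A h : ℝ → Tensor2 n}
    {A' q : Tensor2 n} {t : ℝ} {y : E n} (hy : ‖y‖ < 1)
    (hq : ∀ i j, DifferentiableAt ℝ (fun x => q x i j) y)
    (hA : ∀ i j, HasDerivAt (fun s => A s y i j) (A' y i j) t)
    (hh : ∀ i j, ContDiffAt ℝ ∞ (fun p : ℝ × E n => h p.1 p.2 i j) (t, y))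
    (hev : ∀ᶠ x in 𝓝 y, ∀ i j, HasDerivAt (fun s => h s x i j) (2 * V₀ x * q x i j) t)
    (j : Fin n) :
    HasDerivAt (fun s => potUp V (A s) (h s) y j) (potUpRate V Y (A t) A' (h t) q y j) t := by
  have h1 : ∀ i j, HasDerivAt (fun s => h s y i j) (2 * V₀ y * q y i j) t := hev.self_of_nhds
  have h2 : ∀ l i j, HasDerivAt (fun s => pd l (fun x => h s x i j) y)
      (2 * (om y ^ 2 * (y l * q y i j)) + 2 * V₀ y * pd l (fun x => q x i j) y) t := by
    intro l i j
    have e := hasDerivAt_pd (f := fun s x => h s x i j) l (hh i j) (hev.mono fun x hx => hx i j)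
    have e' := (((hasPd_V₀ l hy).const_mul 2).mul (hasPd_pd l (hq i j))).2
    rw [e'] at e
    exact e.congr_deriv (by ring)
  have main := (((HasDerivAt.fun_sum (u := Finset.univ) fun i _ =>
      HasDerivAt.fun_sum (u := Finset.univ) fun l _ =>
      (hA i l).fun_mul ((h2 l i j).fun_sub (h2 j i l))).fun_add
      ((((HasDerivAt.fun_sum (u := Finset.univ) fun i _ =>
        (h1 i j).const_mul (y i)).const_mul (n : ℝ)).fun_sub
        ((HasDerivAt.fun_sum (u := Finset.univ) fun i _ => h1 i i).const_mul (y j))).const_mul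
          (om y))).const_mul (V y)).fun_sub
    (HasDerivAt.fun_sum (u := Finset.univ) fun i _ => (h1 i j).const_mul (pd i V y))
  have main := main.fun_add
    ((HasDerivAt.fun_sum (u := Finset.univ) fun i _ => h1 i i).mul_const (pd j V y))
  refine HasDerivAt.congr_deriv (f := fun s => potUp V (A s) (h s) y j) main ?_
  have hY : ∀ i, om y ^ 2 * Y y i = om y ^ 2 * V y * y i - V₀ y * pd i V y := hVY y hy
  -- The conjugacy relation rewrites the Killing density in terms of V, V_(0) and their gradients.
  have k1 : killDensity Y q y j = 2 * (om y ^ 2 * V y * ∑ i, y i * q y i j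
      - V₀ y * ∑ i, pd i V y * q y i j)
      - 2 * (∑ i, q y i i) * (om y ^ 2 * V y * y j - V₀ y * pd j V y) := by
    have : ∑ i, (om y ^ 2 * Y y i) * q y i j = om y ^ 2 * V y * ∑ i, y i * q y i j
      - V₀ y * ∑ i, pd i V y * q y i j := by
      simp only [hY, Finset.mul_sum, ← Finset.sum_sub_distrib]
      exact Finset.sum_congr rfl fun i _ => by ring
    rw [← this, ← hY, killDensity]
    simp only [mul_assoc, ← Finset.mul_sum]
    ring
  -- Splits A into the identity, which feeds the Killing density, and A - 1, which is an error term.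
  have k2 : ∑ i, ∑ l, (A t y i l - kd i l) * (y l * q y i j - y j * q y i l) =
      ∑ i, ∑ l, A t y i l * (y l * q y i j - y j * q y i l)
        - (∑ i, y i * q y i j - y j * ∑ i, q y i i) := by
    simp only [sub_mul, Finset.sum_sub_distrib, sum_kd_mul', Finset.mul_sum]
  have k3 : ∑ i, ∑ l, (A' y i l * (pd l (fun x => h t x i j) y - pd j (fun x => h t x i l) y)
      + A t y i l * (2 * (om y ^ 2 * (y l * q y i j)) + 2 * V₀ y * pd l (fun x => q x i j) y
        - (2 * (om y ^ 2 * (y j * q y i l)) + 2 * V₀ y * pd j (fun x => q x i l) y))) =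
      ∑ i, ∑ l, A' y i l * (pd l (fun x => h t x i j) y - pd j (fun x => h t x i l) y)
      + 2 * om y ^ 2 * ∑ i, ∑ l, A t y i l * (y l * q y i j - y j * q y i l)
      + 2 * V₀ y * ∑ i, ∑ l, A t y i l *
        (pd l (fun x => q x i j) y - pd j (fun x => q x i l) y) := by
    simp only [Finset.mul_sum, ← Finset.sum_add_distrib]
    exact Finset.sum_congr rfl fun i _ => Finset.sum_congr rfl fun l _ => by ring
  have k4 : ∑ i, y i * (2 * V₀ y * q y i j) = 2 * V₀ y * ∑ i, y i * q y i j := by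
    rw [Finset.mul_sum]; exact Finset.sum_congr rfl fun i _ => by ring
  have k5 : ∑ i, pd i V y * (2 * V₀ y * q y i j) = 2 * V₀ y * ∑ i, pd i V y * q y i j := by
    rw [Finset.mul_sum]; exact Finset.sum_congr rfl fun i _ => by ring
  rw [potUpRate, k1, k2, k3, k4, k5, ← Finset.mul_sum, divTrUp]
  ring

lemma JS.potUpRate {I : Set ℝ} {A A' h q : ℝ → Tensor2 n} {V : E n → ℝ} {Y : VField n}
    (hV : StaticPotential V) (hY : KillingField Y) (hA : ∀ i j, JS I (fun t y => A t y i j))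
    (hA' : ∀ i j, JS I (fun t y => A' t y i j)) (hh : ∀ i j, JS I (fun t y => h t y i j))
    (hq : ∀ i j, JS I (fun t y => q t y i j)) (j : Fin n) :
    JS I (fun t y => potUpRate V Y (A t) (A' t) (h t) (q t) y j) := by
  have hVs : JS I (fun _ y => V y) := JS.of_space hV.smooth
  have hNs : JS I (fun _ (y : E n) => V₀ y) := JS.of_space staticPotential_V₀.smooth
  have hys : ∀ i, JS I (fun _ (y : E n) => y i) := fun i => (B1.coord i).smooth
  have hom : JS I (fun _ (y : E n) => om y * om y) := B1.om.smooth.mul B1.om.smooth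
  unfold AHData.potUpRate
  simp only [sq]
  refine (((JS.killDensity hY hq j).add ((((JS.const 2).mul hNs).mul hVs).mul
    (JS.divTrUp hA hq j))).add (hVs.mul (JS.sum fun i => JS.sum fun l => (hA' i l).mul
      (((hh i j).pd l).sub ((hh i l).pd j))))).add ((((JS.const 2).mul hVs).mul hom).mul
      (JS.sum fun i => JS.sum fun l => ((hA i l).sub (JS.const _)).mul
        (((hys l).mul (hq i j)).sub ((hys j).mul (hq i l)))))

lemma NearInf.continuousAt {I : Set ℝ} {U : ℝ → OneForm n} (h : ∀ j, JS I (fun t y => U t y j)) :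
    NearInf I (fun t y => ∀ j, ContinuousAt (fun y => U t y j) y) :=
  (NearInf.all h).mono fun _ _ _ _ h j =>
    (contDiffAt_slice (f := fun t y => U t y j) (h j)).continuousAt

/-- Perturbing a one-form by `O(ω^{2 - n - δ})` changes its flux by `O(e^{-δ r})`. -/
lemma abs_hflux_sub_le (hn : 2 ≤ n) {I : Set ℝ} {U W : ℝ → OneForm n} {δ : ℝ} {Q : ℝ → ℝ}
    (hU : ∀ j, JS I (fun t y => U t y j)) (hW : ∀ j, JS I (fun t y => W t y j))
    (hUW : ∀ j, BO I (2 - n - δ) (fun t y => U t y j - W t y j))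
    (hQ : ∃ C ρ : ℝ, ∀ t ∈ I, ∀ R, ρ < R → |hflux (W t) R - Q t| ≤ C * Real.exp (-(δ * R))) :
    ∃ C ρ : ℝ, ∀ t ∈ I, ∀ R, ρ < R → |hflux (U t) R - Q t| ≤ C * Real.exp (-(δ * R)) := by
  obtain ⟨C, ρ, h⟩ := hQ
  obtain ⟨C', ρ', h'⟩ := abs_hflux_le hn (U := fun t y j => U t y j - W t y j) hUW
  obtain ⟨ρ₁, h₁⟩ := NearInf.continuousAt hU
  obtain ⟨ρ₂, h₂⟩ := NearInf.continuousAt hW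
  refine ⟨C' + C, max (max ρ ρ') (max (max ρ₁ ρ₂) 0), fun t ht R hR => ?_⟩
  simp only [max_lt_iff] at hR
  obtain ⟨⟨hρ, hρ'⟩, ⟨hρ₁, hρ₂⟩, hR0⟩ := hR
  have e := hflux_sub (U := U t) (U' := W t) hR0 (max_lt hρ₁ hρ₂)
    (fun y hy => h₁ t ht y (ext_mono (le_max_left _ _) hy))
    (fun y hy => h₂ t ht y (ext_mono (le_max_right _ _) hy))
  have h3 := h t ht R hρ
  have h4 := h' t ht R hρ'
  rw [e] at h4
  have h5 : hflux (U t) R - Q t = (hflux (U t) R - hflux (W t) R) + (hflux (W t) R - Q t) := by ring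
  rw [h5, add_mul]
  exact (abs_add_le _ _).trans (add_le_add h4 h3)

lemma charge_eq_of_tendsto {V : E n → ℝ} {Y : VField n} {γ κ : Tensor2 n} {q : ℝ}
    (h : Tendsto (flux V Y γ κ) atTop (𝓝 q)) : charge V Y γ κ = q := h.limUnder_eq

lemma flux_zero_zero (γ κ : Tensor2 n) (R : ℝ) : flux 0 0 γ κ R = 0 := by
  have h : ∀ y j, chargeDensity (0 : E n → ℝ) 0 γ κ y j = 0 := by
    intro y j
    have h0 : ∀ i, pd i (0 : E n → ℝ) y = 0 := fun i => (HasPd.const 0).2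
    simp [chargeDensity, contr, grad, h0]
  simp [flux, h]

lemma charge_zero_zero (γ κ : Tensor2 n) : charge 0 0 γ κ = 0 :=
  charge_eq_of_tendsto (by
    have : flux 0 0 γ κ = fun _ => 0 := funext (flux_zero_zero γ κ)
    rw [this]; exact tendsto_const_nhds)

namespace RescaledData

variable {I : Set ℝ} {τ ε δ : ℝ} {g k : ℝ → Tensor2 n} {V : E n → ℝ} {Y : VField n}

lemma chargeExists_pot (hn : 2 ≤ n) (hD : RescaledData I τ ε g k) (hV : StaticPotential V)
    (hδ0 : 0 < δ) (hδ : δ ≤ ε) (hδ' : n + δ ≤ 2 * τ) {t : ℝ} (ht : t ∈ I) :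
    ChargeExists V 0 (g t - hyp n) (k t) := by
  obtain ⟨C, ρ, h⟩ := hD.exists_limit_flux_pot hn hV hδ0 hδ hδ'
  obtain ⟨q, hq, -⟩ := h t ht
  exact ⟨q, hq⟩

lemma chargeExists_kill (hn : 2 ≤ n) (hD : RescaledData I τ ε g k) (hY : KillingField Y)
    (hδ0 : 0 < δ) (hδ : δ ≤ ε) (hδ' : n + δ ≤ 2 * τ) {t : ℝ} (ht : t ∈ I) :
    ChargeExists 0 Y (g t - hyp n) (k t) := by
  obtain ⟨C, ρ, h⟩ := hD.exists_limit_flux_kill hn hY hδ0 hδ hδ'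
  obtain ⟨q, hq, -⟩ := h t ht
  exact ⟨q, hq⟩

lemma abs_hflux_sub_charge_pot (hn : 2 ≤ n) (hD : RescaledData I τ ε g k)
    (hV : StaticPotential V) (hδ0 : 0 < δ) (hδ : δ ≤ ε) (hδ' : n + δ ≤ 2 * τ) :
    ∃ C ρ : ℝ, ∀ t ∈ I, ∀ R, ρ < R → |hflux (potDensity V (rs (g t - hyp n))) R
      - charge V 0 (g t - hyp n) (k t)| ≤ C * Real.exp (-(δ * R)) := by
  obtain ⟨C, ρ, h⟩ := hD.exists_limit_flux_pot hn hV hδ0 hδ hδ'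
  refine ⟨C, ρ, fun t ht R hR => ?_⟩
  obtain ⟨q, hq, hq'⟩ := h t ht
  rw [charge_eq_of_tendsto hq]
  exact hq' R hR

lemma abs_hflux_sub_charge_kill (hn : 2 ≤ n) (hD : RescaledData I τ ε g k)
    (hY : KillingField Y) (hδ0 : 0 < δ) (hδ : δ ≤ ε) (hδ' : n + δ ≤ 2 * τ) :
    ∃ C ρ : ℝ, ∀ t ∈ I, ∀ R, ρ < R → |hflux (killDensity Y (rs (k t))) R
      - charge 0 Y (g t - hyp n) (k t)| ≤ C * Real.exp (-(δ * R)) := by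
  obtain ⟨C, ρ, h⟩ := hD.exists_limit_flux_kill hn hY hδ0 hδ hδ'
  refine ⟨C, ρ, fun t ht R hR => ?_⟩
  obtain ⟨q, hq, hq'⟩ := h t ht
  rw [charge_eq_of_tendsto hq]
  exact hq' R hR

/-- The fluxes with `g` in place of the background metric in the derivative terms converge to the
charge, uniformly in time. -/
lemma abs_hflux_potUp_sub_charge (hn : 2 ≤ n) (hD : RescaledData I τ ε g k)
    (hV : StaticPotential V) (hδ0 : 0 < δ) (hδ : δ ≤ ε) (hδ' : n + δ ≤ 2 * τ) :
    ∃ C ρ : ℝ, ∀ t ∈ I, ∀ R, ρ < R → |hflux (potUp V (up (g t)) (rs (g t - hyp n))) R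
      - charge V 0 (g t - hyp n) (k t)| ≤ C * Real.exp (-(δ * R)) := by
  have hh := fun i j => (hD.metric.b1 i j).smooth
  refine abs_hflux_sub_le hn (JS.potUp hV hD.metric.smooth_up hh) (JS.potDensity hV hh)
    (fun j => ?_) (hD.abs_hflux_sub_charge_pot hn hV hδ0 hδ hδ')
  have h1 : BO I (1 - n - δ) (fun t y => ∑ i, ∑ l, (up (g t) y i l - kd i l) *
      (pd l (fun x => rs (g t - hyp n) x i j) y - pd j (fun x => rs (g t - hyp n) x i l) y)) :=
    BO.sum fun i _ => BO.sum fun l _ => (hD.metric.b1_up_sub i l).bO.mul_le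
      ((hD.metric.b1_pd l i j).bO.sub (hD.metric.b1_pd j i l).bO) (by linarith)
  refine ((hV.bO I).mul_le h1 (by linarith)).congr (nearInf_true.mono fun t _ y _ _ => ?_)
  rw [← divTrUp_sub_divTr, potUp, potDensity]; ring

lemma bO_V₀_mul (hV : StaticPotential V) {a : ℝ} {f : ℝ → E n → ℝ} (hf : BO I a f) :
    BO I (2 + a) (fun t y => 2 * V₀ y * V y * f t y) := by
  have h1 : BO I 2 (fun _ y => 2 * V₀ y * V y) :=
    ((staticPotential_V₀.bO I).const_mul 2).mul_le (hV.bO I) (by norm_num)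
  exact h1.mul hf

/-- The time derivative of the rescaled inverse metric. -/
noncomputable def upRate (G k : Tensor2 n) : Tensor2 n := fun y => Matrix.of fun i l =>
  -∑ b, ∑ a, up G y i a * (2 * V₀ y * rs k y a b) * up G y b l

lemma smooth_upRate (hD : RescaledData I τ ε g k) (i l : Fin n) :
    JS I (fun t y => upRate (g t) (k t) y i l) := by
  unfold upRate
  simp only [Matrix.of_apply]
  have hNs : JS I (fun _ (y : E n) => V₀ y) := JS.of_space staticPotential_V₀.smooth
  exact (JS.sum fun b => JS.sum fun a => ((hD.metric.smooth_up i a).mul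
    (((JS.const 2).mul hNs).mul (hD.second a b).smooth)).mul (hD.metric.smooth_up b l)).neg

/-- The lapse costs one power of ω, paid for by the extra decay of k; hence the time derivative of
the inverse metric decays like h itself. -/
lemma bO_upRate (hD : RescaledData I τ ε g k) (i l : Fin n) :
    BO I (-τ) (fun t y => upRate (g t) (k t) y i l) := by
  unfold upRate
  simp only [Matrix.of_apply]
  refine (BO.sum fun b _ => BO.sum fun a _ => BO.mul_le (a := -τ) (b := 0) ?_
    (hD.metric.bO_up b l) (by linarith)).neg
  exact (hD.metric.bO_up i a).mul_le (b := -τ)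
    (((staticPotential_V₀.bO I).const_mul 2).mul_le (hD.second_extra a b) (by linarith))
    (by linarith)

/-- Three errors must be O(ω^{2-n-δ}). The term 2V_(0)V `divTrUp` is controlled by J and
undifferentiated k; the term with the rate of A pairs it with ∂h; the last pairs A - 1 with k under
a weight ω³. The second and third have order 2 - 2τ, and each of the three uses the pointwise rate τ
+ 1 of k. -/
lemma abs_hflux_potUpRate_sub_charge (hn : 2 ≤ n) (hD : RescaledData I τ ε g k)
    (hV : StaticPotential V) (hY : KillingField Y) (hδ0 : 0 < δ) (hδ : δ ≤ ε)
    (hδ' : n + δ ≤ 2 * τ) :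
    ∃ C ρ : ℝ, ∀ t ∈ I, ∀ R, ρ < R →
      |hflux (potUpRate V Y (up (g t)) (upRate (g t) (k t)) (rs (g t - hyp n)) (rs (k t))) R
      - charge 0 Y (g t - hyp n) (k t)| ≤ C * Real.exp (-(δ * R)) := by
  have hh := fun i j => (hD.metric.b1 i j).smooth
  have hq := fun i j => (hD.second i j).smooth
  refine abs_hflux_sub_le hn (JS.potUpRate hV hY hD.metric.smooth_up hD.smooth_upRate hh hq)
    (JS.killDensity hY hq) (fun j => ?_) (hD.abs_hflux_sub_charge_kill hn hY hδ0 hδ hδ')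
  have h1 : BO I (2 - n - δ) (fun t y => 2 * V₀ y * V y *
      divTrUp (up (g t)) (rs (k t)) y j) :=
    (bO_V₀_mul hV (hD.bO_divTrUp hD.second_extra (c := -n - δ) (by linarith) (by linarith) j)).mono
      (by linarith)
  have h2 : BO I (2 - n - δ) (fun t y => V y * ∑ i, ∑ l, upRate (g t) (k t) y i l *
      (pd l (fun x => rs (g t - hyp n) x i j) y - pd j (fun x => rs (g t - hyp n) x i l) y)) :=
    (hV.bO I).mul_le (b := 1 - n - δ) (BO.sum fun i _ => BO.sum fun l _ =>
      (hD.bO_upRate i l).mul_le ((hD.metric.b1_pd l i j).bO.sub (hD.metric.b1_pd j i l).bO)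
        (by linarith)) (by linarith)
  have h3 : BO I (2 - n - δ) (fun t y => 2 * V y * om y ^ 2 * ∑ i, ∑ l,
      (up (g t) y i l - kd i l) * (y l * rs (k t) y i j - y j * rs (k t) y i l)) := by
    have h4 : BO I 3 (fun _ y => 2 * V y * om y ^ 2) :=
      ((hV.bO I).const_mul 2).mul_le (BO.om_pow 2) (by norm_num)
    refine h4.mul_le (b := -1 - n - δ) (BO.sum fun i _ => BO.sum fun l _ =>
      (hD.metric.b1_up_sub i l).bO.mul_le (b := -(τ + 1)) (BO.sub ?_ ?_) (by linarith))
      (by linarith)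
    · exact (BO.coord l).mul_le (hD.second_extra i j) (by linarith)
    · exact (BO.coord j).mul_le (hD.second_extra i l) (by linarith)
  refine ((h1.add h2).add h3).congr (nearInf_true.mono fun t _ y _ _ => ?_)
  rw [potUpRate]; ring

/-- With A = 1 and A' = 0 only the term 2V_(0)V `divTr` survives. Its weight ω² is compensated
because here ∂k has the better rate too. -/
lemma abs_hflux_rate_sub_charge (hn : 2 ≤ n) (hD : RescaledData I τ ε g k)
    (hk : ∀ i j, B1 I (-(τ + 1)) (fun t y => rs (k t) y i j))
    (hV : StaticPotential V) (hY : KillingField Y) (hδ0 : 0 < δ) (hδ : δ ≤ ε)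
    (hδ' : n + δ ≤ 2 * τ) :
    ∃ C ρ : ℝ, ∀ t ∈ I, ∀ R, ρ < R →
      |hflux (potUpRate V Y (fun _ => 1) 0 (rs (g t - hyp n)) (rs (k t))) R
      - charge 0 Y (g t - hyp n) (k t)| ≤ C * Real.exp (-(δ * R)) := by
  have hh := fun i j => (hD.metric.b1 i j).smooth
  have hq := fun i j => (hD.second i j).smooth
  refine abs_hflux_sub_le hn (JS.potUpRate (A := fun _ _ => 1) (A' := fun _ => 0) hV hY
    (fun i j => JS.const _) (fun i j => JS.const 0) hh hq)
    (JS.killDensity hY hq) (fun j => ?_) (hD.abs_hflux_sub_charge_kill hn hY hδ0 hδ hδ')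
  refine ((bO_V₀_mul hV (hD.bO_divTr hk (c := -n - δ) (by linarith) (by linarith) j)).mono
    (b := 2 - n - δ) (by linarith)).congr (nearInf_true.mono fun t _ y _ _ => ?_)
  have e : ∀ i l, (1 : Matrix (Fin n) (Fin n) ℝ) i l = kd i l := fun i l => by
    rw [Matrix.one_apply, kd]
  rw [potUpRate, divTrUp_one]
  simp [e]

end RescaledData

/-! ### Evolving data and the interchange of limit and derivative -/

/-- On `J × ext ρ₀` the data are smooth and satisfy `∂_t g = 2 V_(0) k`. -/
structure EvolvesOn (J : Set ℝ) (ρ₀ : ℝ) (g k : ℝ → Tensor2 n) : Prop where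
  isOpen : IsOpen J
  smooth_g : ∀ t ∈ J, ∀ y ∈ ext n ρ₀, ∀ i j,
    ContDiffAt ℝ ∞ (fun p : ℝ × E n => g p.1 p.2 i j) (t, y)
  smooth_k : ∀ t ∈ J, ∀ y ∈ ext n ρ₀, ∀ i j,
    ContDiffAt ℝ ∞ (fun p : ℝ × E n => k p.1 p.2 i j) (t, y)
  evol : ∀ t ∈ J, ∀ y ∈ ext n ρ₀, ∀ i j,
    HasDerivAt (fun s => g s y i j) (2 * V₀ y * k t y i j) t
  symm_g : ∀ t y i j, g t y i j = g t y j i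
  symm_k : ∀ t y i j, k t y i j = k t y j i

namespace EvolvesOn

variable {J : Set ℝ} {ρ₀ τ ε δ : ℝ} {g k : ℝ → Tensor2 n} {V : E n → ℝ} {Y : VField n}

lemma contDiffAt_rs (hJ : EvolvesOn J ρ₀ g k) {t : ℝ} (ht : t ∈ J) {y : E n} (hy : y ∈ ext n ρ₀)
    (i j : Fin n) : ContDiffAt ℝ ∞ (fun p : ℝ × E n => rs (g p.1) p.2 i j) (t, y) :=
  ContDiffAt.mul ((contDiffAt_om_sq_inv hy.1).comp (f := Prod.snd) (t, y) contDiffAt_snd)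
    (hJ.smooth_g t ht y hy i j)

lemma contDiffAt_rs_sub (hJ : EvolvesOn J ρ₀ g k) {t : ℝ} (ht : t ∈ J) {y : E n}
    (hy : y ∈ ext n ρ₀) (i j : Fin n) :
    ContDiffAt ℝ ∞ (fun p : ℝ × E n => rs (g p.1 - hyp n) p.2 i j) (t, y) := by
  refine ((hJ.contDiffAt_rs ht hy i j).sub (contDiffAt_const (c := kd i j))).congr_of_eventuallyEq ?_
  have h1 : ∀ᶠ p : ℝ × E n in 𝓝 (t, y), ‖p.2‖ < 1 :=
    (continuous_snd.tendsto (t, y)).eventually (ball_eventually hy.1)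
  filter_upwards [h1] with p hp
  rw [rs_sub_hyp (g p.1) hp]; ring

lemma differentiableAt_rs_k (hJ : EvolvesOn J ρ₀ g k) {t : ℝ} (ht : t ∈ J) {y : E n}
    (hy : y ∈ ext n ρ₀) (i j : Fin n) : DifferentiableAt ℝ (fun x => rs (k t) x i j) y :=
  ((contDiffAt_om_sq_inv hy.1).mul (contDiffAt_slice (f := fun t y => k t y i j)
    (hJ.smooth_k t ht y hy i j))).differentiableAt (by simp)

lemma hasDerivAt_rs (hJ : EvolvesOn J ρ₀ g k) {t : ℝ} (ht : t ∈ J) {y : E n}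
    (hy : y ∈ ext n ρ₀) (i j : Fin n) :
    HasDerivAt (fun s => rs (g s) y i j) (2 * V₀ y * rs (k t) y i j) t :=
  ((hJ.evol t ht y hy i j).const_mul ((om y ^ 2)⁻¹)).congr_deriv (by rw [rs_apply]; ring)

lemma hasDerivAt_rs_sub (hJ : EvolvesOn J ρ₀ g k) {t : ℝ} (ht : t ∈ J) {y : E n}
    (hy : y ∈ ext n ρ₀) (i j : Fin n) :
    HasDerivAt (fun s => rs (g s - hyp n) y i j) (2 * V₀ y * rs (k t) y i j) t := by
  have h := (hJ.hasDerivAt_rs ht hy i j).sub_const (kd i j)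
  have e : (fun s => rs (g s - hyp n) y i j) = fun s => rs (g s) y i j - kd i j := by
    ext s; rw [rs_sub_hyp (g s) hy.1]; ring
  rw [e]; exact h

/-- The formula for the derivative of an inverse matrix, with time as the parameter. -/
lemma hasDerivAt_up (hJ : EvolvesOn J ρ₀ g k) {t : ℝ} (ht : t ∈ J) {y : E n} (hy : y ∈ ext n ρ₀)
    (hdet : IsUnit (rs (g t) y).det) (i j : Fin n) :
    HasDerivAt (fun s => up (g s) y i j) (RescaledData.upRate (g t) (k t) y i j) t := by
  have hs : ∀ i j, ContDiffAt ℝ ∞ (fun s => rs (g s) y i j) t := fun i j =>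
    (hJ.contDiffAt_rs ht hy i j).comp (f := fun s : ℝ => (s, y)) t (by fun_prop)
  have h1 : DifferentiableAt ℝ (fun s => up (g s) y i j) t :=
    (contDiffAt_matrix_inv (N := fun s => rs (g s) y) hs hdet i j).differentiableAt (by simp)
  refine h1.hasDerivAt.congr_deriv ?_
  have h2 := fderiv_matrix_inv (N := fun s => rs (g s) y) hs hdet 1 i j
  have h3 : ∀ a b, fderiv ℝ (fun s => rs (g s) y a b) t 1 = 2 * V₀ y * rs (k t) y a b :=
    fun a b => (hJ.hasDerivAt_rs ht hy a b).deriv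
  simp only [h3] at h2
  exact h2

lemma rescaledData (hJ : EvolvesOn J ρ₀ g k) {I : Set ℝ} (hI : I ⊆ J) (hτ : 0 < τ)
    (h : DataDecay I τ ε g k) : RescaledData I τ ε g k := by
  have hg : ∀ i j, JS I (fun t y => g t y i j) := fun i j =>
    ⟨ρ₀, fun t ht y hy => hJ.smooth_g t (hI ht) y hy i j⟩
  have hk : ∀ i j, JS I (fun t y => k t y i j) := fun i j =>
    ⟨ρ₀, fun t ht y hy => hJ.smooth_k t (hI ht) y hy i j⟩
  have hb : ∀ i j, JS I (fun _ y => hyp n y i j) := fun i j => JS.of_space fun y hy => by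
    simp only [hyp_apply]
    exact ((contDiffAt_om hy).pow 2).mul contDiffAt_const
  have hγ : ∀ i j, JS I (fun t y => (g t - hyp n) y i j) := fun i j => (hg i j).sub (hb i j)
  exact
    { metric :=
        { τ_pos := hτ
          symm := hJ.symm_g
          smooth := hg
          b1 := (h.metric.b1_two hγ).1
          b1_pd := (h.metric.b1_two hγ).2 }
      symm := hJ.symm_k
      second := h.second.b1_one hk
      second_extra := h.second_extra.bO_zero
      energy := h.energy.bO_ofFun
      -- A one-form gains one power of ω in coordinates: 1 - (n + 1 + ε) = -(n + ε).
      momentum := fun j => (h.momentum.bO_ofOneForm j).mono (by linarith) }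

/-- Under uniform decay the charge of `V` is differentiable, with the charge of the conjugate
Killing field as its derivative. -/
theorem hasDerivAt_charge (hJ : EvolvesOn J ρ₀ g k) (hn : 2 ≤ n) {I : Set ℝ} (hI : IsOpen I)
    (hIJ : I ⊆ J) (hD : RescaledData I τ ε g k) (hV : StaticPotential V) (hY : KillingField Y)
    (hVY : Conjugate V Y) (hδ0 : 0 < δ) (hδ : δ ≤ ε) (hδ' : n + δ ≤ 2 * τ) {t : ℝ} (ht : t ∈ I) :
    HasDerivAt (fun t => charge V 0 (g t - hyp n) (k t)) (charge 0 Y (g t - hyp n) (k t)) t := by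
  obtain ⟨C, ρ, h⟩ := hD.abs_hflux_potUp_sub_charge hn hV hδ0 hδ hδ'
  obtain ⟨C', ρ', h'⟩ := hD.abs_hflux_potUpRate_sub_charge hn hV hY hδ0 hδ hδ'
  obtain ⟨ρ₁, h₁⟩ := NearInf.all (JS.potUp hV hD.metric.smooth_up
    fun i j => (hD.metric.b1 i j).smooth)
  obtain ⟨ρ₂, h₂⟩ := hD.metric.nearInf_det
  -- The derivatives of the modified fluxes converge uniformly in t, and the modified fluxes
  -- themselves pointwise to the charge.
  refine hasDerivAt_of_tendstoUniformlyOn (l := atTop) hI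
    (f := fun R t => hflux (potUp V (up (g t)) (rs (g t - hyp n))) R)
    (f' := fun R t => hflux (potUpRate V Y (up (g t)) (RescaledData.upRate (g t) (k t))
      (rs (g t - hyp n)) (rs (k t))) R)
    (g' := fun t => charge 0 Y (g t - hyp n) (k t)) ?_ ?_ ?_ ht
  · rw [Metric.tendstoUniformlyOn_iff]
    intro e he
    filter_upwards [eventually_gt_atTop ρ', (tendsto_exp_neg_mul hδ0 C').eventually_lt_const he]
      with R hR hlt s hs
    rw [dist_comm, Real.dist_eq]
    exact (h' s hs R hR).trans_lt hlt
  · filter_upwards [eventually_gt_atTop ρ₁, eventually_gt_atTop ρ₂, eventually_gt_atTop ρ₀,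
      eventually_gt_atTop 0] with R hR₁ hR₂ hR₀ hR s hs
    refine hasDerivAt_hflux_param hI (ρ := max ρ₀ (max ρ₁ ρ₂))
      (U := fun t => potUp V (up (g t)) (rs (g t - hyp n)))
      (U' := fun t => potUpRate V Y (up (g t)) (RescaledData.upRate (g t) (k t))
      (rs (g t - hyp n)) (rs (k t))) ?_ ?_ hs hR (max_lt hR₀ (max_lt hR₁ hR₂))
    · intro t ht y hy j
      exact h₁ t ht y (ext_mono ((le_max_left _ _).trans (le_max_right _ _)) hy) j
    · intro t ht y hy j
      have hy0 : y ∈ ext n ρ₀ := ext_mono (le_max_left _ _) hy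
      have hy2 := ext_mono ((le_max_right _ _).trans (le_max_right _ _)) hy
      refine hasDerivAt_potUp hVY (A := fun t => up (g t)) (h := fun t => rs (g t - hyp n)) hy.1
        (hJ.differentiableAt_rs_k (hIJ ht) hy0)
        (hJ.hasDerivAt_up (hIJ ht) hy0 (h₂ t ht y hy2).1)
        (hJ.contDiffAt_rs_sub (hIJ ht) hy0) ?_ j
      filter_upwards [(isOpen_ext ρ₀).mem_nhds hy0] with x hx i j
      exact hJ.hasDerivAt_rs_sub (hIJ ht) hx i j
  · intro s hs
    rw [tendsto_iff_dist_tendsto_zero]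
    refine squeeze_zero' (Eventually.of_forall fun _ => dist_nonneg) ?_
      (tendsto_exp_neg_mul hδ0 C)
    filter_upwards [eventually_gt_atTop ρ] with R hR
    rw [Real.dist_eq]
    exact h s hs R hR

/-- The time derivatives of the fluxes at a time at which `k = O₁(e^{-(τ + 1) r})`. -/
theorem hasDerivAt_flux (hJ : EvolvesOn J ρ₀ g k) (hn : 2 ≤ n) {t : ℝ} (ht : t ∈ J)
    (hD : RescaledData {t} τ ε g k) (hk : ∀ i j, B1 {t} (-(τ + 1)) (fun t y => rs (k t) y i j))
    (hV : StaticPotential V) (hY : KillingField Y)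
    (hVY : Conjugate V Y) (hδ0 : 0 < δ) (hδ : δ ≤ ε) (hδ' : n + δ ≤ 2 * τ) :
    ∃ F' : ℝ → ℝ, Tendsto F' atTop (𝓝 (charge 0 Y (g t - hyp n) (k t))) ∧
      ∀ᶠ R in atTop, HasDerivAt (fun t => flux V 0 (g t - hyp n) (k t) R) (F' R) t := by
  obtain ⟨C, ρ, h⟩ := hD.abs_hflux_rate_sub_charge hn hk hV hY hδ0 hδ hδ'
  -- The unmodified flux is the case A = 1 with A' = 0.
  refine ⟨hflux (potUpRate V Y (fun _ => 1) 0 (rs (g t - hyp n)) (rs (k t))), ?_, ?_⟩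
  · rw [tendsto_iff_dist_tendsto_zero]
    refine squeeze_zero' (Eventually.of_forall fun _ => dist_nonneg) ?_
      (tendsto_exp_neg_mul hδ0 C)
    filter_upwards [eventually_gt_atTop ρ] with R hR
    rw [Real.dist_eq]
    exact h t rfl R hR
  -- Differentiating at t involves neighbouring times, where smoothness is available but no decay;
  -- decay enters only in the limit R → ∞ at the time t.
  · have hsm : ∀ i j, JS J (fun t y => rs (g t - hyp n) y i j) := fun i j =>
      ⟨ρ₀, fun t ht y hy => hJ.contDiffAt_rs_sub ht hy i j⟩
    obtain ⟨ρ₁, h₁⟩ := NearInf.all (JS.potUp (A := fun _ _ => 1) hV (fun i j => JS.const _) hsm)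
    filter_upwards [eventually_gt_atTop ρ₁, eventually_gt_atTop ρ₀, eventually_gt_atTop 0]
      with R hR₁ hR₀ hR
    have key := hasDerivAt_hflux_param hJ.isOpen (ρ := max ρ₀ ρ₁)
      (U := fun t => potUp V (fun _ => 1) (rs (g t - hyp n)))
      (U' := fun t => potUpRate V Y (fun _ => 1) 0 (rs (g t - hyp n)) (rs (k t))) ?_ ?_ ht hR
      (max_lt hR₀ hR₁)
    · refine key.congr_of_eventuallyEq ?_
      filter_upwards [hJ.isOpen.mem_nhds ht] with s hs
      refine hflux_congr hR hR₀ fun y hy j => ?_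
      rw [potUp_one]
      refine chargeDensity_zero_right V (k s) hy.1 (fun i j => ?_) (fun i j => ?_) j
      · simp only [Pi.sub_apply, Matrix.sub_apply, hyp_apply, hJ.symm_g s y i j, kd_comm i j]
      · exact (contDiffAt_slice (f := fun t y => rs (g t - hyp n) y i j)
          (hJ.contDiffAt_rs_sub hs hy i j)).differentiableAt (by simp)
    · intro t ht y hy j
      exact h₁ t ht y (ext_mono (le_max_right _ _) hy) j
    · intro t ht y hy j
      have hy0 : y ∈ ext n ρ₀ := ext_mono (le_max_left _ _) hy
      refine hasDerivAt_potUp hVY (A := fun _ _ => 1) (A' := 0) (h := fun t => rs (g t - hyp n))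
        hy.1 (hJ.differentiableAt_rs_k ht hy0) (fun i j => hasDerivAt_const _ _)
        (hJ.contDiffAt_rs_sub ht hy0) ?_ j
      filter_upwards [(isOpen_ext ρ₀).mem_nhds hy0] with x hx i j
      exact hJ.hasDerivAt_rs_sub ht hx i j

end EvolvesOn

/-- The data of an evolution in an asymptotic chart, in coordinates. -/
lemma evolvesOn_of_chart {M : Type*} [TopologicalSpace M] [ChartedSpace (E n) M]
    [IsManifold (𝓡 n) ∞ M] (c : ChartAtInfinity n M) {T : ℝ}
    {gM : ℝ → RMetric n M} {kM : ℝ → BilinField n M} (hkM : ∀ t x u v, kM t x u v = kM t x v u)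
    {g k : ℝ → Tensor2 n} (hg : ∀ t, g t = c.push (gM t).inner) (hk : ∀ t, k t = c.push (kM t))
    (hg_smooth : ∀ i j : Fin n, ContDiffOn ℝ ∞ (fun p : ℝ × E n => g p.1 p.2 i j)
      (Set.Ioo (-T) T ×ˢ ext n c.R))
    (hk_smooth : ∀ i j : Fin n, ContDiffOn ℝ ∞ (fun p : ℝ × E n => k p.1 p.2 i j)
      (Set.Ioo (-T) T ×ˢ ext n c.R))
    {S : ℝ → Tensor2 n} (hev : EinsteinEvolution (Set.Ioo (-T) T) (ext n c.R) V₀ 0 S g k) :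
    EvolvesOn (Set.Ioo (-T) T) c.R g k where
  isOpen := isOpen_Ioo
  smooth_g t ht y hy i j := (hg_smooth i j).contDiffAt
    ((isOpen_Ioo.prod (isOpen_ext c.R)).mem_nhds ⟨ht, hy⟩)
  smooth_k t ht y hy i j := (hk_smooth i j).contDiffAt
    ((isOpen_Ioo.prod (isOpen_ext c.R)).mem_nhds ⟨ht, hy⟩)
  evol t ht y hy i j := by
    -- The shift is zero, so the Lie derivative term vanishes.
    refine (hev t ht y hy i j).1.congr_deriv ?_
    have h0 : ∀ a : Fin n, pd a (fun _ : E n => (0 : ℝ)) y = 0 := fun _ => (HasPd.const 0).2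
    simp [metricRate, lieDeriv, h0]
  symm_g t y i j := by
    rw [hg]
    exact (gM t).symm _ _ _
  symm_k t y i j := by
    rw [hk]
    exact hkM t _ _ _

end AHData

/-! ### The theorem -/

theorem mainTheorem3 (n : ℕ) (hn : 3 ≤ n)
    {M : Type*} [TopologicalSpace M] [ChartedSpace (AHData.E n) M] [IsManifold (𝓡 n) ∞ M]
    (c : AHData.ChartAtInfinity n M)
    (τ ε T : ℝ) (hτ : (n : ℝ) / 2 < τ) (hε : 0 < ε) (hT : 0 < T)
    (gM : ℝ → AHData.RMetric n M) (kM : ℝ → AHData.BilinField n M)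
    (hkM : ∀ t x u v, kM t x u v = kM t x v u)
    (g k : ℝ → AHData.Tensor2 n)
    (hg : ∀ t, g t = c.push (gM t).inner) (hk : ∀ t, k t = c.push (kM t))
    (hg_smooth : ∀ i j : Fin n, ContDiffOn ℝ ∞ (fun p : ℝ × AHData.E n => g p.1 p.2 i j)
      (Set.Ioo (-T) T ×ˢ AHData.ext n c.R))
    (hk_smooth : ∀ i j : Fin n, ContDiffOn ℝ ∞ (fun p : ℝ × AHData.E n => k p.1 p.2 i j)
      (Set.Ioo (-T) T ×ˢ AHData.ext n c.R))
    (S : ℝ → AHData.Tensor2 n)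
    (hev : AHData.EinsteinEvolution (Set.Ioo (-T) T) (AHData.ext n c.R) AHData.V₀ 0 S g k)
    (hdata : AHData.DataDecay {0} τ ε g k) :
    -- the charges of the initial data set are well-defined
    (AHData.ChargeExists AHData.V₀ 0 (g 0 - AHData.hyp n) (k 0) ∧
      ∀ i : Fin n, AHData.ChargeExists (AHData.Vᵢ i) 0 (g 0 - AHData.hyp n) (k 0) ∧
        AHData.ChargeExists 0 (AHData.Cᵢ i) (g 0 - AHData.hyp n) (k 0)) ∧
    -- if the decay persists uniformly for short time, the charges are differentiable at `t = 0`
    (∀ T' : ℝ, 0 < T' → T' ≤ T → AHData.DataDecay (Set.Ioo (-T') T') τ ε g k →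
      (∀ t ∈ Set.Ioo (-T') T',
        AHData.ChargeExists AHData.V₀ 0 (g t - AHData.hyp n) (k t) ∧
        ∀ i : Fin n, AHData.ChargeExists (AHData.Vᵢ i) 0 (g t - AHData.hyp n) (k t)) ∧
      HasDerivAt (fun t => AHData.charge AHData.V₀ 0 (g t - AHData.hyp n) (k t)) 0 0 ∧
      ∀ i : Fin n,
        HasDerivAt (fun t => AHData.charge (AHData.Vᵢ i) 0 (g t - AHData.hyp n) (k t))
          (AHData.charge 0 (AHData.Cᵢ i) (g 0 - AHData.hyp n) (k 0)) 0) ∧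
    -- with decay at `t = 0` only, the same holds with the derivative taken before the limit
    (AHData.DecaysOn {0} 1 (τ + 1) (fun t => AHData.ofTensor2 (k t)) →
      (∀ᶠ R in atTop,
        DifferentiableAt ℝ
          (fun t => AHData.flux AHData.V₀ 0 (g t - AHData.hyp n) (k t) R) 0 ∧
        ∀ i : Fin n, DifferentiableAt ℝ
          (fun t => AHData.flux (AHData.Vᵢ i) 0 (g t - AHData.hyp n) (k t) R) 0) ∧
      Tendsto
        (fun R => deriv (fun t => AHData.flux AHData.V₀ 0 (g t - AHData.hyp n) (k t) R) 0)
        atTop (𝓝 0) ∧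
      ∀ i : Fin n, Tendsto
        (fun R => deriv
          (fun t => AHData.flux (AHData.Vᵢ i) 0 (g t - AHData.hyp n) (k t) R) 0)
        atTop (𝓝 (AHData.charge 0 (AHData.Cᵢ i) (g 0 - AHData.hyp n) (k 0)))) := by
  have hn2 : 2 ≤ n := by omega
  have hn0 : (0 : ℝ) ≤ n := Nat.cast_nonneg n
  have hJ := AHData.evolvesOn_of_chart c hkM hg hk hg_smooth hk_smooth hev
  have hτ0 : 0 < τ := by linarith
  -- One rate for everything: δ ≤ ε absorbs μ and J, and n + δ ≤ 2τ absorbs the quadratic errors. It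
  -- is positive because τ > n/2.
  obtain ⟨δ, hδ0, hδ, hδ'⟩ : ∃ δ : ℝ, 0 < δ ∧ δ ≤ ε ∧ n + δ ≤ 2 * τ :=
    ⟨min ε (2 * τ - n), lt_min hε (by linarith), min_le_left _ _,
      by linarith [min_le_right ε (2 * τ - n)]⟩
  have h0T : (0 : ℝ) ∈ Set.Ioo (-T) T := ⟨by linarith, hT⟩
  have hD0 := hJ.rescaledData (Set.singleton_subset_iff.2 h0T) hτ0 hdata
  have pV₀ : AHData.StaticPotential (AHData.V₀ : AHData.E n → ℝ) := AHData.staticPotential_V₀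
  refine ⟨⟨hD0.chargeExists_pot hn2 pV₀ hδ0 hδ hδ' rfl, fun i =>
    ⟨hD0.chargeExists_pot hn2 (AHData.staticPotential_Vᵢ i) hδ0 hδ hδ' rfl,
      hD0.chargeExists_kill hn2 (AHData.killingField_Cᵢ i) hδ0 hδ hδ' rfl⟩⟩, ?_, ?_⟩
  · intro T' hT' hT'T hdecay
    have hsub : Set.Ioo (-T') T' ⊆ Set.Ioo (-T) T := Set.Ioo_subset_Ioo (by linarith) hT'T
    have hD := hJ.rescaledData hsub hτ0 hdecay
    have h0 : (0 : ℝ) ∈ Set.Ioo (-T') T' := ⟨by linarith, hT'⟩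
    refine ⟨fun t ht => ⟨hD.chargeExists_pot hn2 pV₀ hδ0 hδ hδ' ht, fun i =>
      hD.chargeExists_pot hn2 (AHData.staticPotential_Vᵢ i) hδ0 hδ hδ' ht⟩, ?_, fun i => ?_⟩
    · have h := hJ.hasDerivAt_charge hn2 isOpen_Ioo hsub hD pV₀ AHData.killingField_zero
        AHData.conjugate_V₀ hδ0 hδ hδ' h0
      -- The field conjugate to V_(0) is zero, so the derivative obtained is the charge of the zero
      -- pair.
      rwa [AHData.charge_zero_zero] at h
    · exact hJ.hasDerivAt_charge hn2 isOpen_Ioo hsub hD (AHData.staticPotential_Vᵢ i)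
        (AHData.killingField_Cᵢ i) (AHData.conjugate_Vᵢ i) hδ0 hδ hδ' h0
  · intro hk1
    -- The extra hypothesis on k is converted into a bound in rescaled components at the single time
    -- 0.
    have hkB := hk1.b1_one fun i j =>
      ⟨c.R, fun t ht y hy => hJ.smooth_k t (by rw [Set.mem_singleton_iff.1 ht]; exact h0T) y hy i j⟩
    obtain ⟨F₀, hF₀, hF₀'⟩ := hJ.hasDerivAt_flux hn2 h0T hD0 hkB pV₀ AHData.killingField_zero
      AHData.conjugate_V₀ hδ0 hδ hδ'
    rw [AHData.charge_zero_zero] at hF₀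
    choose F hF hF' using fun i => hJ.hasDerivAt_flux hn2 h0T hD0 hkB
      (AHData.staticPotential_Vᵢ i) (AHData.killingField_Cᵢ i) (AHData.conjugate_Vᵢ i) hδ0 hδ hδ'
    refine ⟨?_, hF₀.congr' ?_, fun i => (hF i).congr' ?_⟩
    · filter_upwards [hF₀', Filter.eventually_all.2 hF'] with R hR hR'
      exact ⟨hR.differentiableAt, fun i => (hR' i).differentiableAt⟩
    · filter_upwards [hF₀'] with R hR using hR.deriv.symm
    · filter_upwards [hF' i] with R hR using hR.deriv.symm
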